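/- Let $\bar e_0>0$, $\bar v>0$ and $\bar e(t)=\bar e_0+t\bar v$. Let $\tau_1\ge 0$, $\sigma>0$, $\lambda>0$ and $g^{\tau_1}\in L^2(0,\bar e(\tau_1))$. Consider the problem $$\partial_t g-\sigma\,\partial_{xx}^2g+\lambda g=0\quad (t>\tau_1,\ 0<x<\bar e(t)),$$ $$\sigma\,\partial_x g(t,\bar e(t))+\bar v\,g(t,\bar e(t))=0,\qquad \sigma\,\partial_x g(t,0)=0\quad(t>\tau_1),\qquad g(\tau_1,\cdot)=g^{\tau_1}.$$ A weak $L^2$ solution is a measurable function $g$ on $\{(t,x): t\ge\tau_1,\ 0<x<\bar e(t)\}$ such that (a) $t\mapsto g(t,\bar e(t)\,\cdot)$ belongs to $C^0([\tau_1,+\infty);L^2(0,1))$; (b) $\partial_t g\in L^2\big((\tau_1,+\infty);(H^1(0,\bar e(t)))'\big)$, that is, there is a measurable family of functionals $F(t)\in (H^1(0,\bar e(t)))'$ with $\int_{\tau_1}^{\infty}\|F(t)\|^2_{(H^1(0,\bar e(t)))'}\,dt<\infty$ and $\int_{\tau_1}^\infty\!\int_0^{\bar e(t)} g\,\partial_t\varphi\,dx\,dt=-\int_{\tau_1}^\infty\langle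 F(t),\varphi(t,\cdot)\rangle\,dt$ for all $\varphi\in C_c^\infty((\tau_1,\infty)\times\mathbb R)$; (c) for every $T>\tau_1$, $$\int_{\tau_1}^{T}\!\int_{0}^{\bar e(t)} g\,\big[\partial_t v+\sigma\,\partial_{xx}^2v-\lambda v\big]\,dx\,dt+\int_0^{\bar e(\tau_1)}g^{\tau_1}(x)\,v(\tau_1,x)\,dx=0$$ for all $v$ on $\{(t,x):\tau_1\le t\le T,\ 0<x<\bar e(t)\}$ such that $v,\partial_xv,\partial^2_{xx}v,\partial_tv$ (weak derivatives) are square-integrable, $t\mapsto v(t,\bar e(t)\,\cdot)$ belongs to $C^0([\tau_1,T];L^2(0,1))$, $v(T,\cdot)=0$, and $\partial_xv(t,0)=\partial_xv(t,\bar e(t))=0$ for almost every $t\in(\tau_1,T)$. Then there exists a unique weak $L^2$ solution $g$ (uniqueness holds even among all functions that satisfy (a) and (c) only), and for every $t\ge\tau_1$ $$\|g(t)\|_{L^2(0,\bar e(t))}\le e^{-\lambda(t-\tau_1)}\,\|g^{\tau_1}\|_{L^2(0,\bar e(\tau_1))}.$$ -/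

import Mathlib

open MeasureTheory Set Filter
open scoped Topology ContDiff ENNReal

noncomputable section

namespace MovingHeat

/-- The thickness `ē(t) = ē₀ + t v̄`: right endpoint of the space interval at time `t`. -/
def thickness (e₀ vbar : ℝ) (t : ℝ) : ℝ := e₀ + t * vbar

/-- The moving space-time domain `⋃_{t ∈ I} {t} × (0, e(t))`. -/
def movingDomain (e : ℝ → ℝ) (I : Set ℝ) : Set (ℝ × ℝ) :=
  {p | p.1 ∈ I ∧ 0 < p.2 ∧ p.2 < e p.1}

/-- Lebesgue measure on `(0, L)`. -/
abbrev leb (L : ℝ) : Measure ℝ := volume.restrict (Ioo 0 L)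

/-- `p` is the weak (distributional) derivative of `u` on `(0, L)`.
It is used only for `u` and `p` that are square-integrable on `(0, L)`. -/
def IsWeakDeriv (L : ℝ) (u p : ℝ → ℝ) : Prop :=
  ∀ η : ℝ → ℝ, ContDiff ℝ ∞ η → HasCompactSupport η → tsupport η ⊆ Ioo 0 L →
    ∫ x, u x * deriv η x ∂(leb L) = - ∫ x, p x * η x ∂(leb L)

/-- `q` is the weak (distributional) derivative of `v` with respect to the first variable (time)
on the open moving domain over the time interval `(a, b)`. -/
def IsWeakTimeDeriv (e : ℝ → ℝ) (a b : ℝ) (v q : ℝ → ℝ → ℝ) : Prop :=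
  ∀ φ : ℝ × ℝ → ℝ, ContDiff ℝ ∞ φ → HasCompactSupport φ →
    tsupport φ ⊆ movingDomain e (Ioo a b) →
    ∫ z in movingDomain e (Ioo a b), v z.1 z.2 * deriv (fun s => φ (s, z.2)) z.1 =
      - ∫ z in movingDomain e (Ioo a b), q z.1 z.2 * φ z

/-- The function `u` on `(0, L)` has a representative that is continuous on `[0, L]` and takes the
value `c` at `x₀`. For `u ∈ H¹(0, L)` and `x₀ ∈ {0, L}` this says that the trace of `u` at `x₀`
is `c`. -/
def HasTrace (L : ℝ) (u : ℝ → ℝ) (x₀ c : ℝ) : Prop :=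
  ∃ w : ℝ → ℝ, ContinuousOn w (Icc 0 L) ∧ u =ᵐ[leb L] w ∧ w x₀ = c

/-- The function `f` on the moving domain belongs to `[C⁰(I; L²)]_e`: it is measurable, and after
the rescaling `x = y e(t)` it is a continuous function of `t ∈ I` with values in `L²(0, 1)`. -/
structure ContinuousInL2 (e : ℝ → ℝ) (I : Set ℝ) (f : ℝ → ℝ → ℝ) : Prop where
  aestronglyMeasurable :
    AEStronglyMeasurable (fun z : ℝ × ℝ => f z.1 z.2) (volume.restrict (movingDomain e I))
  memLp : ∀ t ∈ I, MemLp (fun y => f t (y * e t)) 2 (leb 1)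
  tendsto : ∀ t₀ ∈ I,
    Tendsto (fun t => eLpNorm (fun y => f t (y * e t) - f t₀ (y * e t₀)) 2 (leb 1)) (𝓝[I] t₀) (𝓝 0)

/-- The Sobolev space `H¹(0, L)`, as the space of pairs `(u, u')` of elements of `L²(0, L)` such
that `u'` is the weak derivative of `u`, with the norm `(‖u‖² + ‖u'‖²)^(1/2)`. -/
def H1 (L : ℝ) : Submodule ℝ (WithLp 2 (Lp ℝ 2 (leb L) × Lp ℝ 2 (leb L))) where
  carrier := {z | IsWeakDeriv L z.fst z.snd}
  zero_mem' := by
    intro η _ _ _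
    have h : ∀ᵐ x ∂(leb L), (0 : Lp ℝ 2 (leb L)) x = 0 := Lp.coeFn_zero _ _ _
    have h1 : ∀ f : ℝ → ℝ, ∫ x, (0 : Lp ℝ 2 (leb L)) x * f x ∂(leb L) = 0 := by
      intro f
      refine (integral_congr_ae (g := fun _ => (0 : ℝ)) ?_).trans (by simp)
      filter_upwards [h] with x hx
      rw [hx, zero_mul]
    change ∫ x, (0 : Lp ℝ 2 (leb L)) x * deriv η x ∂(leb L)
      = - ∫ x, (0 : Lp ℝ 2 (leb L)) x * η x ∂(leb L)
    rw [h1, h1, neg_zero]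
  add_mem' := by
    intro z w hz hw η h1 h2 h3
    have hη : MemLp η 2 (leb L) := (h1.continuous.memLp_of_hasCompactSupport h2).restrict _
    have hη' : MemLp (deriv η) 2 (leb L) :=
      ((h1.continuous_deriv (by simp)).memLp_of_hasCompactSupport h2.deriv).restrict _
    have key : ∀ (a b : Lp ℝ 2 (leb L)) (f : ℝ → ℝ), MemLp f 2 (leb L) →
        ∫ x, (a + b) x * f x ∂(leb L)
          = ∫ x, a x * f x ∂(leb L) + ∫ x, b x * f x ∂(leb L) := by
      intro a b f hf
      have ha : Integrable (fun x => a x * f x) (leb L) := (Lp.memLp a).integrable_mul hf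
      have hb : Integrable (fun x => b x * f x) (leb L) := (Lp.memLp b).integrable_mul hf
      rw [← integral_add ha hb]
      refine integral_congr_ae ?_
      filter_upwards [Lp.coeFn_add a b] with x hx
      rw [hx, Pi.add_apply, add_mul]
    change ∫ x, (z.fst + w.fst) x * deriv η x ∂(leb L)
      = - ∫ x, (z.snd + w.snd) x * η x ∂(leb L)
    rw [key _ _ _ hη', key _ _ _ hη, hz η h1 h2 h3, hw η h1 h2 h3, neg_add]
  smul_mem' := by
    intro c z hz η h1 h2 h3
    have key : ∀ (a : Lp ℝ 2 (leb L)) (f : ℝ → ℝ),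
        ∫ x, (c • a) x * f x ∂(leb L) = c * ∫ x, a x * f x ∂(leb L) := by
      intro a f
      rw [← integral_const_mul]
      refine integral_congr_ae ?_
      filter_upwards [Lp.coeFn_smul c a] with x hx
      rw [hx, Pi.smul_apply, smul_eq_mul, mul_assoc]
    change ∫ x, (c • z.fst) x * deriv η x ∂(leb L) = - ∫ x, (c • z.snd) x * η x ∂(leb L)
    rw [key, key, hz η h1 h2 h3, mul_neg]

/-- A continuous function is square-integrable on a bounded interval. -/
theorem memLp_of_continuous (L : ℝ) {f : ℝ → ℝ} (hf : Continuous f) : MemLp f 2 (leb L) := by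
  obtain ⟨C, hC⟩ := (isCompact_Icc (a := (0 : ℝ)) (b := L)).exists_bound_of_continuousOn
    hf.continuousOn
  refine MemLp.of_bound hf.aestronglyMeasurable C ?_
  filter_upwards [ae_restrict_mem measurableSet_Ioo] with x hx
  exact hC x (Ioo_subset_Icc_self hx)

/-- The restriction of a smooth function to `(0, L)`, as an element of `H¹(0, L)`. -/
def H1.ofSmooth (L : ℝ) (φ : ℝ → ℝ) (hφ : ContDiff ℝ ∞ φ) : H1 L :=
  ⟨WithLp.toLp 2 ((memLp_of_continuous L hφ.continuous).toLp φ,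
      (memLp_of_continuous L (hφ.continuous_deriv (by simp))).toLp (deriv φ)), by
    intro η h1 h2 h3
    have hd : Continuous (deriv φ) := hφ.continuous_deriv (by simp)
    have hd' : Continuous (deriv η) := h1.continuous_deriv (by simp)
    have key : ∀ (f f' χ : ℝ → ℝ), f' =ᵐ[leb L] f → tsupport χ ⊆ Ioo 0 L →
        ∫ x, f' x * χ x ∂(leb L) = ∫ x, f x * χ x := by
      intro f f' χ hf hχ
      have h0 : ∫ x, f' x * χ x ∂(leb L) = ∫ x in Ioo 0 L, f x * χ x := by
        refine integral_congr_ae ?_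
        filter_upwards [hf] with x hx
        rw [hx]
      rw [h0]
      refine setIntegral_eq_integral_of_forall_compl_eq_zero fun x hx => ?_
      rw [image_eq_zero_of_notMem_tsupport fun h => hx (hχ h), mul_zero]
    have e1 := key _ _ (deriv η) (memLp_of_continuous L hφ.continuous).coeFn_toLp
      (tsupport_deriv_subset.trans h3)
    have e2 := key _ _ η (memLp_of_continuous L hd).coeFn_toLp h3
    change ∫ x, ((memLp_of_continuous L hφ.continuous).toLp φ) x * deriv η x ∂(leb L)
      = - ∫ x, ((memLp_of_continuous L hd).toLp (deriv φ)) x * η x ∂(leb L)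
    rw [e1, e2]
    exact integral_mul_deriv_eq_deriv_mul_of_integrable
      (fun x _ => ((hφ.differentiable (by simp)) x).hasDerivAt)
      (fun x _ => ((h1.differentiable (by simp)) x).hasDerivAt)
      ((hφ.continuous.mul hd').integrable_of_hasCompactSupport h2.deriv.mul_left)
      ((hd.mul h1.continuous).integrable_of_hasCompactSupport h2.mul_left)
      ((hφ.continuous.mul h1.continuous).integrable_of_hasCompactSupport h2.mul_left)⟩

/-- A time slice of a smooth function of `(t, x)` is smooth. -/
theorem contDiff_slice {φ : ℝ × ℝ → ℝ} (hφ : ContDiff ℝ ∞ φ) (t : ℝ) :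
    ContDiff ℝ ∞ (fun x => φ (t, x)) :=
  hφ.comp (contDiff_const.prodMk contDiff_id)

/-- `∂ₜ g ∈ [L²((τ, ∞); (H¹)')]_e`: there is a measurable, square-integrable family of functionals
`F(t) ∈ (H¹(0, e(t)))'`, `t > τ`, that represents the weak time derivative of `g`. The test
functions `φ` are compactly supported in time in `(τ, ∞)`, but need not vanish for `x = 0` or
`x = e(t)`, as is usual for derivatives with values in the dual of the whole space `H¹` (as opposed
to `H¹₀`); with `φ` supported inside the moving domain one gets the distributional derivative. -/
def TimeDerivInDual (e : ℝ → ℝ) (τ : ℝ) (g : ℝ → ℝ → ℝ) : Prop :=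
  ∃ F : (t : ℝ) → StrongDual ℝ (H1 (e t)),
    (∀ (φ : ℝ → ℝ) (hφ : ContDiff ℝ ∞ φ),
      AEStronglyMeasurable (fun t => F t (H1.ofSmooth (e t) φ hφ)) (volume.restrict (Ioi τ))) ∧
    ∫⁻ t in Ioi τ, ‖F t‖ₑ ^ 2 < ⊤ ∧
    ∀ (φ : ℝ × ℝ → ℝ) (hφ : ContDiff ℝ ∞ φ), HasCompactSupport φ →
      tsupport φ ⊆ Ioi τ ×ˢ univ →
      ∫ t in Ioi τ, ∫ x in Ioo 0 (e t), g t x * deriv (fun s => φ (s, x)) t =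
        - ∫ t in Ioi τ, F t (H1.ofSmooth (e t) (fun x => φ (t, x)) (contDiff_slice hφ t))

/-- `v` is an admissible test function on the time interval `(τ, T)`, with weak derivatives
`vt = ∂ₜ v`, `vx = ∂ₓ v` and `vxx = ∂ₓₓ v`:
`v ∈ [L²((τ,T); H²)]_e ∩ [C⁰([τ,T]; L²)]_e`, `∂ₜ v ∈ [L²((τ,T); L²)]_e`, `v(T, ·) = 0`, and
`∂ₓ v(t, 0) = ∂ₓ v(t, e(t)) = 0` for almost every `t`. -/
structure IsTestFunction (e : ℝ → ℝ) (τ T : ℝ) (v vt vx vxx : ℝ → ℝ → ℝ) : Prop where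
  memLp : MemLp (fun z : ℝ × ℝ => v z.1 z.2) 2 (volume.restrict (movingDomain e (Ioo τ T)))
  memLp_x : MemLp (fun z : ℝ × ℝ => vx z.1 z.2) 2 (volume.restrict (movingDomain e (Ioo τ T)))
  memLp_xx : MemLp (fun z : ℝ × ℝ => vxx z.1 z.2) 2 (volume.restrict (movingDomain e (Ioo τ T)))
  weakDeriv_x : ∀ᵐ t ∂(volume.restrict (Ioo τ T)), IsWeakDeriv (e t) (v t) (vx t)
  weakDeriv_xx : ∀ᵐ t ∂(volume.restrict (Ioo τ T)), IsWeakDeriv (e t) (vx t) (vxx t)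
  continuous : ContinuousInL2 e (Icc τ T) v
  memLp_t : MemLp (fun z : ℝ × ℝ => vt z.1 z.2) 2 (volume.restrict (movingDomain e (Ioo τ T)))
  weakDeriv_t : IsWeakTimeDeriv e τ T v vt
  terminal : v T =ᵐ[leb (e T)] 0
  neumann_left : ∀ᵐ t ∂(volume.restrict (Ioo τ T)), HasTrace (e t) (vx t) 0 0
  neumann_right : ∀ᵐ t ∂(volume.restrict (Ioo τ T)), HasTrace (e t) (vx t) (e t) 0

/-- The integral identity of the weak `L²` formulation of
`∂ₜ g - σ ∂ₓₓ g + lam g = 0`, `σ ∂ₓ g + v̄ g = 0` at `x = e(t)` (where `v̄ = e'`),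
`σ ∂ₓ g = 0` at `x = 0`, `g(τ, ·) = g₀`. -/
def WeakFormulation (e : ℝ → ℝ) (τ σ lam : ℝ) (g₀ : ℝ → ℝ) (g : ℝ → ℝ → ℝ) : Prop :=
  ∀ T : ℝ, τ < T → ∀ v vt vx vxx : ℝ → ℝ → ℝ, IsTestFunction e τ T v vt vx vxx →
    (∫ t in Ioo τ T, ∫ x in Ioo 0 (e t), g t x * (vt t x + σ * vxx t x - lam * v t x))
      + ∫ x in Ioo 0 (e τ), g₀ x * v τ x = 0

/-- Weak `L²` solutions of the damped heat equation on the moving domain. -/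
structure IsWeakL2Solution (e : ℝ → ℝ) (τ σ lam : ℝ) (g₀ : ℝ → ℝ) (g : ℝ → ℝ → ℝ) : Prop where
  continuous : ContinuousInL2 e (Ici τ) g
  timeDeriv : TimeDerivInDual e τ g
  weakForm : WeakFormulation e τ σ lam g₀ g

end MovingHeat

end

noncomputable section

namespace MovingHeat

/-! Uniqueness is a duality argument. On an interval that grows linearly, the heat equation with
Dirichlet conditions has explicit separated solutions, the functions `mode`: a Gaussian weight times
a sine in x/e(t). Let P be a mode of the backward equation and V(t,x) = ∫₀ˣ P(t,y) dy. Then ∂ₓV = P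
vanishes at both ends, as is required of test functions, and ∂ₜV + σ∂ₓₓV = σ∂ₓP(t,0) depends on time
alone. Tested with V times a scalar function of time, the weak formulation determines ∫ g V as soon
as the mass ∫ g is known, and V = 1 determines the mass. Since the sines are total, the functions V
together with the constant 1 separate square-integrable functions (`ae_eq_of_weakFormulation`).

Existence is obtained for a potential instead of the density. Without damping, the problem says
formally that g = ∂ₓG with ∂ₜG = σ∂ₓₓG, G(t,0) = 0 and G(t,e(t)) constant: differentiating the last
condition along the boundary gives ∂ₜG + v̄∂ₓG = 0, which is the Robin condition. The damping is
restored by the factor exp(-λ(t-τ)). For a smooth G with these boundary values that need not solve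
the equation, put r = ∂ₜG - σ∂ₓₓG. The energy inequality `IsPotential.energy_le` reads ‖∂ₓG(T)‖² +
σ∫‖∂ₓₓG‖² ≤ ‖∂ₓG(τ)‖² + σ⁻¹∫‖r‖², the moving end contributing the term v̄(∂ₓG)² with the favourable
sign.

It remains to find potentials with r near 0 and ∂ₓG(τ) near the initial datum. No evolution equation
has to be solved for this: the pairs (r, ∂ₓG(τ)) are dense in L² × L², because their orthogonal
complement is trivial (`orthogonal_potentialPairs`). Forward modes multiplied by functions of time
annihilate the first component of an orthogonal pair, and potentials that spread at the diffusive
rate annihilate the second. The energy inequality, applied to differences, makes the approximating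
densities Cauchy, uniformly in time (`exists_isApproximated`). The limit inherits the weak equation,
and the constant 1 in front of ‖∂ₓG(τ)‖² gives the sharp decay estimate.

For test functions that are only weakly differentiable, everything rests on Reynolds' transport
theorem, `integral_transportDensity`. -/

/-! ### One-dimensional tools: primitives, totality of sines, cut-offs, fast Cauchy sequences. -/

theorem exists_Icc_of_isCompact_subset_Ioo {a b : ℝ} (hab : a < b) {K : Set ℝ} (hK : IsCompact K)
    (h : K ⊆ Ioo a b) : ∃ α β, a < α ∧ α ≤ β ∧ β < b ∧ K ⊆ Icc α β := by
  rcases K.eq_empty_or_nonempty with rfl | hne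
  · exact ⟨(a + b) / 2, (a + b) / 2, by linarith, le_rfl, by linarith, empty_subset _⟩
  · obtain ⟨α, hα, hα'⟩ := hK.exists_isLeast hne
    obtain ⟨β, hβ, hβ'⟩ := hK.exists_isGreatest hne
    exact ⟨α, β, (h hα).1, hα' hβ, (h hβ).2, fun x hx => ⟨hα' hx, hβ' hx⟩⟩

/-- A smooth function with compact support in `(a, b)` and vanishing integral is the derivative of
such a function. -/
theorem exists_smooth_primitive {a b : ℝ} (hab : a < b) {f : ℝ → ℝ} (hf : ContDiff ℝ ∞ f)
    (hc : HasCompactSupport f) (hs : tsupport f ⊆ Ioo a b) (h0 : ∫ x, f x = 0) :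
    ∃ ψ : ℝ → ℝ, ContDiff ℝ ∞ ψ ∧ HasCompactSupport ψ ∧ tsupport ψ ⊆ Ioo a b ∧ deriv ψ = f := by
  obtain ⟨α, β, h1, h2, h3, h4⟩ := exists_Icc_of_isCompact_subset_Ioo hab hc hs
  have hfz : ∀ x, x ∉ Icc α β → f x = 0 := fun x hx =>
    image_eq_zero_of_notMem_tsupport fun h => hx (h4 h)
  have hd : ∀ x, HasDerivAt (fun x => ∫ y in a..x, f y) (f x) x := fun x =>
    hf.continuous.integral_hasStrictDerivAt a x |>.hasDerivAt
  have hder : deriv (fun x => ∫ y in a..x, f y) = f := funext fun x => (hd x).deriv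
  have hsup : tsupport (fun x => ∫ y in a..x, f y) ⊆ Icc α β := by
    refine closure_minimal (fun x hx => ?_) isClosed_Icc
    by_contra hx'
    apply hx
    rcases lt_or_ge x α with h | h
    · refine (intervalIntegral.integral_congr (g := fun _ => 0) fun y hy => hfz y fun hy' => ?_).trans
        (by simp)
      have := hy.2
      have h' := hy'.1
      rcases le_total a x with hax | hax
      · rw [max_eq_right hax] at this; linarith
      · rw [max_eq_left hax] at this; linarith
    · have hxβ : β < x := by
        by_contra hh
        exact hx' ⟨h, not_lt.1 hh⟩
      change ∫ y in a..x, f y = 0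
      rw [intervalIntegral.integral_eq_integral_of_support_subset, h0]
      intro y hy
      have := h4 (subset_tsupport _ hy)
      exact ⟨by linarith [this.1], by linarith [this.2]⟩
  refine ⟨fun x => ∫ y in a..x, f y, ?_, ?_, ?_, hder⟩
  · rw [contDiff_infty_iff_deriv, hder]
    exact ⟨fun x => (hd x).differentiableAt, hf⟩
  · exact isCompact_Icc.of_isClosed_subset (isClosed_tsupport _) hsup
  · exact hsup.trans fun x hx => ⟨by linarith [hx.1], by linarith [hx.2]⟩

/-- Integration by parts against a primitive of an integrable function. -/
theorem integral_mul_eq_sub_of_primitive {a b : ℝ} (hab : a ≤ b) {p f : ℝ → ℝ}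
    (hp : IntegrableOn p (Ioo a b)) (hf : ContDiff ℝ 1 f) (c : ℝ) :
    ∫ x in Ioo a b, f x * p x = f b * (c + ∫ x in a..b, p x) - f a * c
      - ∫ x in Ioo a b, deriv f x * (c + ∫ y in a..x, p y) := by
  have hp' : IntervalIntegrable p volume a b := by
    rwa [intervalIntegrable_iff_integrableOn_Ioo_of_le hab]
  have hP := hp'.absolutelyContinuousOnInterval_intervalIntegral (c := a) (by simp)
  have hF : AbsolutelyContinuousOnInterval f a b := hf.contDiffOn.absolutelyContinuousOnInterval
  have hcst : AbsolutelyContinuousOnInterval (fun _ : ℝ => c) a b :=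
    (contDiff_const (c := c)).contDiffOn.absolutelyContinuousOnInterval
  have key := hF.integral_mul_deriv_eq_deriv_mul (hcst.add hP)
  have h1 : ∫ x in a..b, f x * deriv ((fun _ : ℝ => c) + fun x => ∫ v in a..x, p v) x
      = ∫ x in a..b, f x * p x := by
    refine intervalIntegral.integral_congr_ae ?_
    filter_upwards [hp'.ae_hasDerivAt_integral] with x hx hx'
    have hx2 : x ∈ uIcc a b := uIoc_subset_uIcc hx'
    have h := (hx hx2 a (by simp)).const_add c
    have h' : deriv ((fun _ : ℝ => c) + fun x => ∫ v in a..x, p v) x = p x := h.deriv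
    rw [h']
  rw [h1] at key
  simp only [intervalIntegral.integral_of_le hab, integral_Ioc_eq_integral_Ioo] at key
  rw [key]
  simp [intervalIntegral.integral_of_le hab, integral_Ioc_eq_integral_Ioo]

/-- An integrable function whose distributional derivative is integrable is a primitive of it. -/
theorem exists_ae_eq_primitive {a b : ℝ} (hab : a < b) {u p : ℝ → ℝ} (hu : IntegrableOn u (Ioo a b))
    (hp : IntegrableOn p (Ioo a b))
    (h : ∀ η : ℝ → ℝ, ContDiff ℝ ∞ η → HasCompactSupport η → tsupport η ⊆ Ioo a b →
      ∫ x in Ioo a b, u x * deriv η x = - ∫ x in Ioo a b, p x * η x) :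
    ∃ c : ℝ, u =ᵐ[volume.restrict (Ioo a b)] fun x => c + ∫ y in a..x, p y := by
  have hp' : IntervalIntegrable p volume a b := by
    rwa [intervalIntegrable_iff_integrableOn_Ioo_of_le hab.le]
  set P : ℝ → ℝ := fun x => ∫ y in a..x, p y with hPdef
  have hPc : ContinuousOn P (Icc a b) := by
    have := (hp'.absolutelyContinuousOnInterval_intervalIntegral (c := a) (by simp)).continuousOn
    rwa [uIcc_of_le hab.le] at this
  have hPi : IntegrableOn P (Ioo a b) :=
    (hPc.integrableOn_compact isCompact_Icc).mono_set Ioo_subset_Icc_self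
  have hw : IntegrableOn (fun x => u x - P x) (Ioo a b) := hu.sub hPi
  have hbdd : ∀ {q : ℝ → ℝ} {η : ℝ → ℝ}, IntegrableOn q (Ioo a b) → Continuous η →
      IntegrableOn (fun x => q x * η x) (Ioo a b) := by
    intro q η hq hη
    have hq' : IntegrableOn q (Icc a b) := by rwa [integrableOn_Icc_iff_integrableOn_Ioo]
    exact (hq'.mul_continuousOn hη.continuousOn isCompact_Icc).mono_set Ioo_subset_Icc_self
  have h0 : ∀ η : ℝ → ℝ, ContDiff ℝ ∞ η → HasCompactSupport η → tsupport η ⊆ Ioo a b →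
      ∫ x in Ioo a b, (u x - P x) * deriv η x = 0 := by
    intro η h1 h2 h3
    have hd : Continuous (deriv η) := h1.continuous_deriv (by simp)
    have e := integral_mul_eq_sub_of_primitive hab.le hp (h1.of_le (by simp)) 0
    have ha : η a = 0 := image_eq_zero_of_notMem_tsupport fun hh => (h3 hh).1.false
    have hb : η b = 0 := image_eq_zero_of_notMem_tsupport fun hh => (h3 hh).2.false
    simp only [ha, hb, zero_mul, sub_self, zero_sub, zero_add] at e
    simp only [sub_mul]
    rw [integral_sub (hbdd hu hd) (hbdd hPi hd), h η h1 h2 h3]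
    simp only [mul_comm (p _), e, hPdef, mul_comm (deriv η _)]
    ring
  let B : ContDiffBump ((a + b) / 2) := ⟨(b - a) / 8, (b - a) / 4, by linarith, by linarith⟩
  have hB1 : ContDiff ℝ ∞ (B.normed volume) := B.contDiff_normed
  have hB2 : HasCompactSupport (B.normed volume) := B.hasCompactSupport_normed
  have hB3 : tsupport (B.normed volume) ⊆ Ioo a b := by
    rw [B.tsupport_normed_eq, Real.closedBall_eq_Icc]
    intro x hx
    have e : B.rOut = (b - a) / 4 := rfl
    rw [e] at hx
    exact ⟨by linarith [hx.1], by linarith [hx.2]⟩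
  have hB4 : ∫ x, B.normed volume x = 1 := B.integral_normed
  set c := ∫ x in Ioo a b, (u x - P x) * B.normed volume x with hc
  have hloc : LocallyIntegrableOn (fun x => u x - P x - c) (Ioo a b) :=
    (hw.sub (integrableOn_const (by simp))).locallyIntegrableOn
  have hsupp : ∀ {η q : ℝ → ℝ}, tsupport η ⊆ Ioo a b → ∫ x, η x * q x = ∫ x in Ioo a b, q x * η x := by
    intro η q hη
    rw [← setIntegral_eq_integral_of_forall_compl_eq_zero (s := Ioo a b)]
    · simp only [mul_comm]
    · intro x hx
      rw [image_eq_zero_of_notMem_tsupport fun hh => hx (hη hh), zero_mul]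
  have hz : ∀ᵐ x, x ∈ Ioo a b → u x - P x - c = 0 := by
    refine isOpen_Ioo.ae_eq_zero_of_integral_contDiff_smul_eq_zero hloc fun η h1 h2 h3 => ?_
    -- The lemma of du Bois-Reymond: subtracting from η its mass times a unit bump leaves a function
    -- of zero integral, that is, the derivative of a test function. Hence u - P is orthogonal to
    -- everything of zero mean, and is the constant c.
    obtain ⟨ψ, q1, q2, q3, q4⟩ := exists_smooth_primitive hab
      (f := fun x => η x - (∫ y, η y) * B.normed volume x) (h1.sub (contDiff_const.mul hB1))
      (h2.sub hB2.mul_left) ((tsupport_sub _ _).trans (union_subset h3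
        ((tsupport_mul_subset_right).trans hB3))) (by
        rw [integral_sub (h1.continuous.integrable_of_hasCompactSupport h2)
          ((hB1.continuous.integrable_of_hasCompactSupport hB2).const_mul _), integral_const_mul,
          hB4, mul_one, sub_self])
    have e := h0 ψ q1 q2 q3
    rw [q4] at e
    have e1 : ∫ x in Ioo a b, (u x - P x) * (η x - (∫ y, η y) * B.normed volume x)
        = (∫ x in Ioo a b, (u x - P x) * η x) - (∫ y, η y) * c := by
      rw [hc, ← integral_const_mul, ← integral_sub (hbdd hw h1.continuous)
        ((hbdd hw hB1.continuous).const_mul _)]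
      congr 1
      ext x
      ring
    rw [e1] at e
    simp only [smul_eq_mul]
    rw [hsupp h3]
    simp only [sub_mul (_ - _)]
    rw [integral_sub (hbdd hw h1.continuous) ((hbdd (q := fun _ => c) (integrableOn_const (by simp))
      h1.continuous)), integral_const_mul]
    have e2 : ∫ x in Ioo a b, η x = ∫ x, η x :=
      setIntegral_eq_integral_of_forall_compl_eq_zero fun x hx =>
        image_eq_zero_of_notMem_tsupport fun hh => hx (h3 hh)
    rw [e2]
    linarith
  refine ⟨c, ?_⟩
  rw [Filter.EventuallyEq, ae_restrict_iff' measurableSet_Ioo]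
  filter_upwards [hz] with x hx hx'
  linarith [hx hx']

/-- Totality of the sine system in `L¹(0, L)`. -/
theorem ae_eq_zero_of_integral_mul_sin {L : ℝ} (hL : 0 < L) {f : ℝ → ℝ}
    (hf : IntegrableOn f (Ioo 0 L))
    (h : ∀ n : ℕ, ∫ x in Ioo 0 L, f x * Real.sin ((n + 1) * (Real.pi * x / L)) = 0) :
    f =ᵐ[volume.restrict (Ioo 0 L)] 0 := by
  have hbdd : ∀ {q : ℝ → ℝ}, Continuous q → IntegrableOn (fun x => f x * q x) (Ioo 0 L) := by
    intro q hq
    have hq' : IntegrableOn f (Icc 0 L) := by rwa [integrableOn_Icc_iff_integrableOn_Ioo]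
    exact (hq'.mul_continuousOn hq.continuousOn isCompact_Icc).mono_set Ioo_subset_Icc_self
  -- With θ = πx/L, the formula 2 sin(nθ) cos θ = sin((n+1)θ) + sin((n-1)θ) brings in powers of cos
  -- θ one at a time. Thus f sin θ is orthogonal to all polynomials in cos θ.
  have hsc : ∀ k : ℕ, ∀ n : ℕ, ∫ x in Ioo 0 L, f x * (Real.sin (n * (Real.pi * x / L)) *
      Real.cos (Real.pi * x / L) ^ k) = 0 := by
    intro k
    induction k with
    | zero =>
      intro n
      rcases n with _ | n
      · simp
      · simpa using h n
    | succ k ih =>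
      intro n
      rcases n with _ | n
      · simp
      · have e : ∀ x, f x * (Real.sin ((n + 1 : ℕ) * (Real.pi * x / L)) *
            Real.cos (Real.pi * x / L) ^ (k + 1)) =
            (1 / 2) * (f x * (Real.sin ((n + 2 : ℕ) * (Real.pi * x / L)) *
              Real.cos (Real.pi * x / L) ^ k)) +
            (1 / 2) * (f x * (Real.sin ((n : ℕ) * (Real.pi * x / L)) *
              Real.cos (Real.pi * x / L) ^ k)) := by
          intro x
          set θ := Real.pi * x / L
          have e1 : ((n + 2 : ℕ) : ℝ) * θ = (n + 1 : ℕ) * θ + θ := by push_cast; ring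
          have e2 : ((n : ℕ) : ℝ) * θ = (n + 1 : ℕ) * θ - θ := by push_cast; ring
          rw [e1, e2, Real.sin_add, Real.sin_sub]
          ring
        simp only [e]
        rw [integral_add ((hbdd (by fun_prop)).const_mul _) ((hbdd (by fun_prop)).const_mul _),
          integral_const_mul, integral_const_mul, ih, ih]
        simp
  have hpoly : ∀ p : Polynomial ℝ, ∫ x in Ioo 0 L, f x * (Real.sin (Real.pi * x / L) *
      p.eval (Real.cos (Real.pi * x / L))) = 0 := by
    intro p
    induction p using Polynomial.induction_on' with
    | add p q hp hq =>
      simp only [Polynomial.eval_add, mul_add]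
      rw [integral_add (hbdd (by fun_prop)) (hbdd (by fun_prop)), hp, hq, add_zero]
    | monomial n a =>
      have e : ∀ x, f x * (Real.sin (Real.pi * x / L) *
          (Polynomial.monomial n a).eval (Real.cos (Real.pi * x / L))) =
          a * (f x * (Real.sin ((1 : ℕ) * (Real.pi * x / L)) *
            Real.cos (Real.pi * x / L) ^ n)) := by
        intro x
        simp only [Polynomial.eval_monomial, Nat.cast_one, one_mul]
        ring
      simp only [e]
      rw [integral_const_mul, hsc, mul_zero]
  have hcont : ∀ g : ℝ → ℝ, Continuous g →
      ∫ x in Ioo 0 L, f x * (Real.sin (Real.pi * x / L) * g x) = 0 := by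
    intro g hg
    -- Since cos θ is injective for 0 ≤ θ ≤ π, a continuous function of x is a continuous function
    -- of cos θ, to which the Weierstrass theorem applies.
    have hgc : ContinuousOn (fun z => g (L * Real.arccos z / Real.pi)) (Icc (-1) 1) := by
      have := Real.continuous_arccos
      fun_prop
    set N := ∫ x in Ioo 0 L, |f x|
    have hN : 0 ≤ N := integral_nonneg fun x => abs_nonneg _
    refine abs_nonpos_iff.1 (le_of_forall_pos_le_add fun ε hε => ?_)
    obtain ⟨p, hp⟩ := exists_polynomial_near_of_continuousOn (-1) 1 _ hgc (ε / (N + 1))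
      (by positivity)
    have e : ∫ x in Ioo 0 L, f x * (Real.sin (Real.pi * x / L) * g x) =
        ∫ x in Ioo 0 L, f x * (Real.sin (Real.pi * x / L) *
          (g x - p.eval (Real.cos (Real.pi * x / L)))) := by
      simp only [mul_sub]
      rw [integral_sub (hbdd (by fun_prop)) (hbdd (by fun_prop)), hpoly, sub_zero]
    rw [e, zero_add]
    calc |∫ x in Ioo 0 L, f x * (Real.sin (Real.pi * x / L) *
          (g x - p.eval (Real.cos (Real.pi * x / L))))|
        ≤ ∫ x in Ioo 0 L, |f x| * (ε / (N + 1)) := by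
          refine norm_integral_le_of_norm_le (f := fun x => f x * (Real.sin (Real.pi * x / L) *
            (g x - p.eval (Real.cos (Real.pi * x / L))))) (hf.abs.mul_const _) ?_
          filter_upwards [ae_restrict_mem measurableSet_Ioo] with x hx
          have hz := hp (Real.cos (Real.pi * x / L)) ⟨Real.neg_one_le_cos _, Real.cos_le_one _⟩
          rw [Real.arccos_cos (by have := hx.1; positivity)
            (by rw [div_le_iff₀ hL]; nlinarith [hx.2, Real.pi_pos])] at hz
          have e3 : L * (Real.pi * x / L) / Real.pi = x := by
            field_simp
          rw [e3] at hz
          rw [Real.norm_eq_abs, abs_mul, abs_mul]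
          have h1 := Real.abs_sin_le_one (Real.pi * x / L)
          rw [abs_sub_comm] at hz
          have h2 := abs_nonneg (g x - p.eval (Real.cos (Real.pi * x / L)))
          have h3 : |Real.sin (Real.pi * x / L)| * |g x - p.eval (Real.cos (Real.pi * x / L))|
            ≤ ε / (N + 1) := by nlinarith [abs_nonneg (Real.sin (Real.pi * x / L))]
          exact mul_le_mul_of_nonneg_left h3 (abs_nonneg _)
      _ = N * (ε / (N + 1)) := by rw [integral_mul_const]
      _ ≤ ε := by
          rw [mul_div_assoc', div_le_iff₀ (by positivity)]
          nlinarith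
  have hz : ∀ᵐ x, x ∈ Ioo 0 L → f x * Real.sin (Real.pi * x / L) = 0 := by
    refine isOpen_Ioo.ae_eq_zero_of_integral_contDiff_smul_eq_zero
      (IntegrableOn.locallyIntegrableOn (hbdd (by fun_prop))) fun η h1 h2 h3 => ?_
    have := hcont η h1.continuous
    rw [setIntegral_eq_integral_of_forall_compl_eq_zero] at this
    · rw [← this]
      congr 1
      ext x
      simp only [smul_eq_mul]
      ring
    · intro x hx
      rw [image_eq_zero_of_notMem_tsupport fun hh => hx (h3 hh)]
      simp
  rw [Filter.EventuallyEq, ae_restrict_iff' measurableSet_Ioo]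
  filter_upwards [hz] with x hx hx'
  have hs : 0 < Real.sin (Real.pi * x / L) := by
    refine Real.sin_pos_of_pos_of_lt_pi (by have := hx'.1; positivity) ?_
    rw [div_lt_iff₀ hL]
    nlinarith [hx'.2, Real.pi_pos]
  exact (mul_eq_zero.1 (hx hx')).resolve_right hs.ne'

/-- Smooth cut-off functions on `(0, 1)` that increase to `1`. -/
theorem exists_cutoff : ∃ ζ : ℕ → ℝ → ℝ, (∀ k, ContDiff ℝ ∞ (ζ k)) ∧ (∀ k, HasCompactSupport (ζ k)) ∧
    (∀ k, tsupport (ζ k) ⊆ Ioo 0 1) ∧ (∀ k y, 0 ≤ ζ k y ∧ ζ k y ≤ 1) ∧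
    ∀ y ∈ Ioo (0 : ℝ) 1, Tendsto (fun k => ζ k y) atTop (𝓝 1) := by
  have hpos : ∀ k : ℕ, (0 : ℝ) < 1 / (k + 4) := fun k => by positivity
  -- The shift by 4 keeps the inner radius 1/2 - 1/(k+4) of the bump positive for every k.
  have hle : ∀ k : ℕ, (1 : ℝ) / (k + 4) ≤ 1 / 4 := fun k =>
    one_div_le_one_div_of_le (by norm_num) (by linarith [(Nat.cast_nonneg k : (0 : ℝ) ≤ k)])
  let B : ℕ → ContDiffBump (1 / 2 : ℝ) := fun k => ⟨1 / 2 - 1 / (k + 4), 1 / 2 - 1 / (k + 4) / 2,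
    by linarith [hle k], by linarith [hpos k]⟩
  refine ⟨fun k => B k, fun k => (B k).contDiff, fun k => (B k).hasCompactSupport, fun k => ?_,
    fun k y => ⟨(B k).nonneg, (B k).le_one⟩, fun y hy => ?_⟩
  · rw [(B k).tsupport_eq, Real.closedBall_eq_Icc]
    intro x hx
    have e : (B k).rOut = 1 / 2 - 1 / (k + 4) / 2 := rfl
    rw [e] at hx
    exact ⟨by linarith [hx.1, hpos k], by linarith [hx.2, hpos k]⟩
  · refine tendsto_const_nhds.congr' ?_
    have hlim : Tendsto (fun k : ℕ => (1 : ℝ) / (k + 4)) atTop (𝓝 0) := by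
      have := (tendsto_one_div_add_atTop_nhds_zero_nat (𝕜 := ℝ)).comp (tendsto_add_atTop_nat 3)
      refine this.congr fun k => ?_
      simp only [Function.comp_apply, Nat.cast_add, Nat.cast_ofNat]
      ring
    filter_upwards [hlim.eventually (gt_mem_nhds (lt_min hy.1 (sub_pos.2 hy.2)))] with k hk
    refine ((B k).one_of_mem_closedBall ?_).symm
    rw [Real.closedBall_eq_Icc]
    have e : (B k).rIn = 1 / 2 - 1 / (k + 4) := rfl
    rw [e]
    have h1 := hk.trans_le (min_le_left _ _)
    have h2 := hk.trans_le (min_le_right _ _)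
    exact ⟨by linarith, by linarith⟩

/-- A fast Cauchy sequence in `L²` converges to its pointwise limit. -/
theorem tendsto_eLpNorm_sub_limUnder {α : Type*} {m : MeasurableSpace α} {μ : Measure α}
    {f : ℕ → α → ℝ} (hf : ∀ n, AEStronglyMeasurable (f n) μ) {B : ℕ → ℝ≥0∞} (hB : ∑' i, B i ≠ ⊤)
    (hc : ∀ N n m : ℕ, N ≤ n → N ≤ m → eLpNorm (f n - f m) 2 μ < B N) :
    Tendsto (fun n => eLpNorm (fun x => f n x - limUnder atTop fun k => f k x) 2 μ) atTop (𝓝 0) := by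
  refine Lp.cauchy_tendsto_of_tendsto hf (fun x => limUnder atTop fun k => f k x) hB hc ?_
  filter_upwards [Lp.ae_tendsto_of_cauchy_eLpNorm hf (by norm_num) hB hc] with x ⟨l, hl⟩
  rwa [hl.limUnder_eq]

/-! ### Measure theory on the moving domain: time slices and Fubini. -/

theorem measurableSet_movingDomain {e : ℝ → ℝ} (he : Continuous e) {I : Set ℝ}
    (hI : MeasurableSet I) : MeasurableSet (movingDomain e I) :=
  (measurable_fst hI).inter ((isOpen_lt continuous_const continuous_snd).inter
    (isOpen_lt continuous_snd (he.comp continuous_fst))).measurableSet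

theorem movingDomain_mono {e : ℝ → ℝ} {I J : Set ℝ} (h : I ⊆ J) :
    movingDomain e I ⊆ movingDomain e J := fun _ hp => ⟨h hp.1, hp.2⟩

theorem indicator_movingDomain {β : Type*} [Zero β] (e : ℝ → ℝ) (I : Set ℝ) (f : ℝ × ℝ → β)
    (t x : ℝ) : (movingDomain e I).indicator f (t, x) =
      I.indicator (fun t => (Ioo 0 (e t)).indicator (fun x => f (t, x)) x) t := by
  by_cases ht : t ∈ I
  · rw [indicator_of_mem ht]
    by_cases hx : x ∈ Ioo 0 (e t)
    · rw [indicator_of_mem hx, indicator_of_mem (show (t, x) ∈ movingDomain e I from ⟨ht, hx⟩)]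
    · rw [indicator_of_notMem hx, indicator_of_notMem]
      exact fun h => hx h.2
  · rw [indicator_of_notMem ht, indicator_of_notMem]
    exact fun h => ht h.1

section Fubini

variable {e : ℝ → ℝ} {I : Set ℝ}

theorem ae_slice_movingDomain (he : Continuous e) (hI : MeasurableSet I) {p : ℝ × ℝ → Prop}
    (h : ∀ᵐ z ∂(volume.restrict (movingDomain e I)), p z) :
    ∀ᵐ t ∂(volume.restrict I), ∀ᵐ x ∂(leb (e t)), p (t, x) := by
  rw [ae_restrict_iff' (measurableSet_movingDomain he hI), Measure.volume_eq_prod] at h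
  rw [ae_restrict_iff' hI]
  filter_upwards [Measure.ae_ae_of_ae_prod h] with t ht hti
  rw [ae_restrict_iff' measurableSet_Ioo]
  filter_upwards [ht] with x hx hx'
  exact hx ⟨hti, hx'⟩

theorem integrableOn_slice_movingDomain (he : Continuous e) (hI : MeasurableSet I) {f : ℝ × ℝ → ℝ}
    (hf : IntegrableOn f (movingDomain e I)) :
    ∀ᵐ t ∂(volume.restrict I), Integrable (fun x => f (t, x)) (leb (e t)) := by
  rw [← integrable_indicator_iff (measurableSet_movingDomain he hI), Measure.volume_eq_prod] at hf
  rw [ae_restrict_iff' hI]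
  filter_upwards [hf.prod_right_ae] with t ht hti
  simp only [indicator_movingDomain, indicator_of_mem hti] at ht
  exact (integrable_indicator_iff measurableSet_Ioo).1 ht

theorem integral_slice_indicator (f : ℝ × ℝ → ℝ) :
    (fun t => ∫ x, (movingDomain e I).indicator f (t, x)) =
      I.indicator (fun t => ∫ x in Ioo 0 (e t), f (t, x)) := by
  ext t
  by_cases ht : t ∈ I
  · simp only [indicator_movingDomain, indicator_of_mem ht]
    rw [integral_indicator measurableSet_Ioo]
  · simp [indicator_movingDomain, indicator_of_notMem ht]

theorem integrableOn_integral_movingDomain (he : Continuous e) (hI : MeasurableSet I)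
    {f : ℝ × ℝ → ℝ} (hf : IntegrableOn f (movingDomain e I)) :
    IntegrableOn (fun t => ∫ x in Ioo 0 (e t), f (t, x)) I := by
  rw [← integrable_indicator_iff (measurableSet_movingDomain he hI), Measure.volume_eq_prod] at hf
  rw [← integrable_indicator_iff hI, ← integral_slice_indicator]
  exact hf.integral_prod_left

theorem setIntegral_movingDomain (he : Continuous e) (hI : MeasurableSet I) {f : ℝ × ℝ → ℝ}
    (hf : IntegrableOn f (movingDomain e I)) :
    ∫ z in movingDomain e I, f z = ∫ t in I, ∫ x in Ioo 0 (e t), f (t, x) := by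
  rw [← integrable_indicator_iff (measurableSet_movingDomain he hI), Measure.volume_eq_prod] at hf
  rw [← integral_indicator (measurableSet_movingDomain he hI), Measure.volume_eq_prod,
    integral_prod _ hf, integral_slice_indicator, integral_indicator hI]

theorem setLIntegral_movingDomain (he : Continuous e) (hI : MeasurableSet I) {f : ℝ × ℝ → ℝ≥0∞}
    (hf : AEMeasurable f (volume.restrict (movingDomain e I))) :
    ∫⁻ z in movingDomain e I, f z = ∫⁻ t in I, ∫⁻ x in Ioo 0 (e t), f (t, x) := by
  have hm := measurableSet_movingDomain he hI
  rw [← aemeasurable_indicator_iff hm, Measure.volume_eq_prod] at hf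
  rw [← lintegral_indicator hm, Measure.volume_eq_prod, lintegral_prod _ hf, ← lintegral_indicator hI]
  refine lintegral_congr fun t => ?_
  by_cases ht : t ∈ I
  · simp only [indicator_movingDomain, indicator_of_mem ht]
    rw [lintegral_indicator measurableSet_Ioo]
  · simp [indicator_movingDomain, indicator_of_notMem ht]

theorem aestronglyMeasurable_slice (he : Continuous e) (hI : MeasurableSet I) {f : ℝ × ℝ → ℝ}
    (hf : AEStronglyMeasurable f (volume.restrict (movingDomain e I))) :
    ∀ᵐ t ∂(volume.restrict I), AEStronglyMeasurable (fun x => f (t, x)) (leb (e t)) := by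
  filter_upwards [ae_slice_movingDomain he hI hf.ae_eq_mk] with t ht
  exact ⟨fun x => hf.mk f (t, x), hf.stronglyMeasurable_mk.comp_measurable measurable_prodMk_left, ht⟩

theorem memLp_slice (he : Continuous e) (hI : MeasurableSet I) {f : ℝ × ℝ → ℝ}
    (hf : MemLp f 2 (volume.restrict (movingDomain e I))) :
    ∀ᵐ t ∂(volume.restrict I), MemLp (fun x => f (t, x)) 2 (leb (e t)) := by
  filter_upwards [aestronglyMeasurable_slice he hI hf.1,
    integrableOn_slice_movingDomain he hI ((memLp_two_iff_integrable_sq hf.1).1 hf)] with t h1 h2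
  exact (memLp_two_iff_integrable_sq h1).2 h2

end Fubini

/-! ### Rescaling (0, L) to (0, 1), and continuity in time with values in L². -/

section Scaling

theorem measurableEmbedding_mul_right {L : ℝ} (hL : L ≠ 0) :
    MeasurableEmbedding fun y : ℝ => y * L := measurableEmbedding_mulRight₀ hL

theorem leb_eq_smul_map {L : ℝ} (hL : 0 < L) :
    leb L = ENNReal.ofReal L • (leb 1).map (fun y => y * L) := by
  have h := Real.smul_map_volume_mul_right hL.ne'
  rw [abs_of_pos hL] at h
  have hpre : (fun y : ℝ => y * L) ⁻¹' Ioo 0 L = Ioo 0 1 := by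
    ext y
    simp only [mem_preimage, mem_Ioo]
    constructor
    · rintro ⟨h1, h2⟩
      exact ⟨pos_of_mul_pos_left h1 hL.le, by nlinarith⟩
    · rintro ⟨h1, h2⟩
      exact ⟨by positivity, by nlinarith⟩
  conv_lhs => rw [leb, ← h]
  rw [Measure.restrict_smul, (measurableEmbedding_mul_right hL.ne').restrict_map, hpre]

theorem eLpNorm_leb {L : ℝ} (hL : 0 < L) (f : ℝ → ℝ) :
    eLpNorm f 2 (leb L) = ENNReal.ofReal (L ^ (1 / 2 : ℝ)) * eLpNorm (fun y => f (y * L)) 2 (leb 1) := by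
  rw [leb_eq_smul_map hL, eLpNorm_smul_measure_of_ne_top (by simp),
    (measurableEmbedding_mul_right hL.ne').eLpNorm_map_measure, smul_eq_mul,
    ENNReal.ofReal_rpow_of_nonneg hL.le (by simp)]
  norm_num
  rfl

theorem memLp_leb_iff {L : ℝ} (hL : 0 < L) (f : ℝ → ℝ) :
    MemLp f 2 (leb L) ↔ MemLp (fun y => f (y * L)) 2 (leb 1) := by
  have h0 : ENNReal.ofReal L ≠ 0 := by simpa using hL
  rw [leb_eq_smul_map hL, ← Function.comp_def f,
    ← (measurableEmbedding_mul_right hL.ne').memLp_map_measure_iff]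
  refine ⟨fun h => ?_, fun h => h.smul_measure (by simp)⟩
  have := h.smul_measure (c := (ENNReal.ofReal L)⁻¹) (by simpa using hL)
  rwa [smul_smul, ENNReal.inv_mul_cancel h0 (by simp), one_smul] at this

theorem integral_leb {L : ℝ} (hL : 0 < L) (f : ℝ → ℝ) :
    ∫ x, f x ∂(leb L) = L * ∫ y, f (y * L) ∂(leb 1) := by
  rw [leb_eq_smul_map hL, integral_smul_measure,
    (measurableEmbedding_mul_right hL.ne').integral_map, ENNReal.toReal_ofReal hL.le, smul_eq_mul]

end Scaling

section ContinuousInL2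

variable {e : ℝ → ℝ} {I : Set ℝ}

theorem ContinuousInL2.memLp_slice {f : ℝ → ℝ → ℝ} (h : ContinuousInL2 e I f) {t : ℝ} (ht : t ∈ I)
    (hpos : 0 < e t) : MemLp (f t) 2 (leb (e t)) :=
  (memLp_leb_iff hpos _).2 (h.memLp t ht)

/-- A jointly continuous function is continuous in time with values in `L²`. -/
theorem continuousInL2_of_continuous (he : Continuous e) {f : ℝ → ℝ → ℝ}
    (hf : Continuous fun z : ℝ × ℝ => f z.1 z.2) : ContinuousInL2 e I f := by
  have hF : Continuous fun z : ℝ × ℝ => f z.1 (z.2 * e z.1) :=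
    hf.comp (continuous_fst.prodMk (continuous_snd.mul (he.comp continuous_fst)))
  refine ⟨hf.aestronglyMeasurable, fun t _ => ?_, fun t₀ _ => ?_⟩
  · exact memLp_of_continuous 1 (hF.comp (continuous_const.prodMk continuous_id))
  · rw [ENNReal.tendsto_nhds_zero]
    intro ε hε
    obtain ⟨δ, hδ, hδ'⟩ : ∃ δ : ℝ, 0 < δ ∧ ENNReal.ofReal δ ≤ ε := by
      rcases eq_or_ne ε ⊤ with rfl | h
      · exact ⟨1, one_pos, le_top⟩
      · exact ⟨ε.toReal, ENNReal.toReal_pos hε.ne' h, ENNReal.ofReal_toReal h |>.le⟩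
    obtain ⟨v, hv, hv'⟩ := isCompact_Icc.mem_uniformity_of_prod (k := Icc (0 : ℝ) 1) (s := univ)
      (f := fun t y => f t (y * e t)) hF.continuousOn (mem_univ t₀) (Metric.dist_mem_uniformity hδ)
    rw [nhdsWithin_univ] at hv
    filter_upwards [mem_nhdsWithin_of_mem_nhds hv] with t ht
    refine le_trans (eLpNorm_le_of_ae_bound (C := δ) ?_) ?_
    · filter_upwards [ae_restrict_mem measurableSet_Ioo] with y hy
      exact (hv' t ht y (Ioo_subset_Icc_self hy)).le
    · simpa using hδ'

/-- After the rescaling x = y e(t), the pairing is e(t) times the inner product of two continuous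
curves in the fixed space L²(0,1). -/
theorem ContinuousInL2.continuousOn_integral_mul (he : Continuous e) (hpos : ∀ t ∈ I, 0 < e t)
    {f q : ℝ → ℝ → ℝ} (hf : ContinuousInL2 e I f) (hq : ContinuousInL2 e I q) :
    ContinuousOn (fun t => ∫ x in Ioo 0 (e t), f t x * q t x) I := by
  have key : ∀ {f : ℝ → ℝ → ℝ} (hf : ContinuousInL2 e I f),
      Continuous fun t : I => (hf.memLp t t.2).toLp := by
    intro f hf
    refine continuous_iff_continuousAt.2 fun t₀ => ?_
    refine (Lp.tendsto_Lp_iff_tendsto_eLpNorm'' (p := 2) (μ := leb 1)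
      (fun (t : I) y => f t (y * e t)) (fun t => hf.memLp t t.2) _ (hf.memLp t₀ t₀.2)).2 ?_
    exact (tendsto_nhdsWithin_iff_subtype t₀.2
      (fun t => eLpNorm (fun y => f t (y * e t) - f t₀ (y * e t₀)) 2 (leb 1)) _).1 (hf.tendsto t₀ t₀.2)
  have h := (key hf).inner (𝕜 := ℝ) (key hq)
  have h2 : ContinuousOn (fun t => e t * ∫ y, f t (y * e t) * q t (y * e t) ∂(leb 1)) I := by
    refine he.continuousOn.mul (continuousOn_iff_continuous_domRestrict.2 ?_)
    refine h.congr fun t => ?_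
    rw [L2.inner_def]
    refine integral_congr_ae ?_
    filter_upwards [(hf.memLp t t.2).coeFn_toLp, (hq.memLp t t.2).coeFn_toLp] with y h1 h2
    rw [h1, h2]
    simp [mul_comm]
  refine h2.congr fun t ht => ?_
  exact integral_leb (hpos t ht) _

end ContinuousInL2

/-! ### Calculus of smooth functions of (t, x). -/

section PartialDerivatives

/-- The partial derivative in time of a function of `(t, x)`. -/
def dt (f : ℝ × ℝ → ℝ) (z : ℝ × ℝ) : ℝ := fderiv ℝ f z (1, 0)

/-- The partial derivative in space of a function of `(t, x)`. -/
def dx (f : ℝ × ℝ → ℝ) (z : ℝ × ℝ) : ℝ := fderiv ℝ f z (0, 1)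

variable {f g : ℝ × ℝ → ℝ}

theorem contDiff_dt (hf : ContDiff ℝ ∞ f) : ContDiff ℝ ∞ (dt f) :=
  (hf.fderiv_right (m := ∞) (by simp)).clm_apply contDiff_const

theorem contDiff_dx (hf : ContDiff ℝ ∞ f) : ContDiff ℝ ∞ (dx f) :=
  (hf.fderiv_right (m := ∞) (by simp)).clm_apply contDiff_const

theorem hasDerivAt_dt (hf : ContDiff ℝ ∞ f) (t x : ℝ) :
    HasDerivAt (fun s => f (s, x)) (dt f (t, x)) t :=
  ((hf.differentiable (by simp) (t, x)).hasFDerivAt).comp_hasDerivAt t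
    ((hasDerivAt_id t).prodMk (hasDerivAt_const t x))

theorem hasDerivAt_dx (hf : ContDiff ℝ ∞ f) (t x : ℝ) :
    HasDerivAt (fun y => f (t, y)) (dx f (t, x)) x :=
  ((hf.differentiable (by simp) (t, x)).hasFDerivAt).comp_hasDerivAt x
    ((hasDerivAt_const x t).prodMk (hasDerivAt_id x))

theorem deriv_slice_dx (hf : ContDiff ℝ ∞ f) (t : ℝ) :
    deriv (fun y => f (t, y)) = fun x => dx f (t, x) :=
  funext fun x => (hasDerivAt_dx hf t x).deriv

theorem dt_add (hf : ContDiff ℝ ∞ f) (hg : ContDiff ℝ ∞ g) : dt (f + g) = dt f + dt g := by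
  ext z
  simp only [dt, Pi.add_apply]
  rw [fderiv_add (hf.differentiable (by simp) z) (hg.differentiable (by simp) z)]
  rfl

theorem dx_add (hf : ContDiff ℝ ∞ f) (hg : ContDiff ℝ ∞ g) : dx (f + g) = dx f + dx g := by
  ext z
  simp only [dx, Pi.add_apply]
  rw [fderiv_add (hf.differentiable (by simp) z) (hg.differentiable (by simp) z)]
  rfl

theorem dt_smul (hf : ContDiff ℝ ∞ f) (c : ℝ) : dt (c • f) = c • dt f := by
  ext z
  simp only [dt, Pi.smul_apply]
  rw [fderiv_const_smul (hf.differentiable (by simp) z)]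
  rfl

theorem dx_smul (hf : ContDiff ℝ ∞ f) (c : ℝ) : dx (c • f) = c • dx f := by
  ext z
  simp only [dx, Pi.smul_apply]
  rw [fderiv_const_smul (hf.differentiable (by simp) z)]
  rfl

theorem dt_dx_comm (hf : ContDiff ℝ ∞ f) : dt (dx f) = dx (dt f) := by
  ext z
  have hs : IsSymmSndFDerivAt ℝ f z := hf.contDiffAt.isSymmSndFDerivAt (by
    rw [minSmoothness_of_isRCLikeNormedField]
    exact WithTop.coe_le_coe.2 le_top)
  have hd : DifferentiableAt ℝ (fderiv ℝ f) z :=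
    (hf.fderiv_right (m := ∞) (by simp)).differentiable (by simp) z
  have key : ∀ v w : ℝ × ℝ, fderiv ℝ (fun z => fderiv ℝ f z v) z w = fderiv ℝ (fderiv ℝ f) z w v := by
    intro v w
    rw [(hd.hasFDerivAt.clm_apply (hasFDerivAt_const v z)).fderiv]
    simp
  change fderiv ℝ (fun z => fderiv ℝ f z (0, 1)) z (1, 0) =
    fderiv ℝ (fun z => fderiv ℝ f z (1, 0)) z (0, 1)
  rw [key, key]
  exact hs _ _

end PartialDerivatives

/-! ### Integration by parts for weak derivatives in space, and classical derivatives as weak ones.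
-/

section WeakDerivatives

variable {L : ℝ} {u p : ℝ → ℝ}

theorem IsWeakDeriv.exists_primitive (hL : 0 < L) (hu : MemLp u 2 (leb L)) (hp : MemLp p 2 (leb L))
    (h : IsWeakDeriv L u p) : ∃ c : ℝ, u =ᵐ[leb L] fun x => c + ∫ y in (0 : ℝ)..x, p y :=
  exists_ae_eq_primitive hL (hu.integrable (by norm_num)) (hp.integrable (by norm_num)) h

/-- Integration by parts of a weakly differentiable function against a function that vanishes at
the boundary. -/
theorem IsWeakDeriv.integral_mul (hL : 0 < L) (hu : MemLp u 2 (leb L)) (hp : MemLp p 2 (leb L))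
    (h : IsWeakDeriv L u p) {f : ℝ → ℝ} (hf : ContDiff ℝ 1 f) (h0 : f 0 = 0) (h1 : f L = 0) :
    ∫ x, f x * p x ∂(leb L) = - ∫ x, deriv f x * u x ∂(leb L) := by
  obtain ⟨c, hc⟩ := h.exists_primitive hL hu hp
  have e := integral_mul_eq_sub_of_primitive hL.le (hp.integrable (by norm_num)) hf c
  rw [h0, h1, zero_mul, zero_mul, sub_zero, zero_sub] at e
  rw [e]
  congr 1
  refine integral_congr_ae ?_
  filter_upwards [hc] with x hx
  rw [hx]

/-- Integration by parts of a weakly differentiable function with zero traces. -/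
theorem IsWeakDeriv.integral_mul_of_hasTrace (hL : 0 < L) (hu : MemLp u 2 (leb L))
    (hp : MemLp p 2 (leb L)) (h : IsWeakDeriv L u p) (h0 : HasTrace L u 0 0) (h1 : HasTrace L u L 0)
    {f : ℝ → ℝ} (hf : ContDiff ℝ 1 f) :
    ∫ x, f x * p x ∂(leb L) = - ∫ x, deriv f x * u x ∂(leb L) := by
  obtain ⟨c, hc⟩ := h.exists_primitive hL hu hp
  have hp' : IntervalIntegrable p volume 0 L := by
    rw [intervalIntegrable_iff_integrableOn_Ioo_of_le hL.le]
    exact hp.integrable (by norm_num)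
  have hcont : ContinuousOn (fun x => c + ∫ y in (0 : ℝ)..x, p y) (Icc 0 L) := by
    have := (hp'.absolutelyContinuousOnInterval_intervalIntegral (c := 0) (by simp)).continuousOn
    rw [uIcc_of_le hL.le] at this
    exact continuousOn_const.add this
  -- Two continuous representatives agree on the whole closed interval, so the trace is the value of
  -- the primitive at the endpoint.
  have htr : ∀ x₀ ∈ Icc 0 L, HasTrace L u x₀ 0 → c + ∫ y in (0 : ℝ)..x₀, p y = 0 := by
    rintro x₀ hx₀ ⟨w, hw, huw, hw0⟩
    refine Eq.trans ?_ hw0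
    refine Measure.eqOn_Icc_of_ae_eq volume hL.ne ?_ hcont hw hx₀
    rw [← restrict_Ioo_eq_restrict_Icc]
    exact hc.symm.trans huw
  have e := integral_mul_eq_sub_of_primitive hL.le (hp.integrable (by norm_num)) hf c
  have e0 := htr 0 (by simp [hL.le]) h0
  have e1 := htr L (by simp [hL.le]) h1
  rw [intervalIntegral.integral_same, add_zero] at e0
  rw [e1, e0, mul_zero, mul_zero, sub_zero, zero_sub] at e
  rw [e]
  congr 1
  refine integral_congr_ae ?_
  filter_upwards [hc] with x hx
  rw [hx, e0]

/-- A classical derivative is a weak derivative. -/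
theorem isWeakDeriv_of_hasDerivAt (hu : Continuous u) (hp : Continuous p)
    (h : ∀ x, HasDerivAt u (p x) x) : IsWeakDeriv L u p := by
  intro η h1 h2 h3
  have hd : Continuous (deriv η) := h1.continuous_deriv (by simp)
  have key : ∀ (f χ : ℝ → ℝ), tsupport χ ⊆ Ioo 0 L →
      ∫ x, f x * χ x ∂(leb L) = ∫ x, f x * χ x := fun f χ hχ =>
    setIntegral_eq_integral_of_forall_compl_eq_zero fun x hx => by
      rw [image_eq_zero_of_notMem_tsupport fun h => hx (hχ h), mul_zero]
  rw [key _ _ (tsupport_deriv_subset.trans h3), key _ _ h3]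
  exact integral_mul_deriv_eq_deriv_mul_of_integrable (fun x _ => h x)
    (fun x _ => ((h1.differentiable (by simp)) x).hasDerivAt)
    ((hu.mul hd).integrable_of_hasCompactSupport h2.deriv.mul_left)
    ((hp.mul h1.continuous).integrable_of_hasCompactSupport h2.mul_left)
    ((hu.mul h1.continuous).integrable_of_hasCompactSupport h2.mul_left)

theorem isWeakTimeDeriv_of_hasDerivAt {e : ℝ → ℝ} {a b : ℝ} {v vt : ℝ → ℝ → ℝ}
    (hv : Continuous fun z : ℝ × ℝ => v z.1 z.2) (hvt : Continuous fun z : ℝ × ℝ => vt z.1 z.2)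
    (h : ∀ t x, HasDerivAt (fun s => v s x) (vt t x) t) : IsWeakTimeDeriv e a b v vt := by
  intro φ h1 h2 h3
  have key : ∀ (f χ : ℝ × ℝ → ℝ), tsupport χ ⊆ movingDomain e (Ioo a b) →
      ∫ x in movingDomain e (Ioo a b), f x * χ x = ∫ x, f x * χ x := fun f χ hχ =>
    setIntegral_eq_integral_of_forall_compl_eq_zero fun x hx => by
      rw [image_eq_zero_of_notMem_tsupport fun h => hx (hχ h), mul_zero]
  have hd : ∀ z : ℝ × ℝ, deriv (fun s => φ (s, z.2)) z.1 = dt φ z := fun z =>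
    (hasDerivAt_dt h1 z.1 z.2).deriv
  have hs : tsupport (dt φ) ⊆ tsupport φ := by
    refine (closure_mono fun z hz => ?_).trans (tsupport_fderiv_subset ℝ (f := φ))
    intro h0
    exact hz (by simp [dt, h0])
  have hcs : HasCompactSupport (dt φ) := h2.of_isClosed_subset (isClosed_tsupport _) hs
  have hdc : Continuous (dt φ) := (contDiff_dt h1).continuous
  simp only [hd]
  rw [key _ _ (hs.trans h3), key (fun z => vt z.1 z.2) _ h3]
  have hline : ∀ {f : ℝ × ℝ → ℝ} {f' : ℝ} {z : ℝ × ℝ}, HasDerivAt (fun s => f (s, z.2)) f' z.1 →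
      HasLineDerivAt ℝ f f' z (1, 0) := by
    intro f f' z hf
    have e : HasDerivAt (fun s : ℝ => z.1 + s) 1 0 := by simpa using (hasDerivAt_id (0 : ℝ)).const_add z.1
    have := HasDerivAt.comp (0 : ℝ) (h₂ := fun s => f (s, z.2)) (by simpa using hf) e
    rw [mul_one] at this
    refine this.congr_of_eventuallyEq (Eventually.of_forall fun s => ?_)
    have e2 : z + s • ((1, 0) : ℝ × ℝ) = (z.1 + s, z.2) := by
      ext <;> simp
    simp only [e2, Function.comp_apply]
  exact integral_bilinear_hasLineDerivAt_right_eq_neg_left_of_integrable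
    (B := ContinuousLinearMap.mul ℝ ℝ) (v := (1, 0)) (f := fun z : ℝ × ℝ => v z.1 z.2)
    (f' := fun z : ℝ × ℝ => vt z.1 z.2)
    ((hvt.mul h1.continuous).integrable_of_hasCompactSupport h2.mul_left)
    ((hv.mul hdc).integrable_of_hasCompactSupport hcs.mul_left)
    ((hv.mul h1.continuous).integrable_of_hasCompactSupport h2.mul_left)
    (fun z _ => hline (f := fun z : ℝ × ℝ => v z.1 z.2) (h z.1 z.2))
    (fun z _ => hline (hasDerivAt_dt h1 z.1 z.2))

end WeakDerivatives

/-! ### Regular functions on the moving domain; smooth functions as test functions. -/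

section RegularFunctions

variable {e : ℝ → ℝ} {τ T : ℝ}

theorem exists_compact_superset_movingDomain (he : Continuous e) (τ T : ℝ) :
    ∃ K : Set (ℝ × ℝ), IsCompact K ∧ movingDomain e (Ioo τ T) ⊆ K := by
  obtain ⟨C, hC⟩ := (isCompact_Icc (a := τ) (b := T)).exists_bound_of_continuousOn he.continuousOn
  refine ⟨Icc τ T ×ˢ Icc 0 C, isCompact_Icc.prod isCompact_Icc, fun z hz => ?_⟩
  have hzI := Ioo_subset_Icc_self hz.1
  exact ⟨hzI, hz.2.1.le, hz.2.2.le.trans ((le_abs_self _).trans (hC _ hzI))⟩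

theorem isFiniteMeasure_movingDomain (he : Continuous e) (τ T : ℝ) :
    IsFiniteMeasure (volume.restrict (movingDomain e (Ioo τ T))) := by
  obtain ⟨K, hK, hK'⟩ := exists_compact_superset_movingDomain he τ T
  exact ⟨by
    rw [Measure.restrict_apply_univ]
    exact (measure_mono hK').trans_lt hK.measure_lt_top⟩

theorem exists_ae_bound_movingDomain (he : Continuous e) {f : ℝ × ℝ → ℝ} (hf : Continuous f) :
    ∃ C : ℝ, ∀ᵐ z ∂(volume.restrict (movingDomain e (Ioo τ T))), ‖f z‖ ≤ C := by
  obtain ⟨K, hK, hK'⟩ := exists_compact_superset_movingDomain he τ T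
  obtain ⟨C, hC⟩ := hK.exists_bound_of_continuousOn hf.continuousOn
  refine ⟨C, ?_⟩
  filter_upwards [ae_restrict_mem (measurableSet_movingDomain he measurableSet_Ioo)] with z hz
  exact hC z (hK' hz)

theorem memLp_movingDomain_of_continuous (he : Continuous e) {f : ℝ × ℝ → ℝ} (hf : Continuous f) :
    MemLp f 2 (volume.restrict (movingDomain e (Ioo τ T))) := by
  have := isFiniteMeasure_movingDomain he τ T
  obtain ⟨C, hC⟩ := exists_ae_bound_movingDomain (τ := τ) (T := T) he hf
  exact MemLp.of_bound hf.aestronglyMeasurable C hC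

theorem integrableOn_mul_movingDomain (he : Continuous e) {f g : ℝ × ℝ → ℝ} (hf : Continuous f)
    (hg : MemLp g 2 (volume.restrict (movingDomain e (Ioo τ T)))) :
    IntegrableOn (fun z => f z * g z) (movingDomain e (Ioo τ T)) :=
  (memLp_movingDomain_of_continuous he hf).integrable_mul hg

/-- Functions on the moving domain that are square-integrable together with their first weak
derivatives, and continuous in time. -/
structure IsRegular (e : ℝ → ℝ) (τ T : ℝ) (v vt vx : ℝ → ℝ → ℝ) : Prop where
  memLp : MemLp (fun z : ℝ × ℝ => v z.1 z.2) 2 (volume.restrict (movingDomain e (Ioo τ T)))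
  memLp_x : MemLp (fun z : ℝ × ℝ => vx z.1 z.2) 2 (volume.restrict (movingDomain e (Ioo τ T)))
  weakDeriv_x : ∀ᵐ t ∂(volume.restrict (Ioo τ T)), IsWeakDeriv (e t) (v t) (vx t)
  continuous : ContinuousInL2 e (Icc τ T) v
  memLp_t : MemLp (fun z : ℝ × ℝ => vt z.1 z.2) 2 (volume.restrict (movingDomain e (Ioo τ T)))
  weakDeriv_t : IsWeakTimeDeriv e τ T v vt

theorem IsTestFunction.isRegular {v vt vx vxx : ℝ → ℝ → ℝ} (h : IsTestFunction e τ T v vt vx vxx) :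
    IsRegular e τ T v vt vx :=
  ⟨h.memLp, h.memLp_x, h.weakDeriv_x, h.continuous, h.memLp_t, h.weakDeriv_t⟩

variable {v vt vx vxx : ℝ → ℝ → ℝ}

theorem isRegular_of_hasDerivAt (he : Continuous e) (hv : Continuous fun z : ℝ × ℝ => v z.1 z.2)
    (hvt : Continuous fun z : ℝ × ℝ => vt z.1 z.2) (hvx : Continuous fun z : ℝ × ℝ => vx z.1 z.2)
    (ht : ∀ t x, HasDerivAt (fun s => v s x) (vt t x) t)
    (hx : ∀ t x, HasDerivAt (v t) (vx t x) x) : IsRegular e τ T v vt vx where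
  memLp := memLp_movingDomain_of_continuous he hv
  memLp_x := memLp_movingDomain_of_continuous he hvx
  weakDeriv_x := Eventually.of_forall fun t => isWeakDeriv_of_hasDerivAt
    (hv.comp (continuous_const.prodMk continuous_id))
    (hvx.comp (continuous_const.prodMk continuous_id)) (hx t)
  continuous := continuousInL2_of_continuous he hv
  memLp_t := memLp_movingDomain_of_continuous he hvt
  weakDeriv_t := isWeakTimeDeriv_of_hasDerivAt hv hvt ht

theorem isTestFunction_of_hasDerivAt (he : Continuous e)
    (hv : Continuous fun z : ℝ × ℝ => v z.1 z.2)
    (hvt : Continuous fun z : ℝ × ℝ => vt z.1 z.2) (hvx : Continuous fun z : ℝ × ℝ => vx z.1 z.2)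
    (hvxx : Continuous fun z : ℝ × ℝ => vxx z.1 z.2)
    (ht : ∀ t x, HasDerivAt (fun s => v s x) (vt t x) t)
    (hx : ∀ t x, HasDerivAt (v t) (vx t x) x) (hxx : ∀ t x, HasDerivAt (vx t) (vxx t x) x)
    (hT : ∀ x, v T x = 0) (h0 : ∀ t ∈ Ioo τ T, vx t 0 = 0) (h1 : ∀ t ∈ Ioo τ T, vx t (e t) = 0) :
    IsTestFunction e τ T v vt vx vxx :=
  have h := isRegular_of_hasDerivAt (τ := τ) (T := T) he hv hvt hvx ht hx
  have hs : ∀ t, Continuous (vx t) := fun t => hvx.comp (continuous_const.prodMk continuous_id)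
  { memLp := h.memLp
    memLp_x := h.memLp_x
    memLp_xx := memLp_movingDomain_of_continuous he hvxx
    weakDeriv_x := h.weakDeriv_x
    weakDeriv_xx := Eventually.of_forall fun t => isWeakDeriv_of_hasDerivAt (hs t)
      (hvxx.comp (continuous_const.prodMk continuous_id)) (hxx t)
    continuous := h.continuous
    memLp_t := h.memLp_t
    weakDeriv_t := h.weakDeriv_t
    terminal := Eventually.of_forall hT
    neumann_left := by
      filter_upwards [ae_restrict_mem measurableSet_Ioo] with t ht
      exact ⟨vx t, (hs t).continuousOn, EventuallyEq.rfl, h0 t ht⟩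
    neumann_right := by
      filter_upwards [ae_restrict_mem measurableSet_Ioo] with t ht
      exact ⟨vx t, (hs t).continuousOn, EventuallyEq.rfl, h1 t ht⟩ }

end RegularFunctions

/-! ### Smooth positive extension of the thickness to negative times. -/

theorem continuous_thickness (e₀ vbar : ℝ) : Continuous (thickness e₀ vbar) := by
  unfold thickness
  fun_prop

theorem thickness_pos {e₀ vbar t : ℝ} (he₀ : 0 < e₀) (hv : 0 < vbar) (ht : 0 ≤ t) :
    0 < thickness e₀ vbar t := by
  unfold thickness
  positivity

/-- The thickness for nonnegative times extends to a smooth positive function on the line. -/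
theorem exists_smooth_thickness {e₀ vbar : ℝ} (he₀ : 0 < e₀) (hv : 0 < vbar) :
    ∃ E : ℝ → ℝ, ContDiff ℝ ∞ E ∧ (∀ t, 0 < E t) ∧ (∀ t, 0 ≤ t → E t = thickness e₀ vbar t) ∧
      ∀ t, 0 ≤ t → HasDerivAt E vbar t := by
  -- At time a the thickness is still e₀/2. The transition from the constant 1 to the thickness
  -- takes place on [a, a/2], inside the negative half-line, so that the extension agrees with the
  -- thickness in a neighbourhood of every t ≥ 0 and has the same derivative there.
  set a := - e₀ / (2 * vbar) with ha
  have ha0 : a < 0 := by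
    rw [ha, neg_div]
    have : 0 < e₀ / (2 * vbar) := by positivity
    linarith
  have hav : a * vbar = - e₀ / 2 := by
    rw [ha]
    field_simp
  set S : ℝ → ℝ := fun t => Real.smoothTransition ((t - a) / (- a / 2)) with hS
  have hden : 0 < - a / 2 := by linarith
  have hS1 : ∀ t, a / 2 ≤ t → S t = 1 := fun t ht =>
    Real.smoothTransition.one_of_one_le (by rw [le_div_iff₀ hden]; linarith)
  have hS0 : ∀ t, t ≤ a → S t = 0 := fun t ht =>
    Real.smoothTransition.zero_of_nonpos (div_nonpos_of_nonpos_of_nonneg (by linarith) hden.le)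
  have hSm : ContDiff ℝ ∞ S := by
    have : ContDiff ℝ ∞ Real.smoothTransition := Real.smoothTransition.contDiff
    exact this.comp (by fun_prop)
  have hE : ∀ t, a / 2 ≤ t →
      S t * thickness e₀ vbar t + (1 - S t) = thickness e₀ vbar t := fun t ht => by
    rw [hS1 t ht]
    ring
  refine ⟨fun t => S t * thickness e₀ vbar t + (1 - S t), ?_, fun t => ?_, fun t ht =>
    hE t (by linarith), fun t ht => ?_⟩
  · unfold thickness
    fun_prop
  · change 0 < S t * thickness e₀ vbar t + (1 - S t)
    rcases le_or_gt t a with h | h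
    · rw [hS0 t h]
      norm_num
    · have h1 : 0 ≤ S t := Real.smoothTransition.nonneg _
      have h2 : S t ≤ 1 := Real.smoothTransition.le_one _
      have h3 : 0 < thickness e₀ vbar t := by
        unfold thickness
        nlinarith
      rcases h1.eq_or_lt with h4 | h4
      · rw [← h4]
        norm_num
      · have := mul_pos h4 h3
        linarith
  · have h1 : HasDerivAt (thickness e₀ vbar) vbar t := by
      exact (((hasDerivAt_id t).mul_const vbar).const_add e₀).congr_deriv (one_mul _)
    refine h1.congr_of_eventuallyEq ?_
    filter_upwards [lt_mem_nhds (show a / 2 < t by linarith)] with s hs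
    exact hE s hs.le

/-! ### Explicit solutions of the heat equation on the linearly moving interval. -/

section Modes

/-- The explicit solutions of `∂ₜ P + σ ∂ₓₓ P = 0` on the moving domain; they vanish at `x = 0`, and
at `x = E t` if `k` is a multiple of `π`. -/
def mode (E : ℝ → ℝ) (vbar σ k : ℝ) (z : ℝ × ℝ) : ℝ :=
  Real.exp (- Real.log (E z.1) / 2 + vbar * z.2 ^ 2 / (4 * σ * E z.1) - k ^ 2 * σ / (vbar * E z.1)) *
    Real.sin (k * z.2 / E z.1)

variable {E : ℝ → ℝ} {vbar σ : ℝ}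

theorem contDiff_mode (hE : ContDiff ℝ ∞ E) (hpos : ∀ t, 0 < E t) (hv : vbar ≠ 0) (hσ : σ ≠ 0)
    (k : ℝ) : ContDiff ℝ ∞ (mode E vbar σ k) := by
  have h1 : ContDiff ℝ ∞ fun z : ℝ × ℝ => E z.1 := hE.comp contDiff_fst
  have h0 : ∀ z : ℝ × ℝ, E z.1 ≠ 0 := fun z => (hpos z.1).ne'
  have h2 : ∀ z : ℝ × ℝ, 4 * σ * E z.1 ≠ 0 := fun z => mul_ne_zero (by simpa using hσ) (h0 z)
  have h3 : ∀ z : ℝ × ℝ, vbar * E z.1 ≠ 0 := fun z => mul_ne_zero hv (h0 z)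
  unfold mode
  have h4 := h1.log h0
  exact (((((h4.neg).div_const 2).add ((contDiff_const.mul (contDiff_snd.pow 2)).div
    (contDiff_const.mul h1) h2)).sub (contDiff_const.div (contDiff_const.mul h1) h3)).exp).mul
    ((contDiff_const.mul contDiff_snd).div h1 h0).sin

theorem mode_zero (k t : ℝ) : mode E vbar σ k (t, 0) = 0 := by simp [mode]

theorem mode_right (hpos : ∀ t, 0 < E t) (n : ℕ) (t : ℝ) :
    mode E vbar σ ((n + 1) * Real.pi) (t, E t) = 0 := by
  have h : ((n : ℝ) + 1) * Real.pi * E t / E t = ((n + 1 : ℕ) : ℝ) * Real.pi := by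
    rw [mul_div_assoc, div_self (hpos t).ne', mul_one]
    push_cast
    ring
  simp only [mode]
  rw [h, Real.sin_nat_mul_pi, mul_zero]

/-- In the variable x/E the motion of the domain produces a drift, which the Gaussian weight and the
factor E^(-1/2) remove. What is left is diffusion at rate σ/E², for which sin(kx/E) is an
eigenfunction; as -1/(v̄E) is a primitive of 1/E², the amplitude is exp(-k²σ/(v̄E)). The sign of σ
is free: replacing σ by -σ gives the modes of the forward equation. -/
theorem mode_equation (hE : ContDiff ℝ ∞ E) (hpos : ∀ t, 0 < E t) (hv : vbar ≠ 0) (hσ : σ ≠ 0)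
    (k : ℝ) {t : ℝ} (ht : HasDerivAt E vbar t) (x : ℝ) :
    dt (mode E vbar σ k) (t, x) + σ * dx (dx (mode E vbar σ k)) (t, x) = 0 := by
  have hm := contDiff_mode hE hpos hv hσ k
  have h0 := (hpos t).ne'
  set φ : ℝ → ℝ → ℝ := fun t x =>
    - Real.log (E t) / 2 + vbar * x ^ 2 / (4 * σ * E t) - k ^ 2 * σ / (vbar * E t) with hφ
  have hφx : ∀ x, HasDerivAt (fun x => φ t x) (vbar * x / (2 * σ * E t)) x := by
    intro x
    have := (((((hasDerivAt_id x).pow 2).const_mul vbar).div_const (4 * σ * E t)).const_add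
      (- Real.log (E t) / 2)).sub_const (k ^ 2 * σ / (vbar * E t))
    refine this.congr_deriv ?_
    simp
    field_simp
    ring
  have hsx : ∀ x, HasDerivAt (fun x => k * x / E t) (k / E t) x := by
    intro x
    simpa using ((hasDerivAt_id x).const_mul k).div_const (E t)
  have hx : ∀ x, HasDerivAt (fun x => mode E vbar σ k (t, x))
      (Real.exp (φ t x) * (vbar * x / (2 * σ * E t) * Real.sin (k * x / E t) +
        k / E t * Real.cos (k * x / E t))) x := by
    intro x
    refine ((hφx x).exp.mul (hsx x).sin).congr_deriv ?_
    ring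
  have hdx : ∀ x, dx (mode E vbar σ k) (t, x) = Real.exp (φ t x) *
      (vbar * x / (2 * σ * E t) * Real.sin (k * x / E t) + k / E t * Real.cos (k * x / E t)) :=
    fun x => (hasDerivAt_dx hm t x).unique (hx x)
  have hlin : HasDerivAt (fun x => vbar * x / (2 * σ * E t)) (vbar / (2 * σ * E t)) x := by
    simpa using ((hasDerivAt_id x).const_mul vbar).div_const (2 * σ * E t)
  have hxx := (hasDerivAt_dx (contDiff_dx hm) t x).unique
    (((hφx x).exp.mul ((hlin.mul (hsx x).sin).add ((hsx x).cos.const_mul (k / E t)))).congr_of_eventuallyEq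
      (Eventually.of_forall hdx))
  have ht1 : HasDerivAt (fun s => φ s x) (- (vbar / E t) / 2 - vbar ^ 2 * x ^ 2 / (4 * σ * E t ^ 2)
      + k ^ 2 * σ / E t ^ 2) t := by
    have a1 := ((ht.log h0).neg).div_const 2
    have a2 := (hasDerivAt_const t (vbar * x ^ 2)).div (ht.const_mul (4 * σ)) (by positivity)
    have a3 := (hasDerivAt_const t (k ^ 2 * σ)).div (ht.const_mul vbar) (by positivity)
    refine ((a1.add a2).sub a3).congr_deriv ?_
    field_simp
    ring
  have ht2 : HasDerivAt (fun s => k * x / E s) (- (k * x * vbar / E t ^ 2)) t := by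
    refine ((hasDerivAt_const t (k * x)).div ht h0).congr_deriv ?_
    field_simp
    ring
  have htt := (hasDerivAt_dt hm t x).unique (ht1.exp.mul ht2.sin)
  rw [htt, hxx]
  simp only [Pi.add_apply, Pi.mul_apply]
  field_simp
  ring

end Modes

/-! ### Primitives in space of functions of (t, x). -/

section Primitives

variable {f : ℝ × ℝ → ℝ}

theorem continuous_primitive (hf : Continuous f) :
    Continuous fun z : ℝ × ℝ => ∫ y in (0 : ℝ)..z.2, f (z.1, y) := by
  have : Continuous (Function.uncurry fun (z : ℝ × ℝ) (y : ℝ) => f (z.1, y)) := by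
    unfold Function.uncurry
    fun_prop
  exact intervalIntegral.continuous_parametric_intervalIntegral_of_continuous this continuous_snd

theorem hasDerivAt_primitive_snd (hf : Continuous f) (t x : ℝ) :
    HasDerivAt (fun x => ∫ y in (0 : ℝ)..x, f (t, y)) (f (t, x)) x := by
  have : Continuous fun y => f (t, y) := by fun_prop
  exact (this.integral_hasStrictDerivAt 0 x).hasDerivAt

theorem hasDerivAt_primitive_fst (hf : ContDiff ℝ ∞ f) (t x : ℝ) :
    HasDerivAt (fun s => ∫ y in (0 : ℝ)..x, f (s, y)) (∫ y in (0 : ℝ)..x, dt f (t, y)) t := by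
  have hc : ∀ s, Continuous fun y => f (s, y) := fun s =>
    hf.continuous.comp (continuous_const.prodMk continuous_id)
  have hd := (contDiff_dt hf).continuous
  obtain ⟨C, hC⟩ := ((isCompact_closedBall t 1).prod (isCompact_uIcc (a := (0 : ℝ)) (b := x))
    ).exists_bound_of_continuousOn hd.continuousOn
  refine (intervalIntegral.hasDerivAt_integral_of_dominated_loc_of_deriv_le (μ := volume)
    (F := fun s y => f (s, y)) (F' := fun s y => dt f (s, y)) (bound := fun _ => C)
    (Metric.closedBall_mem_nhds t one_pos)
    (Eventually.of_forall fun s => (hc s).aestronglyMeasurable) ((hc t).intervalIntegrable _ _)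
    (hd.comp (continuous_const.prodMk continuous_id)).aestronglyMeasurable ?_ (by simp) ?_).2
  · exact Eventually.of_forall fun y hy s hs => hC (s, y) ⟨hs, uIoc_subset_uIcc hy⟩
  · exact Eventually.of_forall fun y _ s _ => hasDerivAt_dt hf s y

end Primitives

/-! ### Uniqueness by duality with primitives of the backward modes. -/

section Uniqueness

theorem eqOn_zero_of_setIntegral_Ioo_eq_zero {φ : ℝ → ℝ} {τ : ℝ} (hφ : ContinuousOn φ (Ici τ))
    (h : ∀ T, τ < T → ∫ t in Ioo τ T, φ t = 0) : ∀ t, τ ≤ t → φ t = 0 := by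
  have h1 : EqOn φ (fun _ => 0) (Ioi τ) := by
    intro t ht
    have hat : ContinuousAt φ t := hφ.continuousAt (Ici_mem_nhds ht)
    have hi : IntervalIntegrable φ volume τ t :=
      (hφ.mono (by rw [uIcc_of_le (le_of_lt ht)]; exact Icc_subset_Ici_self)).intervalIntegrable
    have hm : StronglyMeasurableAtFilter φ (𝓝 t) :=
      ⟨Ici τ, Ici_mem_nhds ht, hφ.aestronglyMeasurable measurableSet_Ici⟩
    have hd := intervalIntegral.integral_hasDerivAt_right hi hm hat
    refine hd.unique ((hasDerivAt_const t (0 : ℝ)).congr_of_eventuallyEq ?_)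
    filter_upwards [lt_mem_nhds (show τ < t from ht)] with s hs
    rw [intervalIntegral.integral_of_le hs.le, integral_Ioc_eq_integral_Ioo, h s hs]
  intro t ht
  exact h1.of_subset_closure hφ continuousOn_const Ioi_subset_Ici_self (by rw [closure_Ioi]) ht

/-- The identity that a weak solution satisfies when it is tested with `(T - t) V`, up to an
exponential factor. -/
theorem WeakFormulation.integral_pairing {e : ℝ → ℝ} (he : Continuous e) {τ σ lam : ℝ}
    {g₀ : ℝ → ℝ} {h : ℝ → ℝ → ℝ} (hpos : ∀ t, τ ≤ t → 0 < e t) (hc : ContinuousInL2 e (Ici τ) h)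
    (hw : WeakFormulation e τ σ lam g₀ h) {V Vt Vx Vxx : ℝ → ℝ → ℝ} {q : ℝ → ℝ}
    (hV : Continuous fun z : ℝ × ℝ => V z.1 z.2) (hVt : Continuous fun z : ℝ × ℝ => Vt z.1 z.2)
    (hVx : Continuous fun z : ℝ × ℝ => Vx z.1 z.2) (hVxx : Continuous fun z : ℝ × ℝ => Vxx z.1 z.2)
    (ht : ∀ t x, HasDerivAt (fun s => V s x) (Vt t x) t) (hx : ∀ t x, HasDerivAt (V t) (Vx t x) x)
    (hxx : ∀ t x, HasDerivAt (Vx t) (Vxx t x) x) (h0 : ∀ t, τ ≤ t → Vx t 0 = 0)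
    (h1 : ∀ t, τ ≤ t → Vx t (e t) = 0) (hq : ∀ t x, τ ≤ t → Vt t x + σ * Vxx t x = q t)
    {T : ℝ} (hT : τ < T) :
    (∫ t in Ioo τ T, Real.exp (lam * (t - τ)) * (- (∫ x in Ioo 0 (e t), h t x * V t x) +
      (T - t) * q t * ∫ x in Ioo 0 (e t), h t x * 1)) +
      (T - τ) * ∫ x in Ioo 0 (e τ), g₀ x * V τ x = 0 := by
  -- The exponential absorbs the damping term, and the factor T - t provides the terminal condition:
  -- a' - λa = -exp(λ(t-τ)). The remaining dependence on T is explicit, so that T can be varied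
  -- afterwards.
  set a : ℝ → ℝ := fun t => (T - t) * Real.exp (lam * (t - τ)) with ha
  set a' : ℝ → ℝ := fun t => - Real.exp (lam * (t - τ)) + lam * a t with ha'
  have hac : Continuous a := by fun_prop
  have hac' : Continuous a' := by fun_prop
  have had : ∀ t, HasDerivAt a (a' t) t := by
    intro t
    have h2 : HasDerivAt (fun t => Real.exp (lam * (t - τ))) (Real.exp (lam * (t - τ)) * lam) t := by
      simpa using (((hasDerivAt_id t).sub_const τ).const_mul lam).exp
    refine (((hasDerivAt_id t).const_sub T).mul h2).congr_deriv ?_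
    simp only [ha', ha, id_eq]
    ring
  have htest : IsTestFunction e τ T (fun t x => a t * V t x)
      (fun t x => a' t * V t x + a t * Vt t x) (fun t x => a t * Vx t x)
      (fun t x => a t * Vxx t x) := by
    have hac1 : Continuous fun z : ℝ × ℝ => a z.1 := hac.comp continuous_fst
    have hac2 : Continuous fun z : ℝ × ℝ => a' z.1 := hac'.comp continuous_fst
    refine isTestFunction_of_hasDerivAt he (hac1.mul hV) ((hac2.mul hV).add (hac1.mul hVt))
      (hac1.mul hVx) (hac1.mul hVxx) (fun t x => (had t).mul (ht t x)) (fun t x => (hx t x).const_mul _)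
      (fun t x => (hxx t x).const_mul _) (fun x => by simp [ha]) (fun t ht' => ?_) (fun t ht' => ?_)
    · simp [h0 t ht'.1.le]
    · simp [h1 t ht'.1.le]
  have key := hw T hT _ _ _ _ htest
  have e1 : ∫ x in Ioo 0 (e τ), g₀ x * (a τ * V τ x) = (T - τ) * ∫ x in Ioo 0 (e τ), g₀ x * V τ x := by
    rw [← integral_const_mul]
    congr 1
    ext x
    simp [ha]
    ring
  rw [e1] at key
  refine Eq.trans ?_ key
  congr 1
  refine setIntegral_congr_fun measurableSet_Ioo fun t ht' => ?_
  have hL := hc.memLp_slice (t := t) ht'.1.le (hpos t ht'.1.le)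
  have hi1 : Integrable (fun x => h t x * V t x) (leb (e t)) :=
    hL.integrable_mul (memLp_of_continuous (e t) (hV.comp (continuous_const.prodMk continuous_id)))
  have hi2 : Integrable (fun x => h t x * 1) (leb (e t)) :=
    hL.integrable_mul (memLp_of_continuous (e t) (f := fun _ => 1) continuous_const)
  have e2 : ∀ x, h t x * (a' t * V t x + a t * Vt t x + σ * (a t * Vxx t x) - lam * (a t * V t x)) =
      - Real.exp (lam * (t - τ)) * (h t x * V t x) +
        Real.exp (lam * (t - τ)) * ((T - t) * q t) * (h t x * 1) := by
    intro x
    rw [← hq t x ht'.1.le]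
    simp only [ha', ha]
    ring
  change _ = ∫ x in Ioo 0 (e t), h t x *
    (a' t * V t x + a t * Vt t x + σ * (a t * Vxx t x) - lam * (a t * V t x))
  simp only [e2]
  rw [integral_add (hi1.const_mul _) (hi2.const_mul _), integral_const_mul, integral_const_mul]
  ring

/-- The primitives of the modes and the constants are total. -/
theorem ae_eq_zero_of_integral_mul_primitive_mode {E : ℝ → ℝ} {vbar σ : ℝ} (hE : ContDiff ℝ ∞ E)
    (hpos : ∀ t, 0 < E t) (hv : vbar ≠ 0) (hσ : σ ≠ 0) (t : ℝ) {D : ℝ → ℝ}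
    (hD : Integrable D (leb (E t))) (h0 : ∫ x, D x ∂(leb (E t)) = 0)
    (h : ∀ n : ℕ, ∫ x, D x * (∫ y in (0 : ℝ)..x, mode E vbar σ ((n + 1) * Real.pi) (t, y)) ∂(leb (E t)) = 0) :
    D =ᵐ[leb (E t)] 0 := by
  have hL := hpos t
  set L := E t with hLdef
  have hD' : IntervalIntegrable D volume 0 L := by
    rwa [intervalIntegrable_iff_integrableOn_Ioo_of_le hL.le]
  -- The primitive of D vanishes at both ends because D has zero mean. Integration by parts
  -- therefore turns orthogonality of D to the primitives of the modes into orthogonality of H to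
  -- the modes themselves.
  set H : ℝ → ℝ := fun x => ∫ y in (0 : ℝ)..x, D y with hH
  have hHc : ContinuousOn H (Icc 0 L) := by
    have := (hD'.absolutelyContinuousOnInterval_intervalIntegral (c := 0) (by simp)).continuousOn
    rwa [uIcc_of_le hL.le] at this
  have hHL : ∫ x in (0 : ℝ)..L, D x = 0 := by
    rw [intervalIntegral.integral_of_le hL.le, integral_Ioc_eq_integral_Ioo, h0]
  -- At fixed time, the modes are nonzero constants times sines times this common weight, so H A is
  -- orthogonal to all sines.
  set A : ℝ → ℝ := fun x => Real.exp (vbar * x ^ 2 / (4 * σ * L)) with hA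
  have hAc : Continuous A := by fun_prop
  have hHA : IntegrableOn (fun x => H x * A x) (Ioo 0 L) :=
    ((hHc.mul hAc.continuousOn).integrableOn_compact isCompact_Icc).mono_set Ioo_subset_Icc_self
  have hz : (fun x => H x * A x) =ᵐ[volume.restrict (Ioo 0 L)] 0 := by
    refine ae_eq_zero_of_integral_mul_sin hL hHA fun n => ?_
    set k : ℝ := (n + 1) * Real.pi with hk
    have hm := contDiff_mode hE hpos hv hσ k
    have hmc : Continuous fun y => mode E vbar σ k (t, y) :=
      hm.continuous.comp (continuous_const.prodMk continuous_id)
    have hd := hasDerivAt_primitive_snd hm.continuous t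
    have hder : deriv (fun x => ∫ y in (0 : ℝ)..x, mode E vbar σ k (t, y)) =
        fun x => mode E vbar σ k (t, x) := funext fun x => (hd x).deriv
    have hC1 : ContDiff ℝ 1 fun x => ∫ y in (0 : ℝ)..x, mode E vbar σ k (t, y) :=
      contDiff_one_iff_deriv.2 ⟨fun x => (hd x).differentiableAt, by rw [hder]; exact hmc⟩
    have e := integral_mul_eq_sub_of_primitive hL.le hD hC1 0
    rw [hHL, hder] at e
    have e2 := h n
    simp only [mul_comm (D _)] at e2
    rw [e2] at e
    simp only [zero_add, mul_zero, sub_zero, zero_sub] at e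
    have e3 : ∀ x, mode E vbar σ k (t, x) * H x =
        Real.exp (- Real.log L / 2 - k ^ 2 * σ / (vbar * L)) *
        (H x * A x * Real.sin ((n + 1) * (Real.pi * x / L))) := by
      intro x
      have e4 : (- Real.log L / 2 + vbar * x ^ 2 / (4 * σ * L) - k ^ 2 * σ / (vbar * L)) =
        (- Real.log L / 2 - k ^ 2 * σ / (vbar * L)) + vbar * x ^ 2 / (4 * σ * L) := by ring
      have e5 : k * x / L = (n + 1) * (Real.pi * x / L) := by rw [hk]; ring
      simp only [mode, ← hLdef]
      rw [e4, Real.exp_add, e5]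
      ring
    have e6 : ∫ x in Ioo 0 L, mode E vbar σ k (t, x) * H x = 0 := by
      simpa using e.symm
    simp only [e3] at e6
    rw [integral_const_mul] at e6
    exact (mul_eq_zero.1 e6).resolve_left (Real.exp_pos _).ne'
  have hH0 : EqOn H (fun _ => 0) (Icc 0 L) := by
    refine Measure.eqOn_Icc_of_ae_eq volume hL.ne ?_ hHc continuousOn_const
    rw [← restrict_Ioo_eq_restrict_Icc]
    filter_upwards [hz] with x hx
    exact (mul_eq_zero.1 hx).resolve_right (Real.exp_pos _).ne'
  rw [Filter.EventuallyEq, ae_restrict_iff' measurableSet_Ioo]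
  filter_upwards [hD'.ae_hasDerivAt_integral] with x hx hx'
  have hxI : x ∈ uIcc 0 L := by
    rw [uIcc_of_le hL.le]
    exact Ioo_subset_Icc_self hx'
  refine (hx hxI 0 (by simp)).unique ((hasDerivAt_const x (0 : ℝ)).congr_of_eventuallyEq ?_)
  filter_upwards [Ioo_mem_nhds hx'.1 hx'.2] with y hy
  exact hH0 (Ioo_subset_Icc_self hy)

/-- The two solutions are compared through their pairings with the test profiles V. In the
difference of the identities `WeakFormulation.integral_pairing`, the initial terms cancel and, once
the masses agree, so do the terms with q. There remains an integral over (τ, T) that vanishes for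
every T, hence a vanishing integrand. -/
theorem ae_eq_of_weakFormulation {e₀ vbar τ σ lam : ℝ} (he₀ : 0 < e₀) (hv : 0 < vbar) (hτ : 0 ≤ τ)
    (hσ : 0 < σ) {g₀ : ℝ → ℝ} {h₁ h₂ : ℝ → ℝ → ℝ}
    (hc₁ : ContinuousInL2 (thickness e₀ vbar) (Ici τ) h₁)
    (hc₂ : ContinuousInL2 (thickness e₀ vbar) (Ici τ) h₂)
    (hw₁ : WeakFormulation (thickness e₀ vbar) τ σ lam g₀ h₁)
    (hw₂ : WeakFormulation (thickness e₀ vbar) τ σ lam g₀ h₂) {t : ℝ} (ht : τ ≤ t) :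
    h₁ t =ᵐ[leb (thickness e₀ vbar t)] h₂ t := by
  obtain ⟨E, hE, hEpos, hEe, hEd⟩ := exists_smooth_thickness he₀ hv
  set e := thickness e₀ vbar with he
  have hec : Continuous e := continuous_thickness e₀ vbar
  have hpos : ∀ t, τ ≤ t → 0 < e t := fun t ht => thickness_pos he₀ hv (hτ.trans ht)
  have hpc : ∀ {h V : ℝ → ℝ → ℝ}, ContinuousInL2 e (Ici τ) h →
      Continuous (fun z : ℝ × ℝ => V z.1 z.2) →
      ContinuousOn (fun t => ∫ x in Ioo 0 (e t), h t x * V t x) (Ici τ) := fun hh hV =>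
    hh.continuousOn_integral_mul hec hpos (continuousInL2_of_continuous hec hV)
  have key : ∀ {V Vt Vx Vxx : ℝ → ℝ → ℝ} {q : ℝ → ℝ},
      Continuous (fun z : ℝ × ℝ => V z.1 z.2) → Continuous (fun z : ℝ × ℝ => Vt z.1 z.2) →
      Continuous (fun z : ℝ × ℝ => Vx z.1 z.2) → Continuous (fun z : ℝ × ℝ => Vxx z.1 z.2) →
      (∀ t x, HasDerivAt (fun s => V s x) (Vt t x) t) → (∀ t x, HasDerivAt (V t) (Vx t x) x) →
      (∀ t x, HasDerivAt (Vx t) (Vxx t x) x) → (∀ t, τ ≤ t → Vx t 0 = 0) →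
      (∀ t, τ ≤ t → Vx t (e t) = 0) → (∀ t x, τ ≤ t → Vt t x + σ * Vxx t x = q t) →
      (∀ t, τ ≤ t → q t * (∫ x in Ioo 0 (e t), h₁ t x * 1) = q t * ∫ x in Ioo 0 (e t), h₂ t x * 1) →
      ∀ t, τ ≤ t → ∫ x in Ioo 0 (e t), h₁ t x * V t x = ∫ x in Ioo 0 (e t), h₂ t x * V t x := by
    intro V Vt Vx Vxx q a1 a2 a3 a4 a5 a6 a7 a8 a9 a10 a11
    have hz := eqOn_zero_of_setIntegral_Ioo_eq_zero (τ := τ)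
      (φ := fun t => Real.exp (lam * (t - τ)) * ((∫ x in Ioo 0 (e t), h₁ t x * V t x) -
        ∫ x in Ioo 0 (e t), h₂ t x * V t x))
      ((by fun_prop : Continuous fun t => Real.exp (lam * (t - τ))).continuousOn.mul
        ((hpc hc₁ a1).sub (hpc hc₂ a1))) ?_
    · intro t ht
      have := (mul_eq_zero.1 (hz t ht)).resolve_left (Real.exp_pos _).ne'
      linarith
    · intro T hT
      have i1 := hw₁.integral_pairing hec hpos hc₁ a1 a2 a3 a4 a5 a6 a7 a8 a9 a10 hT
      have i2 := hw₂.integral_pairing hec hpos hc₂ a1 a2 a3 a4 a5 a6 a7 a8 a9 a10 hT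
      have hqc : ContinuousOn q (Icc τ T) := by
        have : Continuous fun t => Vt t 0 + σ * Vxx t 0 :=
          (a2.comp (continuous_id.prodMk continuous_const)).add
            ((a4.comp (continuous_id.prodMk continuous_const)).const_mul σ)
        exact this.continuousOn.congr fun t ht => (a10 t 0 ht.1).symm
      have hint : ∀ {h : ℝ → ℝ → ℝ}, ContinuousInL2 e (Ici τ) h →
          IntegrableOn (fun t => Real.exp (lam * (t - τ)) * (- (∫ x in Ioo 0 (e t), h t x * V t x) +
            (T - t) * q t * ∫ x in Ioo 0 (e t), h t x * 1)) (Ioo τ T) := by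
        intro h hh
        refine IntegrableOn.mono_set ?_ (Ioo_subset_Icc_self)
        refine ContinuousOn.integrableOn_compact isCompact_Icc ?_
        refine (by fun_prop : Continuous fun t => Real.exp (lam * (t - τ))).continuousOn.mul
          ((((hpc hh a1).mono Icc_subset_Ici_self).neg).add
            (((continuous_const.sub continuous_id).continuousOn.mul hqc).mul
              ((hpc (V := fun _ _ => 1) hh continuous_const).mono Icc_subset_Ici_self)))
      have e1 := integral_sub (hint hc₂) (hint hc₁)
      have e2 : (∫ t in Ioo τ T, (Real.exp (lam * (t - τ)) *
            (- (∫ x in Ioo 0 (e t), h₂ t x * V t x) + (T - t) * q t * ∫ x in Ioo 0 (e t), h₂ t x * 1) -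
          Real.exp (lam * (t - τ)) * (- (∫ x in Ioo 0 (e t), h₁ t x * V t x) +
            (T - t) * q t * ∫ x in Ioo 0 (e t), h₁ t x * 1))) = 0 := by
        rw [e1]
        linarith
      refine Eq.trans ?_ e2
      refine setIntegral_congr_fun measurableSet_Ioo fun t ht => ?_
      have := a11 t ht.1.le
      simp only [mul_assoc (T - t), this]
      ring
  -- For V = 1 one has q = 0, so equality of the masses needs no prior information; it is then the
  -- input for the modes.
  have hmass := key (V := fun _ _ => 1) (Vt := fun _ _ => 0) (Vx := fun _ _ => 0)
    (Vxx := fun _ _ => 0) (q := fun _ => 0) continuous_const continuous_const continuous_const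
    continuous_const (fun t x => hasDerivAt_const _ _) (fun t x => hasDerivAt_const _ _)
    (fun t x => hasDerivAt_const _ _) (fun _ _ => rfl) (fun _ _ => rfl) (by simp) (by simp)
  have hmode : ∀ n : ℕ, ∀ t, τ ≤ t →
      ∫ x in Ioo 0 (e t), h₁ t x * ∫ y in (0 : ℝ)..x, mode E vbar σ ((n + 1) * Real.pi) (t, y) =
      ∫ x in Ioo 0 (e t), h₂ t x * ∫ y in (0 : ℝ)..x, mode E vbar σ ((n + 1) * Real.pi) (t, y) := by
    intro n
    set P := mode E vbar σ ((n + 1) * Real.pi)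
    have hm : ContDiff ℝ ∞ P := contDiff_mode hE hEpos hv.ne' hσ.ne' _
    refine key (V := fun t x => ∫ y in (0 : ℝ)..x, P (t, y))
      (Vt := fun t x => ∫ y in (0 : ℝ)..x, dt P (t, y)) (Vx := fun t x => P (t, x))
      (Vxx := fun t x => dx P (t, x)) (q := fun t => σ * dx P (t, 0))
      (continuous_primitive hm.continuous)
      (continuous_primitive (contDiff_dt hm).continuous) hm.continuous (contDiff_dx hm).continuous
      (hasDerivAt_primitive_fst hm) (hasDerivAt_primitive_snd hm.continuous) (hasDerivAt_dx hm)
      (fun t _ => mode_zero _ _) (fun t ht => ?_) (fun t x ht => ?_) (fun t ht => ?_)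
    · rw [← hEe t (hτ.trans ht)]
      exact mode_right hEpos n t
    -- The equation of the mode makes ∂ₜV the integral of -σ∂ₓₓP, that is, -σ(∂ₓP(t,x) - ∂ₓP(t,0)).
    -- The term at x cancels against σ∂ₓₓV.
    · have e1 : ∀ y, dt P (t, y) = (- σ) * dx (dx P) (t, y) := fun y => by
        linarith [mode_equation hE hEpos hv.ne' hσ.ne' ((n + 1) * Real.pi) (hEd t (hτ.trans ht)) y]
      have hcc : Continuous fun y => dx (dx P) (t, y) :=
        (contDiff_dx (contDiff_dx hm)).continuous.comp (continuous_const.prodMk continuous_id)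
      simp only [e1]
      rw [intervalIntegral.integral_const_mul, intervalIntegral.integral_eq_sub_of_hasDerivAt
        (fun y _ => hasDerivAt_dx (contDiff_dx hm) t y) (hcc.intervalIntegrable _ _)]
      ring
    · exact congrArg _ (hmass t ht)
  have hm1 := hc₁.memLp_slice (t := t) ht (hpos t ht)
  have hm2 := hc₂.memLp_slice (t := t) ht (hpos t ht)
  have hEt : E t = e t := hEe t (hτ.trans ht)
  have hsub : ∀ {w : ℝ → ℝ}, Continuous w → ∫ x in Ioo 0 (e t), h₁ t x * w x =
      ∫ x in Ioo 0 (e t), h₂ t x * w x → ∫ x in Ioo 0 (e t), (h₁ t x - h₂ t x) * w x = 0 := by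
    intro w hw heq
    simp only [sub_mul]
    have i1 : Integrable (fun x => h₁ t x * w x) (leb (e t)) :=
      hm1.integrable_mul (memLp_of_continuous _ hw)
    have i2 : Integrable (fun x => h₂ t x * w x) (leb (e t)) :=
      hm2.integrable_mul (memLp_of_continuous _ hw)
    rw [integral_sub i1 i2, heq, sub_self]
  have hfin := ae_eq_zero_of_integral_mul_primitive_mode hE hEpos hv.ne' hσ.ne' t
    (D := fun x => h₁ t x - h₂ t x) (by
      rw [hEt]
      exact (hm1.sub hm2).integrable (by norm_num)) (by
      rw [hEt]
      simpa using hsub continuous_const (hmass t ht)) (fun n => by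
      rw [hEt]
      refine hsub ?_ (hmode n t ht)
      exact (continuous_primitive (contDiff_mode hE hEpos hv.ne' hσ.ne' _).continuous).comp
        (continuous_const.prodMk continuous_id))
  rw [hEt] at hfin
  filter_upwards [hfin] with x hx
  exact sub_eq_zero.1 hx

end Uniqueness

/-! ### Reynolds' transport theorem for weakly differentiable functions. -/

/-- `E` is a smooth positive function on the line that extends `e` from the half-line `[τ, ∞)`,
where `e` has the constant velocity `vbar`. -/
structure IsSmoothExtension (e E : ℝ → ℝ) (vbar τ : ℝ) : Prop where
  continuous : Continuous e
  contDiff : ContDiff ℝ ∞ E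
  pos : ∀ t, 0 < E t
  eq : ∀ t, τ ≤ t → E t = e t
  hasDerivAt : ∀ t, τ ≤ t → HasDerivAt E vbar t

section Transport

variable {e E : ℝ → ℝ} {vbar τ T : ℝ} {v vt vx : ℝ → ℝ → ℝ} {w : ℝ × ℝ → ℝ}

/-- The density whose integral over a time slice of the moving domain is the time derivative of
`∫ w v dx`. -/
def transportDensity (E : ℝ → ℝ) (vbar : ℝ) (w : ℝ × ℝ → ℝ) (v vt vx : ℝ → ℝ → ℝ) (z : ℝ × ℝ) : ℝ :=
  w z * vt z.1 z.2 + (dt w z + vbar / E z.1 * (w z + z.2 * dx w z)) * v z.1 z.2 +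
    vbar / E z.1 * z.2 * w z * vx z.1 z.2

theorem integrableOn_transportDensity (hE : IsSmoothExtension e E vbar τ)
    (hv : IsRegular e τ T v vt vx) (hw₀ : ContDiff ℝ ∞ w) :
    IntegrableOn (transportDensity E vbar w v vt vx) (movingDomain e (Ioo τ T)) := by
  have hEc : Continuous fun z : ℝ × ℝ => vbar / E z.1 := continuous_const.div
    (hE.contDiff.continuous.comp continuous_fst) fun z => (hE.pos _).ne'
  have h1 := hw₀.continuous
  have h2 := (contDiff_dt hw₀).continuous
  have h3 := (contDiff_dx hw₀).continuous
  exact ((integrableOn_mul_movingDomain hE.continuous h1 hv.memLp_t).add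
    (integrableOn_mul_movingDomain hE.continuous (by fun_prop) hv.memLp)).add
    (integrableOn_mul_movingDomain hE.continuous (by fun_prop) hv.memLp_x)

theorem isCompact_image_rescale (hE : Continuous E) {A B : Set ℝ} (hA : IsCompact A)
    (hB : IsCompact B) : IsCompact ((fun p : ℝ × ℝ => (p.1, p.2 * E p.1)) '' (A ×ˢ B)) :=
  (hA.prod hB).image (by fun_prop)

/-- The weak time derivative is tested with κ(t) ζ(x/E(t)) w, whose support is compact in the open
moving domain. A cut-off that moves with the domain satisfies ∂ₜζ(x/E) = -(v̄/E) x ∂ₓζ(x/E), so an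
integration by parts in x takes the derivative off ζ. Because no derivative of ζ survives, the
cut-off can be removed later without any information on boundary values. -/
theorem integral_cutoff_transportDensity (hE : IsSmoothExtension e E vbar τ)
    (hv : IsRegular e τ T v vt vx) (hw₀ : ContDiff ℝ ∞ w) {κ ζ : ℝ → ℝ} (hκ : ContDiff ℝ ∞ κ)
    (hκc : HasCompactSupport κ) (hκs : tsupport κ ⊆ Ioo τ T) (hζ : ContDiff ℝ ∞ ζ)
    (hζc : HasCompactSupport ζ) (hζs : tsupport ζ ⊆ Ioo 0 1) :
    ∫ z in movingDomain e (Ioo τ T), ζ (z.2 / E z.1) *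
      (deriv κ z.1 * (w z * v z.1 z.2) + κ z.1 * transportDensity E vbar w v vt vx z) = 0 := by
  have he := hE.continuous
  have hEc := hE.contDiff.continuous
  have hE0 : ∀ t, E t ≠ 0 := fun t => (hE.pos t).ne'
  have hwc := hw₀.continuous
  have hwt₁ := (contDiff_dt hw₀).continuous
  have hwx := (contDiff_dx hw₀).continuous
  have hκ' : Continuous (deriv κ) := hκ.continuous_deriv (by simp)
  have hζ' : Continuous (deriv ζ) := hζ.continuous_deriv (by simp)
  have hκcont := hκ.continuous
  have hζcont := hζ.continuous
  have hdivc : Continuous fun z : ℝ × ℝ => z.2 / E z.1 :=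
    continuous_snd.div (hEc.comp continuous_fst) fun z => hE0 _
  have hdivs : ContDiff ℝ ∞ fun z : ℝ × ℝ => z.2 / E z.1 :=
    contDiff_snd.div (hE.contDiff.comp contDiff_fst) fun z => hE0 _
  have hvE : Continuous fun z : ℝ × ℝ => vbar / E z.1 :=
    continuous_const.div (hEc.comp continuous_fst) fun z => hE0 _
  set φ : ℝ × ℝ → ℝ := fun z => κ z.1 * ζ (z.2 / E z.1) * w z with hφ
  have hφs : ContDiff ℝ ∞ φ := ((hκ.comp contDiff_fst).mul (hζ.comp hdivs)).mul hw₀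
  set K := (fun p : ℝ × ℝ => (p.1, p.2 * E p.1)) '' (tsupport κ ×ˢ tsupport ζ) with hK
  have hKc : IsCompact K := isCompact_image_rescale hEc hκc hζc
  have hsupp : Function.support φ ⊆ K := by
    intro z hz
    refine ⟨(z.1, z.2 / E z.1), ⟨subset_tsupport _ fun h => hz ?_, subset_tsupport _ fun h => hz ?_⟩, ?_⟩
    · have h' : κ z.1 = 0 := h
      simp [hφ, h']
    · have h' : ζ (z.2 / E z.1) = 0 := h
      simp [hφ, h']
    · ext
      · rfl
      · exact div_mul_cancel₀ _ (hE0 _)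
  have hφK : tsupport φ ⊆ K := closure_minimal hsupp hKc.isClosed
  have hKQ : K ⊆ movingDomain e (Ioo τ T) := by
    rintro _ ⟨p, ⟨h1, h2⟩, rfl⟩
    have hp1 := hκs h1
    have hp2 := hζs h2
    refine ⟨hp1, mul_pos hp2.1 (hE.pos _), ?_⟩
    change p.2 * E p.1 < e p.1
    rw [← hE.eq p.1 hp1.1.le]
    nlinarith [hp2.2, hE.pos p.1]
  set A : ℝ × ℝ → ℝ := fun z => ζ (z.2 / E z.1) * (deriv κ z.1 * w z + κ z.1 * dt w z) with hA
  set B : ℝ × ℝ → ℝ := fun z => - (κ z.1 * (vbar / E z.1) * (deriv ζ (z.2 / E z.1) * (1 / E z.1) * (z.2 * w z)))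
    with hB
  have hiE : Continuous fun z : ℝ × ℝ => 1 / E z.1 :=
    continuous_const.div (hEc.comp continuous_fst) fun z => hE0 _
  have hAc : Continuous A := by fun_prop
  have hBc : Continuous B := by fun_prop
  have hderiv : ∀ z ∈ movingDomain e (Ioo τ T), deriv (fun s => φ (s, z.2)) z.1 = A z + B z := by
    rintro ⟨t, x⟩ hz
    have ht : τ ≤ t := hz.1.1.le
    have d1 : HasDerivAt κ (deriv κ t) t := (hκ.differentiable (by simp) t).hasDerivAt
    have d2 : HasDerivAt (fun s => x / E s) (- (x * vbar / E t ^ 2)) t := by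
      refine ((hasDerivAt_const t x).div (hE.hasDerivAt t ht) (hE0 t)).congr_deriv ?_
      ring
    have d3 : HasDerivAt (fun s => ζ (x / E s)) (deriv ζ (x / E t) * - (x * vbar / E t ^ 2)) t :=
      ((hζ.differentiable (by simp) (x / E t)).hasDerivAt).comp t d2
    refine (((d1.mul d3).mul (hasDerivAt_dt hw₀ t x)).congr_deriv ?_).deriv
    simp only [hA, hB, Pi.mul_apply]
    field_simp [hE0 t]
    ring
  have hwt := hv.weakDeriv_t φ hφs (HasCompactSupport.of_support_subset_isCompact hKc hsupp)
    (hφK.trans hKQ)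
  have hmeas := measurableSet_movingDomain he (measurableSet_Ioo (a := τ) (b := T))
  rw [setIntegral_congr_fun hmeas (g := fun z => A z * v z.1 z.2 + B z * v z.1 z.2)
    (fun z hz => by simp only [hderiv z hz]; ring)] at hwt
  have iA := integrableOn_mul_movingDomain he hAc hv.memLp
  have iB := integrableOn_mul_movingDomain he hBc hv.memLp
  have iφ := integrableOn_mul_movingDomain he hφs.continuous hv.memLp_t
  set C1 : ℝ × ℝ → ℝ := fun z => κ z.1 * (vbar / E z.1) * (ζ (z.2 / E z.1) * (w z + z.2 * dx w z)) with hC1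
  set C2 : ℝ × ℝ → ℝ := fun z => κ z.1 * (vbar / E z.1) * (ζ (z.2 / E z.1) * (z.2 * w z)) with hC2
  have iC1 := integrableOn_mul_movingDomain he (show Continuous C1 by fun_prop) hv.memLp
  have iC2 := integrableOn_mul_movingDomain he (show Continuous C2 by fun_prop) hv.memLp_x
  have iC : IntegrableOn (fun z : ℝ × ℝ => C1 z * v z.1 z.2 + C2 z * vx z.1 z.2)
      (movingDomain e (Ioo τ T)) := iC1.add iC2
  have iAC : IntegrableOn (fun z : ℝ × ℝ => A z * v z.1 z.2 + (C1 z * v z.1 z.2 + C2 z * vx z.1 z.2))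
      (movingDomain e (Ioo τ T)) := iA.add iC
  -- B carries the derivative of ζ. On almost every slice the weak space derivative is tested with η
  -- = ζ(x/E) x w, which replaces B by the coefficients C1 and C2, free of derivatives of ζ.
  have hBC : ∫ z in movingDomain e (Ioo τ T), B z * v z.1 z.2 =
      ∫ z in movingDomain e (Ioo τ T), (C1 z * v z.1 z.2 + C2 z * vx z.1 z.2) := by
    rw [setIntegral_movingDomain he measurableSet_Ioo iB,
      setIntegral_movingDomain he measurableSet_Ioo iC]
    refine integral_congr_ae ?_
    filter_upwards [hv.weakDeriv_x, memLp_slice he measurableSet_Ioo hv.memLp,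
      memLp_slice he measurableSet_Ioo hv.memLp_x, ae_restrict_mem measurableSet_Ioo] with t ht hvL hvxL htI
    have htτ : τ ≤ t := htI.1.le
    set η : ℝ → ℝ := fun x => ζ (x / E t) * (x * w (t, x)) with hη
    have hws : ContDiff ℝ ∞ fun x => w (t, x) := contDiff_slice hw₀ t
    have hηs : ContDiff ℝ ∞ η := (hζ.comp (contDiff_id.div_const _)).mul (contDiff_id.mul hws)
    have hKη : IsCompact ((fun y => y * E t) '' tsupport ζ) :=
      hζc.isCompact.image (by fun_prop)
    have hsη : Function.support η ⊆ (fun y => y * E t) '' tsupport ζ := by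
      intro x hx
      refine ⟨x / E t, subset_tsupport _ fun h => hx ?_, div_mul_cancel₀ _ (hE0 _)⟩
      have h' : ζ (x / E t) = 0 := h
      simp [hη, h']
    have hKη' : (fun y => y * E t) '' tsupport ζ ⊆ Ioo 0 (e t) := by
      rintro _ ⟨y, hy, rfl⟩
      have := hζs hy
      rw [← hE.eq t htτ]
      exact ⟨mul_pos this.1 (hE.pos t), by nlinarith [this.2, hE.pos t]⟩
    have hw := ht η hηs (HasCompactSupport.of_support_subset_isCompact hKη hsη)
      ((closure_minimal hsη hKη.isClosed).trans hKη')
    have hdη : ∀ x, deriv η x = deriv ζ (x / E t) * (1 / E t) * (x * w (t, x)) +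
        ζ (x / E t) * (w (t, x) + x * dx w (t, x)) := by
      intro x
      have d2 : HasDerivAt (fun x => ζ (x / E t)) (deriv ζ (x / E t) * (1 / E t)) x :=
        ((hζ.differentiable (by simp) (x / E t)).hasDerivAt).comp x ((hasDerivAt_id x).div_const _)
      refine ((d2.mul ((hasDerivAt_id x).mul (hasDerivAt_dx hw₀ t x))).congr_deriv ?_).deriv
      simp
    simp only [hdη] at hw
    have sl : ∀ {q : ℝ × ℝ → ℝ}, Continuous q → Continuous fun x => q (t, x) := fun hq =>
      hq.comp (continuous_const.prodMk continuous_id)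
    have j1 : Integrable (fun x => v t x * (deriv ζ (x / E t) * (1 / E t) * (x * w (t, x)))) (leb (e t)) :=
      hvL.integrable_mul (memLp_of_continuous _ (sl (q := fun z => deriv ζ (z.2 / E z.1) * (1 / E z.1) *
        (z.2 * w z)) (by fun_prop)))
    have j2 : Integrable (fun x => v t x * (ζ (x / E t) * (w (t, x) + x * dx w (t, x)))) (leb (e t)) :=
      hvL.integrable_mul (memLp_of_continuous _ (sl (q := fun z => ζ (z.2 / E z.1) *
        (w z + z.2 * dx w z)) (by fun_prop)))
    have j3 : Integrable (fun x => vx t x * η x) (leb (e t)) :=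
      hvxL.integrable_mul (memLp_of_continuous _ hηs.continuous)
    have e1 : ∫ x in Ioo 0 (e t), B (t, x) * v t x = - (κ t * (vbar / E t)) *
        ∫ x in Ioo 0 (e t), v t x * (deriv ζ (x / E t) * (1 / E t) * (x * w (t, x))) := by
      rw [← integral_const_mul]
      congr 1
      ext x
      simp only [hB]
      ring
    have e2 : ∫ x in Ioo 0 (e t), (C1 (t, x) * v t x + C2 (t, x) * vx t x) = (κ t * (vbar / E t)) *
        ((∫ x in Ioo 0 (e t), v t x * (ζ (x / E t) * (w (t, x) + x * dx w (t, x)))) +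
          ∫ x in Ioo 0 (e t), vx t x * η x) := by
      rw [← integral_add j2 j3, ← integral_const_mul]
      congr 1
      ext x
      simp only [hC1, hC2, hη]
      ring
    simp only [mul_add] at hw
    simp only [mul_add] at j2
    have e3 : ∀ x, v t x * (deriv ζ (x / E t) * (1 / E t) * (x * w (t, x))) +
        (v t x * (ζ (x / E t) * w (t, x)) + v t x * (ζ (x / E t) * (x * dx w (t, x)))) =
        v t x * (deriv ζ (x / E t) * (1 / E t) * (x * w (t, x))) +
        v t x * (ζ (x / E t) * (w (t, x) + x * dx w (t, x))) := fun x => by ring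
    simp only [e3] at hw
    simp only [← mul_add] at j2
    rw [integral_add j1 j2] at hw
    change ∫ x in Ioo 0 (e t), B (t, x) * v t x =
      ∫ x in Ioo 0 (e t), (C1 (t, x) * v t x + C2 (t, x) * vx t x)
    rw [e1, e2]
    linear_combination (- (κ t * (vbar / E t))) * hw
  rw [integral_add iA iB, hBC] at hwt
  have e4 : ∫ z in movingDomain e (Ioo τ T), vt z.1 z.2 * φ z =
      ∫ z in movingDomain e (Ioo τ T), φ z * vt z.1 z.2 := by simp only [mul_comm]
  rw [e4] at hwt
  have e5 : ∀ z : ℝ × ℝ, ζ (z.2 / E z.1) *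
      (deriv κ z.1 * (w z * v z.1 z.2) + κ z.1 * transportDensity E vbar w v vt vx z) =
      A z * v z.1 z.2 + (C1 z * v z.1 z.2 + C2 z * vx z.1 z.2) + φ z * vt z.1 z.2 := by
    intro z
    simp only [hA, hC1, hC2, hφ, transportDensity]
    ring
  simp only [e5]
  rw [integral_add iAC iφ, integral_add iA iC, hwt]
  ring

/-- The cut-offs increase to 1 inside the domain, and the integrand without cut-off is an integrable
majorant. -/
theorem integral_weight_transportDensity (hE : IsSmoothExtension e E vbar τ)
    (hv : IsRegular e τ T v vt vx) (hw₀ : ContDiff ℝ ∞ w) {κ : ℝ → ℝ} (hκ : ContDiff ℝ ∞ κ)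
    (hκc : HasCompactSupport κ) (hκs : tsupport κ ⊆ Ioo τ T) :
    ∫ z in movingDomain e (Ioo τ T), (deriv κ z.1 * (w z * v z.1 z.2) +
      κ z.1 * transportDensity E vbar w v vt vx z) = 0 := by
  have he := hE.continuous
  obtain ⟨ζ, z1, z2, z3, z4, z5⟩ := exists_cutoff
  have hκ' : Continuous (deriv κ) := hκ.continuous_deriv (by simp)
  set F : ℝ × ℝ → ℝ := fun z => deriv κ z.1 * (w z * v z.1 z.2) +
      κ z.1 * transportDensity E vbar w v vt vx z with hF
  have hFi : IntegrableOn F (movingDomain e (Ioo τ T)) := by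
    refine Integrable.add ?_ ?_
    · have hc : Continuous fun z : ℝ × ℝ => deriv κ z.1 * w z :=
        (hκ'.comp continuous_fst).mul hw₀.continuous
      refine (integrableOn_mul_movingDomain he hc hv.memLp).congr (Eventually.of_forall fun z => ?_)
      simp only [mul_assoc]
    · obtain ⟨C, hC⟩ := exists_ae_bound_movingDomain (τ := τ) (T := T) he
        (hκ.continuous.comp (continuous_fst (X := ℝ) (Y := ℝ)))
      exact (integrableOn_transportDensity hE hv hw₀).bdd_mul
        (hκ.continuous.comp (continuous_fst (X := ℝ) (Y := ℝ))).aestronglyMeasurable hC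
  have hdivc : Continuous fun z : ℝ × ℝ => z.2 / E z.1 :=
    continuous_snd.div (hE.contDiff.continuous.comp continuous_fst) fun z => (hE.pos _).ne'
  have hlim : Tendsto (fun k => ∫ z in movingDomain e (Ioo τ T), ζ k (z.2 / E z.1) * F z) atTop
      (𝓝 (∫ z in movingDomain e (Ioo τ T), F z)) := by
    refine tendsto_integral_of_dominated_convergence (fun z => ‖F z‖) (fun k => ?_) hFi.norm
      (fun k => Eventually.of_forall fun z => ?_) ?_
    · exact ((z1 k).continuous.comp hdivc).aestronglyMeasurable.mul hFi.1
    · rw [norm_mul, Real.norm_eq_abs, abs_of_nonneg (z4 k _).1]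
      exact mul_le_of_le_one_left (norm_nonneg _) (z4 k _).2
    · filter_upwards [ae_restrict_mem (measurableSet_movingDomain he measurableSet_Ioo)] with z hz
      have hEz := hE.eq z.1 hz.1.1.le
      have := (z5 (z.2 / E z.1) ⟨div_pos hz.2.1 (hE.pos _), by
        rw [div_lt_one (hE.pos _), hEz]
        exact hz.2.2⟩).mul_const (F z)
      rwa [one_mul] at this
  refine tendsto_nhds_unique hlim ?_
  simp only [hF, integral_cutoff_transportDensity hE hv hw₀ hκ hκc hκs (z1 _) (z2 _) (z3 _)]
  exact tendsto_const_nhds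

/-- Reynolds' transport theorem for a weakly differentiable function on the moving domain. -/
theorem integral_transportDensity (hE : IsSmoothExtension e E vbar τ)
    (hv : IsRegular e τ T v vt vx) (hw₀ : ContDiff ℝ ∞ w) (hT : τ < T) :
    ∫ z in movingDomain e (Ioo τ T), transportDensity E vbar w v vt vx z =
      (∫ x in Ioo 0 (e T), w (T, x) * v T x) - ∫ x in Ioo 0 (e τ), w (τ, x) * v τ x := by
  have he := hE.continuous
  have hpos : ∀ t ∈ Icc τ T, 0 < e t := fun t ht => hE.eq t ht.1 ▸ hE.pos t
  set m : ℝ → ℝ := fun t => ∫ x in Ioo 0 (e t), w (t, x) * v t x with hm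
  set n : ℝ → ℝ := fun t => ∫ x in Ioo 0 (e t), transportDensity E vbar w v vt vx (t, x) with hn
  have hNi := integrableOn_transportDensity hE hv hw₀
  have hni : IntegrableOn n (Ioo τ T) := integrableOn_integral_movingDomain he measurableSet_Ioo hNi
  have hmc : ContinuousOn m (Icc τ T) :=
    (continuousInL2_of_continuous (f := fun t x => w (t, x)) he hw₀.continuous
      ).continuousOn_integral_mul he hpos hv.continuous
  have hmi : IntegrableOn m (Ioo τ T) :=
    (hmc.integrableOn_compact isCompact_Icc).mono_set Ioo_subset_Icc_self
  obtain ⟨c, hc⟩ := exists_ae_eq_primitive hT hmi hni (fun κ k1 k2 k3 => by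
    have h := integral_weight_transportDensity hE hv hw₀ k1 k2 k3
    have hκ' : Continuous (deriv κ) := k1.continuous_deriv (by simp)
    have i1 : IntegrableOn (fun z : ℝ × ℝ => deriv κ z.1 * (w z * v z.1 z.2))
        (movingDomain e (Ioo τ T)) := by
      have hc : Continuous fun z : ℝ × ℝ => deriv κ z.1 * w z :=
        (hκ'.comp continuous_fst).mul hw₀.continuous
      refine (integrableOn_mul_movingDomain he hc hv.memLp).congr (Eventually.of_forall fun z => ?_)
      simp only [mul_assoc]
    have i2 : IntegrableOn (fun z : ℝ × ℝ => κ z.1 * transportDensity E vbar w v vt vx z)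
        (movingDomain e (Ioo τ T)) := by
      obtain ⟨C, hC⟩ := exists_ae_bound_movingDomain (τ := τ) (T := T) he
        (k1.continuous.comp (continuous_fst (X := ℝ) (Y := ℝ)))
      exact hNi.bdd_mul (k1.continuous.comp (continuous_fst (X := ℝ) (Y := ℝ))).aestronglyMeasurable hC
    rw [integral_add i1 i2, setIntegral_movingDomain he measurableSet_Ioo i1,
      setIntegral_movingDomain he measurableSet_Ioo i2] at h
    simp only [integral_const_mul] at h
    simp only [mul_comm (m _), mul_comm (n _)]
    exact eq_neg_of_add_eq_zero_left h)
  have hni' : IntervalIntegrable n volume τ T := by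
    rwa [intervalIntegrable_iff_integrableOn_Ioo_of_le hT.le]
  have hcont : ContinuousOn (fun t => c + ∫ s in τ..t, n s) (Icc τ T) := by
    have := (hni'.absolutelyContinuousOnInterval_intervalIntegral (c := τ) (by simp)).continuousOn
    rw [uIcc_of_le hT.le] at this
    exact continuousOn_const.add this
  -- The compactly supported weights κ show only that n is the weak derivative of m on the open
  -- interval. Continuity in time extends the almost everywhere identity to both endpoints.
  have heq : EqOn m (fun t => c + ∫ s in τ..t, n s) (Icc τ T) := by
    refine Measure.eqOn_Icc_of_ae_eq volume hT.ne ?_ hmc hcont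
    rwa [← restrict_Ioo_eq_restrict_Icc]
  have h1 := heq (left_mem_Icc.2 hT.le)
  have h2 := heq (right_mem_Icc.2 hT.le)
  simp only [intervalIntegral.integral_same, add_zero] at h1
  rw [setIntegral_movingDomain he measurableSet_Ioo hNi]
  change ∫ t in Ioo τ T, n t = m T - m τ
  simp only [h1, h2]
  rw [intervalIntegral.integral_of_le hT.le, integral_Ioc_eq_integral_Ioo]
  ring

end Transport

/-! ### Potentials: boundary conditions, weak identity and energy inequality. -/

/-- A smooth function that vanishes at `x = 0` and is constant in time at `x = e t`. Its space
derivative is the density of a conserved quantity. -/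
structure IsPotential (e : ℝ → ℝ) (τ : ℝ) (G : ℝ × ℝ → ℝ) : Prop where
  contDiff : ContDiff ℝ ∞ G
  left : ∀ t, τ ≤ t → G (t, 0) = 0
  right : ∃ M, ∀ t, τ ≤ t → G (t, e t) = M

/-- The residual of the heat equation. -/
def residual (σ : ℝ) (G : ℝ × ℝ → ℝ) (z : ℝ × ℝ) : ℝ := dt G z - σ * dx (dx G) z

theorem continuous_residual {σ : ℝ} {G : ℝ × ℝ → ℝ} (hG : ContDiff ℝ ∞ G) :
    Continuous (residual σ G) :=
  (contDiff_dt hG).continuous.sub ((contDiff_dx (contDiff_dx hG)).continuous.const_mul σ)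

theorem IsPotential.add {e : ℝ → ℝ} {τ : ℝ} {G H : ℝ × ℝ → ℝ} (hG : IsPotential e τ G)
    (hH : IsPotential e τ H) : IsPotential e τ (G + H) := by
  obtain ⟨M, hM⟩ := hG.right
  obtain ⟨N, hN⟩ := hH.right
  exact ⟨hG.contDiff.add hH.contDiff, fun t ht => by simp [hG.left t ht, hH.left t ht],
    M + N, fun t ht => by simp [hM t ht, hN t ht]⟩

theorem IsPotential.smul {e : ℝ → ℝ} {τ : ℝ} {G : ℝ × ℝ → ℝ} (hG : IsPotential e τ G) (c : ℝ) :
    IsPotential e τ (c • G) := by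
  obtain ⟨M, hM⟩ := hG.right
  exact ⟨contDiff_const.smul hG.contDiff, fun t ht => by simp [hG.left t ht],
    c * M, fun t ht => by simp [hM t ht]⟩

theorem residual_add {σ : ℝ} {G H : ℝ × ℝ → ℝ} (hG : ContDiff ℝ ∞ G) (hH : ContDiff ℝ ∞ H) :
    residual σ (G + H) = residual σ G + residual σ H := by
  ext z
  simp only [residual, dt_add hG hH, dx_add hG hH, dx_add (contDiff_dx hG) (contDiff_dx hH),
    Pi.add_apply]
  ring

theorem residual_smul {σ : ℝ} {G : ℝ × ℝ → ℝ} (hG : ContDiff ℝ ∞ G) (c : ℝ) :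
    residual σ (c • G) = c • residual σ G := by
  ext z
  simp only [residual, dt_smul hG, dx_smul hG, dx_smul (contDiff_dx hG), Pi.smul_apply, smul_eq_mul]
  ring

section Identities

variable {e E : ℝ → ℝ} {vbar τ T σ lam : ℝ} {v vt vx : ℝ → ℝ → ℝ} {G : ℝ × ℝ → ℝ}

theorem IsPotential.dt_left (hG : IsPotential e τ G) {t : ℝ} (ht : τ < t) : dt G (t, 0) = 0 := by
  refine (hasDerivAt_dt hG.contDiff t 0).unique ((hasDerivAt_const t (0 : ℝ)).congr_of_eventuallyEq ?_)
  filter_upwards [lt_mem_nhds ht] with s hs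
  exact hG.left s hs.le

/-- The potential is constant along the moving end, whose velocity is (1, v̄). For a solution of the
heat equation this is the Robin condition satisfied by its space derivative. -/
theorem IsPotential.dt_right (hE : IsSmoothExtension e E vbar τ) (hG : IsPotential e τ G) {t : ℝ}
    (ht : τ < t) : dt G (t, e t) + vbar * dx G (t, e t) = 0 := by
  obtain ⟨M, hM⟩ := hG.right
  have h1 : HasDerivAt (fun s => G (s, E s)) (fderiv ℝ G (t, E t) (1, vbar)) t :=
    ((hG.contDiff.differentiable (by simp) (t, E t)).hasFDerivAt).comp_hasDerivAt t
      ((hasDerivAt_id t).prodMk (hE.hasDerivAt t ht.le))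
  have h2 : HasDerivAt (fun s => G (s, E s)) 0 t := by
    refine (hasDerivAt_const t M).congr_of_eventuallyEq ?_
    filter_upwards [lt_mem_nhds ht] with s hs
    rw [hE.eq s hs.le, hM s hs.le]
  have h3 := h1.unique h2
  have h4 : ((1, vbar) : ℝ × ℝ) = (1, 0) + vbar • (0, 1) := by simp
  rw [h4, map_add, map_smul, hE.eq t ht.le] at h3
  exact h3

/-- The weak form of the equation that the space derivative of a potential satisfies. -/
theorem IsPotential.integral_identity (hE : IsSmoothExtension e E vbar τ) (hG : IsPotential e τ G)
    (hv : IsRegular e τ T v vt vx) (hT : τ < T) (lam : ℝ) :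
    ∫ z in movingDomain e (Ioo τ T), Real.exp (-lam * (z.1 - τ)) *
      (dx G z * (vt z.1 z.2 - lam * v z.1 z.2) - dt G z * vx z.1 z.2) =
    Real.exp (-lam * (T - τ)) * (∫ x in Ioo 0 (e T), dx G (T, x) * v T x) -
      ∫ x in Ioo 0 (e τ), dx G (τ, x) * v τ x := by
  have he := hE.continuous
  have hGs := hG.contDiff
  have hGx := contDiff_dx hGs
  have hGt := contDiff_dt hGs
  have hexp : ContDiff ℝ ∞ fun z : ℝ × ℝ => Real.exp (-lam * (z.1 - τ)) := by fun_prop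
  set w : ℝ × ℝ → ℝ := fun z => Real.exp (-lam * (z.1 - τ)) * dx G z with hw
  have hws : ContDiff ℝ ∞ w := hexp.mul hGx
  have hdxw : ∀ t x, dx w (t, x) = Real.exp (-lam * (t - τ)) * dx (dx G) (t, x) := fun t x =>
    (hasDerivAt_dx hws t x).unique ((hasDerivAt_dx hGx t x).const_mul (Real.exp (-lam * (t - τ))))
  have hdtw : ∀ t x, dt w (t, x) = Real.exp (-lam * (t - τ)) * (dx (dt G) (t, x) - lam * dx G (t, x)) := by
    intro t x
    have h1 : HasDerivAt (fun t => Real.exp (-lam * (t - τ))) (Real.exp (-lam * (t - τ)) * (-lam)) t := by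
      have := (((hasDerivAt_id t).sub_const τ).const_mul (-lam)).exp
      exact this.congr_deriv (by simp)
    rw [(hasDerivAt_dt hws t x).unique (h1.mul (hasDerivAt_dt hGx t x)), dt_dx_comm hGs]
    ring
  have key := integral_transportDensity hE hv hws hT
  have e1 : ∫ x in Ioo 0 (e T), w (T, x) * v T x =
      Real.exp (-lam * (T - τ)) * ∫ x in Ioo 0 (e T), dx G (T, x) * v T x := by
    rw [← integral_const_mul]
    simp only [hw, mul_assoc]
  have e2 : ∫ x in Ioo 0 (e τ), w (τ, x) * v τ x = ∫ x in Ioo 0 (e τ), dx G (τ, x) * v τ x := by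
    simp [hw]
  rw [e1, e2] at key
  rw [← key]
  have hexpc := hexp.continuous
  have c1 := hGx.continuous
  have c2 := hGt.continuous
  have iL : IntegrableOn (fun z : ℝ × ℝ => Real.exp (-lam * (z.1 - τ)) *
      (dx G z * (vt z.1 z.2 - lam * v z.1 z.2) - dt G z * vx z.1 z.2)) (movingDomain e (Ioo τ T)) := by
    have i1 := integrableOn_mul_movingDomain he (f := fun z => Real.exp (-lam * (z.1 - τ)) * dx G z)
      (by fun_prop) hv.memLp_t
    have i2 := integrableOn_mul_movingDomain he
      (f := fun z => Real.exp (-lam * (z.1 - τ)) * dx G z * lam) (by fun_prop) hv.memLp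
    have i3 := integrableOn_mul_movingDomain he (f := fun z => Real.exp (-lam * (z.1 - τ)) * dt G z)
      (by fun_prop) hv.memLp_x
    refine ((i1.sub i2).sub i3).congr (Eventually.of_forall fun z => ?_)
    simp only [Pi.sub_apply]
    ring
  rw [setIntegral_movingDomain he measurableSet_Ioo iL,
    setIntegral_movingDomain he measurableSet_Ioo (integrableOn_transportDensity hE hv hws)]
  refine integral_congr_ae ?_
  filter_upwards [hv.weakDeriv_x, memLp_slice he measurableSet_Ioo hv.memLp,
    memLp_slice he measurableSet_Ioo hv.memLp_x, memLp_slice he measurableSet_Ioo hv.memLp_t,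
    ae_restrict_mem measurableSet_Ioo] with t ht hvL hvxL hvtL htI
  have hEt := hE.eq t htI.1.le
  have hpos : 0 < e t := hEt ▸ hE.pos t
  have hne : E t ≠ 0 := (hE.pos t).ne'
  -- Up to the exponential factor, the transport density exceeds the integrand on the left by
  -- ∂ₓ(Φv), in the weak sense. The boundary conditions of the potential say precisely that Φ
  -- vanishes at both ends, so nothing is needed about the traces of v.
  set Φ : ℝ → ℝ := fun x => dt G (t, x) + vbar / E t * (x * dx G (t, x)) with hΦ
  have hΦd : ∀ x, HasDerivAt Φ (dx (dt G) (t, x) + vbar / E t * (dx G (t, x) + x * dx (dx G) (t, x))) x := by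
    intro x
    refine ((hasDerivAt_dx hGt t x).add
      (((hasDerivAt_id x).mul (hasDerivAt_dx hGx t x)).const_mul _)).congr_deriv ?_
    simp
  have hΦs : ContDiff ℝ 1 Φ := ((contDiff_slice hGt t).add (contDiff_const.mul
    (contDiff_id.mul (contDiff_slice hGx t)))).of_le (by simp)
  have hΦ0 : Φ 0 = 0 := by simp [hΦ, hG.dt_left htI.1]
  have hΦ1 : Φ (e t) = 0 := by
    have := hG.dt_right hE htI.1
    simp only [hΦ, hEt]
    field_simp
    linarith
  have hibp := ht.integral_mul hpos hvL hvxL hΦs hΦ0 hΦ1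
  have hder : deriv Φ = fun x => dx (dt G) (t, x) + vbar / E t * (dx G (t, x) + x * dx (dx G) (t, x)) :=
    funext fun x => (hΦd x).deriv
  have j1 : Integrable (fun x => Φ x * vx t x) (leb (e t)) :=
    (memLp_of_continuous _ hΦs.continuous).integrable_mul hvxL
  have j2 : Integrable (fun x => deriv Φ x * v t x) (leb (e t)) :=
    (memLp_of_continuous _ (hΦs.continuous_deriv le_rfl)).integrable_mul hvL
  have sl : ∀ {q : ℝ × ℝ → ℝ}, Continuous q → Continuous fun x => q (t, x) := fun hq =>
    hq.comp (continuous_const.prodMk continuous_id)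
  have j3 : Integrable (fun x => dx G (t, x) * (vt t x - lam * v t x) - dt G (t, x) * vx t x) (leb (e t)) :=
    ((memLp_of_continuous _ (sl c1)).integrable_mul (hvtL.sub (hvL.const_mul lam))).sub
      ((memLp_of_continuous _ (sl c2)).integrable_mul hvxL)
  have e3 : ∀ x, transportDensity E vbar w v vt vx (t, x) = Real.exp (-lam * (t - τ)) *
      ((dx G (t, x) * (vt t x - lam * v t x) - dt G (t, x) * vx t x) +
        (deriv Φ x * v t x + Φ x * vx t x)) := by
    intro x
    rw [hder]
    simp only [transportDensity, hdxw, hdtw]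
    simp only [hΦ, hw]
    ring
  have j4 : Integrable (fun x => deriv Φ x * v t x + Φ x * vx t x) (leb (e t)) := j2.add j1
  simp only [e3]
  rw [integral_const_mul, integral_const_mul, integral_add j3 j4, integral_add j2 j1, hibp]
  ring

/-- The integrand is the space derivative of (v̄/E) x G². Applied to ∂ₓG, this shows that the
transport term in the energy balance is a nonnegative boundary term. -/
theorem integral_sq_boundary (hE : IsSmoothExtension e E vbar τ) (hG : ContDiff ℝ ∞ G) {t : ℝ}
    (ht : τ ≤ t) :
    ∫ x in Ioo 0 (e t), vbar / E t * (G (t, x) ^ 2 + 2 * x * (G (t, x) * dx G (t, x))) =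
      vbar * G (t, e t) ^ 2 := by
  have hEt := hE.eq t ht
  have hpos : 0 < e t := hEt ▸ hE.pos t
  have hd : ∀ x, HasDerivAt (fun x => vbar / E t * (x * G (t, x) ^ 2))
      (vbar / E t * (G (t, x) ^ 2 + 2 * x * (G (t, x) * dx G (t, x)))) x := by
    intro x
    refine (((hasDerivAt_id x).mul ((hasDerivAt_dx hG t x).pow 2)).const_mul _).congr_deriv ?_
    simp
    left
    ring
  have hc : Continuous fun x => vbar / E t * (G (t, x) ^ 2 + 2 * x * (G (t, x) * dx G (t, x))) := by
    have h1 : Continuous fun x => G (t, x) := (contDiff_slice hG t).continuous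
    have h2 : Continuous fun x => dx G (t, x) := (contDiff_slice (contDiff_dx hG) t).continuous
    fun_prop
  rw [← integral_Ioc_eq_integral_Ioo, ← intervalIntegral.integral_of_le hpos.le,
    intervalIntegral.integral_eq_sub_of_hasDerivAt (fun x _ => hd x) (hc.intervalIntegrable _ _), hEt]
  field_simp
  ring

/-- The energy inequality. -/
theorem IsPotential.energy_le (hE : IsSmoothExtension e E vbar τ) (hG : IsPotential e τ G)
    (hvb : 0 < vbar) (hσ : 0 < σ) (hT : τ < T) :
    (∫ x in Ioo 0 (e T), dx G (T, x) ^ 2) +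
      σ * ∫ z in movingDomain e (Ioo τ T), dx (dx G) z ^ 2 ≤
    (∫ x in Ioo 0 (e τ), dx G (τ, x) ^ 2) +
      σ⁻¹ * ∫ z in movingDomain e (Ioo τ T), residual σ G z ^ 2 := by
  have he := hE.continuous
  have hGs := hG.contDiff
  have hGx := contDiff_dx hGs
  have hGxx := contDiff_dx hGx
  have hGt := contDiff_dt hGs
  have hGxt := contDiff_dt hGx
  have hreg : IsRegular e τ T (fun t x => dx G (t, x)) (fun t x => dt (dx G) (t, x))
      (fun t x => dx (dx G) (t, x)) :=
    isRegular_of_hasDerivAt he hGx.continuous hGxt.continuous hGxx.continuous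
      (hasDerivAt_dt hGx) (hasDerivAt_dx hGx)
  have hint : ∀ {f : ℝ × ℝ → ℝ}, Continuous f → IntegrableOn f (movingDomain e (Ioo τ T)) :=
    fun {f} hf => by
      have := isFiniteMeasure_movingDomain he τ T
      exact (memLp_movingDomain_of_continuous he hf).integrable (by norm_num)
  have c0 := hGs.continuous
  have c1 := hGx.continuous
  have c2 := hGxx.continuous
  have c3 := hGt.continuous
  have c4 := hGxt.continuous
  have c5 := continuous_residual (σ := σ) hGs
  have cE : Continuous fun z : ℝ × ℝ => vbar / E z.1 :=
    continuous_const.div (hE.contDiff.continuous.comp continuous_fst) fun z => (hE.pos _).ne'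
  -- The weak identity is tested with ∂ₓG itself and compared with the transport theorem for the
  -- square of ∂ₓG. Twice the first minus the second eliminates the integral of ∂ₓG ∂ₜ∂ₓG.
  have k1 := hG.integral_identity hE hreg hT 0
  have k2 := integral_transportDensity hE hreg hGx hT
  simp only [neg_zero, zero_mul, Real.exp_zero, one_mul, sub_zero] at k1
  set Q := movingDomain e (Ioo τ T) with hQ
  have s1 : ∫ z in Q, (dx G z * dt (dx G) z - dt G z * dx (dx G) z) =
      (∫ z in Q, dx G z * dt (dx G) z) - ∫ z in Q, dt G z * dx (dx G) z :=
    integral_sub (hint (by fun_prop)) (hint (by fun_prop))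
  have s2 : ∫ z in Q, transportDensity E vbar (dx G) (fun t x => dx G (t, x))
      (fun t x => dt (dx G) (t, x)) (fun t x => dx (dx G) (t, x)) z =
      2 * (∫ z in Q, dx G z * dt (dx G) z) +
        ∫ z in Q, vbar / E z.1 * (dx G z ^ 2 + 2 * z.2 * (dx G z * dx (dx G) z)) := by
    rw [← integral_const_mul, ← integral_add (hint (by fun_prop)) (hint (by fun_prop))]
    refine integral_congr_ae (Eventually.of_forall fun z => ?_)
    simp only [transportDensity]
    ring
  have s3 : 0 ≤ ∫ z in Q, vbar / E z.1 * (dx G z ^ 2 + 2 * z.2 * (dx G z * dx (dx G) z)) := by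
    rw [hQ, setIntegral_movingDomain he measurableSet_Ioo (hint (by fun_prop))]
    refine setIntegral_nonneg measurableSet_Ioo fun t ht => ?_
    rw [integral_sq_boundary hE hGx ht.1.le]
    positivity
  have s4 : ∫ z in Q, dt G z * dx (dx G) z =
      (∫ z in Q, residual σ G z * dx (dx G) z) + σ * ∫ z in Q, dx (dx G) z ^ 2 := by
    rw [← integral_const_mul, ← integral_add (hint (by fun_prop)) (hint (by fun_prop))]
    refine integral_congr_ae (Eventually.of_forall fun z => ?_)
    simp only [residual]
    ring
  -- Young's inequality with weights chosen so as to use up only half of the dissipation 2σ∫(∂ₓₓG)².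
  have s5 : - 2 * (∫ z in Q, residual σ G z * dx (dx G) z) ≤
      σ * (∫ z in Q, dx (dx G) z ^ 2) + σ⁻¹ * ∫ z in Q, residual σ G z ^ 2 := by
    rw [← integral_const_mul, ← integral_const_mul, ← integral_const_mul,
      ← integral_add (hint (by fun_prop)) (hint (by fun_prop))]
    refine integral_mono (hint (by fun_prop)) (hint (by fun_prop)) fun z => ?_
    have h1 : 0 ≤ σ⁻¹ * (σ * dx (dx G) z + residual σ G z) ^ 2 := by positivity
    have h2 : σ⁻¹ * (σ * dx (dx G) z + residual σ G z) ^ 2 = σ * dx (dx G) z ^ 2 +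
        2 * (residual σ G z * dx (dx G) z) + σ⁻¹ * residual σ G z ^ 2 := by
      field_simp
      ring
    simp only
    linarith
  rw [s1] at k1
  rw [s2] at k2
  simp only [← sq] at k1 k2
  linarith

end Identities

/-! ### Two families of potentials: modulated modes and diffusive profiles. -/

theorem ae_eq_zero_of_ae_slice {e : ℝ → ℝ} (he : Continuous e) {I : Set ℝ} (hI : MeasurableSet I)
    {f : ℝ × ℝ → ℝ} (hf : AEStronglyMeasurable f (volume.restrict (movingDomain e I)))
    (h : ∀ᵐ t ∂(volume.restrict I), (fun x => f (t, x)) =ᵐ[leb (e t)] 0) :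
    f =ᵐ[volume.restrict (movingDomain e I)] 0 := by
  have h0 : ∫⁻ z in movingDomain e I, ‖f z‖ₑ = 0 := by
    rw [setLIntegral_movingDomain he hI hf.enorm]
    refine lintegral_eq_zero_of_ae_eq_zero ?_
    filter_upwards [h] with t ht
    refine lintegral_eq_zero_of_ae_eq_zero ?_
    filter_upwards [ht] with x hx
    simp [hx]
  filter_upwards [(lintegral_eq_zero_iff' hf.enorm).1 h0] with z hz
  simpa using hz

theorem memLp_movingDomain_Ioi_of_eq_zero {e : ℝ → ℝ} (he : Continuous e) {τ T : ℝ}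
    {f : ℝ × ℝ → ℝ} (hf : Continuous f) (h0 : ∀ z : ℝ × ℝ, T ≤ z.1 → f z = 0) :
    MemLp f 2 (volume.restrict (movingDomain e (Ioi τ))) := by
  have h1 : (movingDomain e (Ioi τ)).indicator f = (movingDomain e (Ioo τ T)).indicator f := by
    ext z
    by_cases hz : T ≤ z.1
    · rw [indicator_apply_eq_zero.2 fun _ => h0 z hz, indicator_apply_eq_zero.2 fun _ => h0 z hz]
    · have : z ∈ movingDomain e (Ioi τ) ↔ z ∈ movingDomain e (Ioo τ T) :=
        ⟨fun h => ⟨⟨h.1, not_le.1 hz⟩, h.2⟩, fun h => ⟨h.1.1, h.2⟩⟩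
      by_cases hm : z ∈ movingDomain e (Ioi τ)
      · rw [indicator_of_mem hm, indicator_of_mem (this.1 hm)]
      · rw [indicator_of_notMem hm, indicator_of_notMem fun h => hm (this.2 h)]
  rw [← memLp_indicator_iff_restrict (measurableSet_movingDomain he measurableSet_Ioi), h1,
    memLp_indicator_iff_restrict (measurableSet_movingDomain he measurableSet_Ioo)]
  exact memLp_movingDomain_of_continuous he hf

section Generators

variable {e₀ vbar τ σ : ℝ} {E : ℝ → ℝ}

/-- A mode multiplied by a function of time that vanishes near the initial time. -/
theorem isPotential_primitive_mul_mode {e : ℝ → ℝ} (hE : IsSmoothExtension e E vbar τ)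
    (hv : vbar ≠ 0) (hσ : σ ≠ 0) {η : ℝ → ℝ} (hη : ContDiff ℝ ∞ η) (n : ℕ) :
    let G : ℝ × ℝ → ℝ := fun z => (∫ s in τ..z.1, η s) * mode E vbar (-σ) ((n + 1) * Real.pi) z
    IsPotential e τ G ∧
      (∀ z, τ ≤ z.1 → residual σ G z = η z.1 * mode E vbar (-σ) ((n + 1) * Real.pi) z) ∧
      ∀ x, dx G (τ, x) = 0 := by
  intro G
  set P := mode E vbar (-σ) ((n + 1) * Real.pi)
  have hPs : ContDiff ℝ ∞ P := contDiff_mode hE.contDiff hE.pos hv (neg_ne_zero.2 hσ) _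
  have hd : ∀ t, HasDerivAt (fun t => ∫ s in τ..t, η s) (η t) t := fun t =>
    (hη.continuous.integral_hasStrictDerivAt τ t).hasDerivAt
  have hθ : ContDiff ℝ ∞ fun t => ∫ s in τ..t, η s := by
    rw [contDiff_infty_iff_deriv, funext fun t => (hd t).deriv]
    exact ⟨fun t => (hd t).differentiableAt, hη⟩
  have hG : ContDiff ℝ ∞ G := (hθ.comp contDiff_fst).mul hPs
  have hGx : ∀ t x, dx G (t, x) = (∫ s in τ..t, η s) * dx P (t, x) := fun t x =>
    (hasDerivAt_dx hG t x).unique ((hasDerivAt_dx hPs t x).const_mul (∫ s in τ..t, η s))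
  have hGxx : ∀ t x, dx (dx G) (t, x) = (∫ s in τ..t, η s) * dx (dx P) (t, x) := fun t x =>
    (hasDerivAt_dx (contDiff_dx hG) t x).unique
      (((hasDerivAt_dx (contDiff_dx hPs) t x).const_mul _).congr_of_eventuallyEq
        (Eventually.of_forall fun y => hGx t y))
  have hGt : ∀ t x, dt G (t, x) = η t * P (t, x) + (∫ s in τ..t, η s) * dt P (t, x) := fun t x =>
    (hasDerivAt_dt hG t x).unique ((hd t).mul (hasDerivAt_dt hPs t x))
  refine ⟨⟨hG, fun t _ => ?_, 0, fun t ht => ?_⟩, ?_, fun x => ?_⟩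
  · simp [G, mode_zero]
  · have := mode_right (vbar := vbar) (σ := -σ) hE.pos n t
    rw [hE.eq t ht] at this
    simp [G, this]
  · rintro ⟨t, x⟩ ht
    have := mode_equation hE.contDiff hE.pos hv (neg_ne_zero.2 hσ) ((n + 1) * Real.pi)
      (hE.hasDerivAt t ht) x
    simp only [residual, hGt, hGxx]
    linear_combination (∫ s in τ..t, η s) * this
  · simp [hGx]

/-- An affine function to the power -3/2, which is the decay in time of the squared residual of a
diffusive profile. -/
theorem integrableOn_thickness_rpow (he₀ : 0 < e₀) (hv : 0 < vbar) (hτ : 0 ≤ τ) :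
    IntegrableOn (fun t => 1 / (thickness e₀ vbar t * √(thickness e₀ vbar t))) (Ioi τ) := by
  have hd : ∀ t, HasDerivAt (thickness e₀ vbar) vbar t := fun t =>
    (((hasDerivAt_id t).mul_const vbar).const_add e₀).congr_deriv (one_mul _)
  refine integrableOn_Ioi_deriv_of_nonneg' (g := fun t => (-2 / vbar) * (√(thickness e₀ vbar t))⁻¹)
    (l := (-2 / vbar) * 0) (fun t ht => ?_) (fun t ht => ?_) ?_
  · have hpos := thickness_pos he₀ hv (hτ.trans ht)
    have hs : 0 < √(thickness e₀ vbar t) := Real.sqrt_pos.2 hpos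
    refine ((((hd t).sqrt hpos.ne').inv hs.ne').const_mul (-2 / vbar)).congr_deriv ?_
    rw [Real.sq_sqrt hpos.le]
    field_simp
  · have hpos := thickness_pos he₀ hv (hτ.trans (le_of_lt ht))
    positivity
  · refine Tendsto.const_mul _ (tendsto_inv_atTop_zero.comp ?_)
    refine Real.tendsto_sqrt_atTop.comp ?_
    unfold thickness
    exact tendsto_atTop_add_const_left _ _ (tendsto_id.atTop_mul_const hv)

/-- Potentials with prescribed initial density, spreading at the diffusive rate. -/
theorem isPotential_diffusive (he₀ : 0 < e₀) (hv : 0 < vbar) (hτ : 0 ≤ τ)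
    (hE : IsSmoothExtension (thickness e₀ vbar) E vbar τ) {u : ℝ → ℝ} (hu : ContDiff ℝ ∞ u)
    (hus : tsupport u ⊆ Ioo 0 (E τ)) :
    let G : ℝ × ℝ → ℝ := fun z => ∫ y in (0 : ℝ)..(z.2 * √(E τ / E z.1)), u y
    IsPotential (thickness e₀ vbar) τ G ∧
      MemLp (residual σ G) 2 (volume.restrict (movingDomain (thickness e₀ vbar) (Ioi τ))) ∧
      ∀ x, dx G (τ, x) = u x := by
  -- The profile is stretched to a width of order √E. This rate makes the residual square-integrable
  -- up to infinite time: it has size 1/E on a set of length √(LE), and E^(-3/2) is integrable. With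
  -- no stretching, or with stretching proportional to E, it would in general fail to be.
  intro G
  set e := thickness e₀ vbar with he
  set L := E τ with hL
  have hLpos : 0 < L := hE.pos τ
  have hd : ∀ t, HasDerivAt (fun t => ∫ s in (0 : ℝ)..t, u s) (u t) t := fun t =>
    (hu.continuous.integral_hasStrictDerivAt 0 t).hasDerivAt
  have hU : ContDiff ℝ ∞ fun t => ∫ s in (0 : ℝ)..t, u s := by
    rw [contDiff_infty_iff_deriv, funext fun t => (hd t).deriv]
    exact ⟨fun t => (hd t).differentiableAt, hu⟩
  have hUc : ∀ y, L ≤ y → ∫ s in (0 : ℝ)..y, u s = ∫ s, u s := by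
    intro y hy
    refine intervalIntegral.integral_eq_integral_of_support_subset fun x hx => ?_
    have := hus (subset_tsupport _ hx)
    exact ⟨this.1, this.2.le.trans hy⟩
  have hq0 : ∀ t, 0 < L / E t := fun t => div_pos hLpos (hE.pos t)
  have hs : ContDiff ℝ ∞ fun t => √(L / E t) :=
    (contDiff_const.div hE.contDiff fun t => (hE.pos t).ne').sqrt fun t => (hq0 t).ne'
  have hG : ContDiff ℝ ∞ G := hU.comp (contDiff_snd.mul (hs.comp contDiff_fst))
  have hGx : ∀ t x, dx G (t, x) = u (x * √(L / E t)) * √(L / E t) := by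
    intro t x
    have h1 : HasDerivAt (fun y => y * √(L / E t)) (√(L / E t)) x := by
      simpa using (hasDerivAt_id x).mul_const (√(L / E t))
    exact (hasDerivAt_dx hG t x).unique (HasDerivAt.comp x (h₂ := fun t => ∫ s in (0 : ℝ)..t, u s)
      (hd (x * √(L / E t))) h1)
  have hu' : ∀ y, HasDerivAt u (deriv u y) y := fun y => (hu.differentiable (by simp) y).hasDerivAt
  have hGxx : ∀ t x, dx (dx G) (t, x) = deriv u (x * √(L / E t)) * (L / E t) := fun t x =>
    (hasDerivAt_dx (contDiff_dx hG) t x).unique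
      (((((hu' (x * √(L / E t))).comp x ((hasDerivAt_id x).mul_const (√(L / E t)))).mul_const
        (√(L / E t))).congr_of_eventuallyEq (Eventually.of_forall fun y => hGx t y)).congr_deriv (by
          rw [one_mul, mul_assoc, Real.mul_self_sqrt (hq0 t).le]))
  have hst : ∀ t, τ ≤ t → HasDerivAt (fun t => √(L / E t)) (- vbar / (2 * E t) * √(L / E t)) t := by
    intro t ht
    have h1 : HasDerivAt (fun t => L / E t) (- (L * vbar / E t ^ 2)) t := by
      refine ((hasDerivAt_const t L).div (hE.hasDerivAt t ht) (hE.pos t).ne').congr_deriv ?_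
      ring
    refine (h1.sqrt (hq0 t).ne').congr_deriv ?_
    have h2 : √(L / E t) * √(L / E t) = L / E t := Real.mul_self_sqrt (hq0 t).le
    have h3 : 0 < √(L / E t) := Real.sqrt_pos.2 (hq0 t)
    have h4 := (hE.pos t).ne'
    have h5 : L = E t * (√(L / E t) * √(L / E t)) := by
      rw [h2]
      field_simp
    rw [div_eq_iff (by positivity)]
    have h6 : - vbar / (2 * E t) * √(L / E t) * (2 * √(L / E t)) =
        - vbar / E t * (√(L / E t) * √(L / E t)) := by
      field_simp
    rw [h6, h2]
    ring
  have hGt : ∀ t x, τ ≤ t → dt G (t, x) =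
      u (x * √(L / E t)) * (x * (- vbar / (2 * E t) * √(L / E t))) := fun t x ht =>
    (hasDerivAt_dt hG t x).unique
      (HasDerivAt.comp t (h₂ := fun t => ∫ s in (0 : ℝ)..t, u s) (hd (x * √(L / E t))) ((hst t ht).const_mul x))
  set R : ℝ → ℝ := fun y => - (vbar / 2) * (y * u y) - σ * L * deriv u y with hR
  have hud : Continuous (deriv u) := hu.continuous_deriv (by simp)
  -- In the stretched variable the residual is a fixed profile R divided by E: ∂ₜG and σ∂ₓₓG scale
  -- alike, which is the parabolic scaling.
  have hRc : Continuous R := by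
    have := hu.continuous
    fun_prop
  have hres : ∀ t x, τ ≤ t → residual σ G (t, x) = R (x * √(L / E t)) / E t := by
    intro t x ht
    have h4 := (hE.pos t).ne'
    simp only [residual, hGt t x ht, hGxx, hR]
    field_simp
  have hR0 : ∀ y, L ≤ y → R y = 0 := by
    intro y hy
    have h1 : y ∉ tsupport u := fun h => (hus h).2.not_ge hy
    have h2 : u y = 0 := image_eq_zero_of_notMem_tsupport h1
    have h3 : deriv u y = 0 := by
      by_contra h
      exact h1 (support_deriv_subset h)
    simp [hR, h2, h3]
  obtain ⟨C, hC⟩ := (isCompact_Icc (a := 0) (b := L)).exists_bound_of_continuousOn hRc.continuousOn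
  have hC0 : 0 ≤ C := (norm_nonneg _).trans (hC 0 (left_mem_Icc.2 hLpos.le))
  have hRb : ∀ y, 0 ≤ y → ‖R y‖ ≤ C := by
    intro y hy
    rcases le_total L y with h | h
    · rw [hR0 y h, norm_zero]
      exact hC0
    · exact hC y ⟨hy, h⟩
  refine ⟨⟨hG, fun t _ => by simp [G], ∫ s, u s, fun t ht => ?_⟩, ?_, fun x => ?_⟩
  · refine hUc _ ?_
    -- The domain grows at least as fast as the profile spreads: E√(L/E) = √(LE) ≥ L, so the support
    -- of the density never reaches the moving end and the total mass is constant.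
    have h1 : L ≤ E t := by
      rw [hL, hE.eq t ht, hE.eq τ le_rfl, he]
      unfold thickness
      nlinarith
    rw [← hE.eq t ht]
    have h2 : E t * √(L / E t) = √(L * E t) := by
      rw [← Real.sqrt_sq (hE.pos t).le, ← Real.sqrt_mul (by positivity), Real.sqrt_sq (hE.pos t).le]
      congr 1
      have := (hE.pos t).ne'
      field_simp
    change L ≤ E t * √(L / E t)
    rw [h2]
    refine Real.le_sqrt_of_sq_le ?_
    nlinarith
  · refine ⟨(continuous_residual hG).aestronglyMeasurable, ?_⟩
    rw [eLpNorm_lt_top_iff_lintegral_rpow_enorm_lt_top (by norm_num) (by norm_num)]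
    rw [setLIntegral_movingDomain hE.continuous measurableSet_Ioi
      ((continuous_residual hG).enorm.aemeasurable.pow_const _)]
    have hbound : ∀ t ∈ Ioi τ, ∫⁻ x in Ioo 0 (e t), ‖residual σ G (t, x)‖ₑ ^ (2 : ℝ≥0∞).toReal ≤
        ENNReal.ofReal (C ^ 2 * √L * (1 / (e t * √(e t)))) := by
      intro t ht
      have ht' : τ ≤ t := le_of_lt ht
      have hEt := hE.eq t ht'
      have hpos := hE.pos t
      have hsq : 0 < √(L * E t) := Real.sqrt_pos.2 (by positivity)
      calc ∫⁻ x in Ioo 0 (e t), ‖residual σ G (t, x)‖ₑ ^ (2 : ℝ≥0∞).toReal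
          ≤ ∫⁻ x in Ioo 0 (e t), (Ioo 0 (√(L * E t))).indicator
              (fun _ => ENNReal.ofReal ((C / E t) ^ 2)) x := by
            refine setLIntegral_mono' measurableSet_Ioo fun x hx => ?_
            rw [hres t x ht']
            by_cases hxs : x < √(L * E t)
            · rw [indicator_of_mem (show x ∈ Ioo 0 (√(L * E t)) from ⟨hx.1, hxs⟩)]
              rw [← ofReal_norm, ENNReal.toReal_ofNat,
                ENNReal.ofReal_rpow_of_nonneg (norm_nonneg _) (by norm_num)]
              refine ENNReal.ofReal_le_ofReal ?_
              rw [Real.rpow_two, norm_div, Real.norm_eq_abs (E t), abs_of_pos hpos]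
              have := hRb (x * √(L / E t)) (mul_nonneg hx.1.le (Real.sqrt_nonneg _))
              gcongr
            · have h3 : L ≤ x * √(L / E t) := by
                have h4 : √(L * E t) * √(L / E t) = L := by
                  rw [← Real.sqrt_mul (by positivity)]
                  have : L * E t * (L / E t) = L ^ 2 := by
                    field_simp
                  rw [this, Real.sqrt_sq hLpos.le]
                calc L = √(L * E t) * √(L / E t) := h4.symm
                  _ ≤ x * √(L / E t) := by
                    gcongr
                    exact not_lt.1 hxs
              simp [hR0 _ h3]
        _ ≤ ∫⁻ x, (Ioo 0 (√(L * E t))).indicator (fun _ => ENNReal.ofReal ((C / E t) ^ 2)) x :=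
            setLIntegral_le_lintegral _ _
        _ = ENNReal.ofReal ((C / E t) ^ 2) * ENNReal.ofReal (√(L * E t)) := by
            rw [lintegral_indicator measurableSet_Ioo, setLIntegral_const, Real.volume_Ioo, sub_zero]
        _ = ENNReal.ofReal (C ^ 2 * √L * (1 / (e t * √(e t)))) := by
            rw [← ENNReal.ofReal_mul (by positivity), ← hEt, Real.sqrt_mul hLpos.le]
            congr 1
            have h5 : E t = √(E t) * √(E t) := (Real.mul_self_sqrt hpos.le).symm
            have h6 : 0 < √(E t) := Real.sqrt_pos.2 hpos
            rw [div_pow, div_mul_eq_mul_div, mul_one_div, div_eq_div_iff (by positivity) (by positivity)]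
            calc C ^ 2 * (√L * √(E t)) * (E t * √(E t)) =
                C ^ 2 * √L * (E t * (√(E t) * √(E t))) := by ring
              _ = C ^ 2 * √L * E t ^ 2 := by rw [← h5]; ring
    refine (setLIntegral_mono' measurableSet_Ioi hbound).trans_lt ?_
    exact ((integrableOn_thickness_rpow he₀ hv hτ).const_mul (C ^ 2 * √L)).lintegral_lt_top
  · rw [hGx, ← hL, div_self hLpos.ne', Real.sqrt_one, mul_one, mul_one]

end Generators

/-! ### Density of the pairs (residual, initial density) in L² × L². -/

section Density

variable {e₀ vbar τ σ : ℝ} {E : ℝ → ℝ}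

/-- A forward mode multiplied by ∫_τ^t η has residual η times the mode and zero initial density. As
η is arbitrary, ψ(t, ·) is orthogonal to all modes for almost every t, and the totality of the sines
applies on each such slice. -/
theorem ae_eq_zero_of_integral_residual_mul {e : ℝ → ℝ} (hE : IsSmoothExtension e E vbar τ)
    (hv : vbar ≠ 0) (hσ : σ ≠ 0) {ψ : ℝ × ℝ → ℝ}
    (hψ : MemLp ψ 2 (volume.restrict (movingDomain e (Ioi τ))))
    (h : ∀ G, IsPotential e τ G → MemLp (residual σ G) 2 (volume.restrict (movingDomain e (Ioi τ))) →
      (∀ x, dx G (τ, x) = 0) → ∫ z in movingDomain e (Ioi τ), residual σ G z * ψ z = 0) :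
    ψ =ᵐ[volume.restrict (movingDomain e (Ioi τ))] 0 := by
  have he := hE.continuous
  have hmode : ∀ n : ℕ, ∀ᵐ t, t ∈ Ioi τ →
      ∫ x in Ioo 0 (e t), mode E vbar (-σ) ((n + 1) * Real.pi) (t, x) * ψ (t, x) = 0 := by
    intro n
    set P := mode E vbar (-σ) ((n + 1) * Real.pi)
    have hPs : ContDiff ℝ ∞ P := contDiff_mode hE.contDiff hE.pos hv (neg_ne_zero.2 hσ) _
    have hloc : LocallyIntegrableOn (fun t => ∫ x in Ioo 0 (e t), P (t, x) * ψ (t, x)) (Ioi τ) := by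
      rw [locallyIntegrableOn_iff isOpen_Ioi.isLocallyClosed]
      intro k hk hkc
      obtain ⟨b, hb⟩ := hkc.bddAbove
      have hkI : k ⊆ Ioo τ (b + 1) := fun t ht => ⟨hk ht, (hb ht).trans_lt (by linarith)⟩
      refine IntegrableOn.mono_set ?_ hkI
      exact integrableOn_integral_movingDomain he measurableSet_Ioo
        (integrableOn_mul_movingDomain he hPs.continuous (hψ.mono_measure
          (Measure.restrict_mono (movingDomain_mono fun t ht => ht.1) le_rfl)))
    refine isOpen_Ioi.ae_eq_zero_of_integral_contDiff_smul_eq_zero hloc fun η h1 h2 h3 => ?_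
    obtain ⟨hG, hres, h0⟩ := isPotential_primitive_mul_mode hE hv hσ h1 n
    set G : ℝ × ℝ → ℝ := fun z => (∫ s in τ..z.1, η s) * P z with hGdef
    have hQm := measurableSet_movingDomain he (measurableSet_Ioi (a := τ))
    obtain ⟨b, hb⟩ := h2.isCompact.bddAbove
    have hηP : MemLp (fun z : ℝ × ℝ => η z.1 * P z) 2 (volume.restrict (movingDomain e (Ioi τ))) := by
      refine memLp_movingDomain_Ioi_of_eq_zero (T := b + 1) he
        ((h1.continuous.comp continuous_fst).mul hPs.continuous) fun z hz => ?_
      have : η z.1 = 0 := image_eq_zero_of_notMem_tsupport fun hh => by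
        have := hb hh
        linarith
      rw [this, zero_mul]
    have hae : residual σ G =ᵐ[volume.restrict (movingDomain e (Ioi τ))]
        fun z => η z.1 * P z := by
      filter_upwards [ae_restrict_mem hQm] with z hz
      exact hres z (le_of_lt hz.1)
    have key := h G hG (hηP.ae_eq hae.symm) h0
    have e1 : ∫ z in movingDomain e (Ioi τ), residual σ G z * ψ z =
        ∫ z in movingDomain e (Ioi τ), η z.1 * P z * ψ z := by
      refine integral_congr_ae ?_
      filter_upwards [hae] with z hz
      rw [hz]
    have hi : IntegrableOn (fun z : ℝ × ℝ => η z.1 * P z * ψ z) (movingDomain e (Ioi τ)) :=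
      hηP.integrable_mul hψ
    rw [e1, setIntegral_movingDomain he measurableSet_Ioi hi] at key
    simp only [mul_assoc, integral_const_mul] at key
    rw [setIntegral_eq_integral_of_forall_compl_eq_zero] at key
    · simpa using key
    · intro t ht
      rw [image_eq_zero_of_notMem_tsupport fun hh => ht (h3 hh), zero_mul]
  refine ae_eq_zero_of_ae_slice he measurableSet_Ioi hψ.1 ?_
  rw [ae_restrict_iff' measurableSet_Ioi]
  have hsl := memLp_slice he measurableSet_Ioi hψ
  rw [ae_restrict_iff' measurableSet_Ioi] at hsl
  filter_upwards [ae_all_iff.2 hmode, hsl] with t ht hψt htτ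
  have hEt := hE.eq t (le_of_lt htτ)
  have hpos : 0 < e t := hEt ▸ hE.pos t
  set A : ℝ → ℝ := fun x => Real.exp (vbar * x ^ 2 / (4 * (-σ) * e t)) with hA
  have hAc : Continuous A := by fun_prop
  have hz := ae_eq_zero_of_integral_mul_sin hpos (f := fun x => A x * ψ (t, x))
    ((memLp_of_continuous _ hAc).integrable_mul (hψt htτ)) fun n => by
      have hn := ht n htτ
      set k : ℝ := (n + 1) * Real.pi with hk
      have e3 : ∀ x, mode E vbar (-σ) k (t, x) * ψ (t, x) =
          Real.exp (- Real.log (e t) / 2 - k ^ 2 * (-σ) / (vbar * e t)) *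
          (A x * ψ (t, x) * Real.sin ((n + 1) * (Real.pi * x / e t))) := by
        intro x
        have e4 : (- Real.log (e t) / 2 + vbar * x ^ 2 / (4 * (-σ) * e t) - k ^ 2 * (-σ) / (vbar * e t)) =
          (- Real.log (e t) / 2 - k ^ 2 * (-σ) / (vbar * e t)) + vbar * x ^ 2 / (4 * (-σ) * e t) := by ring
        have e5 : k * x / e t = (n + 1) * (Real.pi * x / e t) := by rw [hk]; ring
        simp only [mode, hEt]
        rw [e4, Real.exp_add, e5]
        ring
      simp only [e3] at hn
      rw [integral_const_mul] at hn
      exact (mul_eq_zero.1 hn).resolve_left (Real.exp_pos _).ne'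
  filter_upwards [hz] with x hx
  exact (mul_eq_zero.1 hx).resolve_left (Real.exp_pos _).ne'

/-- The pairs formed by the residual of a potential and its initial density. -/
def potentialPairs (e : ℝ → ℝ) (τ σ : ℝ) : Submodule ℝ (WithLp 2
    (Lp ℝ 2 (volume.restrict (movingDomain e (Ioi τ))) × Lp ℝ 2 (leb (e τ)))) where
  carrier := {z | ∃ G, IsPotential e τ G ∧
    z.fst =ᵐ[volume.restrict (movingDomain e (Ioi τ))] residual σ G ∧
    z.snd =ᵐ[leb (e τ)] fun x => dx G (τ, x)}
  zero_mem' := by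
    have hz : IsPotential e τ 0 :=
      ⟨contDiff_const, fun _ _ => rfl, 0, fun _ _ => rfl⟩
    have h1 : dx (0 : ℝ × ℝ → ℝ) = 0 := by
      ext z
      simp [dx]
    have h2 : dt (0 : ℝ × ℝ → ℝ) = 0 := by
      ext z
      simp [dt]
    refine ⟨0, hz, ?_, ?_⟩
    · have h3 : residual σ 0 = 0 := by
        ext z
        simp [residual, h1, h2]
      rw [h3]
      exact Lp.coeFn_zero _ _ _
    · rw [h1]
      exact Lp.coeFn_zero _ _ _
  add_mem' := by
    rintro z w ⟨G, hG, h1, h2⟩ ⟨H, hH, h3, h4⟩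
    refine ⟨G + H, hG.add hH, ?_, ?_⟩
    · rw [residual_add hG.contDiff hH.contDiff]
      filter_upwards [Lp.coeFn_add z.fst w.fst, h1, h3] with x q1 q2 q3
      rw [WithLp.add_fst, q1, Pi.add_apply, Pi.add_apply, q2, q3]
    · rw [dx_add hG.contDiff hH.contDiff]
      filter_upwards [Lp.coeFn_add z.snd w.snd, h2, h4] with x q1 q2 q3
      rw [WithLp.add_snd, q1, Pi.add_apply, Pi.add_apply, q2, q3]
  smul_mem' := by
    rintro c z ⟨G, hG, h1, h2⟩
    refine ⟨c • G, hG.smul c, ?_, ?_⟩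
    · rw [residual_smul hG.contDiff]
      filter_upwards [Lp.coeFn_smul c z.fst, h1] with x q1 q2
      rw [WithLp.smul_fst, q1, Pi.smul_apply, Pi.smul_apply, q2]
    · rw [dx_smul hG.contDiff]
      filter_upwards [Lp.coeFn_smul c z.snd, h2] with x q1 q2
      rw [WithLp.smul_snd, q1, Pi.smul_apply, Pi.smul_apply, q2]

/-- Potentials with zero initial density remove the first component of an orthogonal pair. The
residual of a diffusive profile then no longer contributes, so the second component is orthogonal to
every smooth u with compact support. -/
theorem orthogonal_potentialPairs (he₀ : 0 < e₀) (hv : 0 < vbar) (hτ : 0 ≤ τ) (hσ : σ ≠ 0)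
    (hE : IsSmoothExtension (thickness e₀ vbar) E vbar τ) :
    (potentialPairs (thickness e₀ vbar) τ σ)ᗮ = ⊥ := by
  set e := thickness e₀ vbar with he
  refine (Submodule.eq_bot_iff _).2 fun z hz => ?_
  rw [Submodule.mem_orthogonal] at hz
  have horth : ∀ G, IsPotential e τ G →
      MemLp (residual σ G) 2 (volume.restrict (movingDomain e (Ioi τ))) →
      (∫ y in movingDomain e (Ioi τ), residual σ G y * z.fst y) +
        ∫ x, dx G (τ, x) * z.snd x ∂(leb (e τ)) = 0 := by
    intro G hG hres
    have hx : MemLp (fun x => dx G (τ, x)) 2 (leb (e τ)) :=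
      memLp_of_continuous _ (contDiff_slice (contDiff_dx hG.contDiff) τ).continuous
    have := hz (WithLp.toLp 2 (hres.toLp, hx.toLp)) ⟨G, hG, hres.coeFn_toLp, hx.coeFn_toLp⟩
    rw [WithLp.prod_inner_apply, L2.inner_def, L2.inner_def] at this
    rw [← this]
    congr 1
    · refine integral_congr_ae ?_
      filter_upwards [hres.coeFn_toLp] with y hy
      simp [hy, mul_comm]
    · refine integral_congr_ae ?_
      filter_upwards [hx.coeFn_toLp] with y hy
      simp [hy, mul_comm]
  have hfst : z.fst =ᵐ[volume.restrict (movingDomain e (Ioi τ))] 0 := by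
    refine ae_eq_zero_of_integral_residual_mul hE hv.ne' hσ (Lp.memLp _) fun G hG hres h0 => ?_
    have := horth G hG hres
    simpa [h0] using this
  have hsnd : z.snd =ᵐ[leb (e τ)] 0 := by
    have hEτ := hE.eq τ le_rfl
    have hloc : LocallyIntegrableOn (fun x => z.snd x) (Ioo 0 (e τ)) :=
      IntegrableOn.locallyIntegrableOn ((Lp.memLp z.snd).integrable (by norm_num))
    rw [Filter.EventuallyEq, ae_restrict_iff' measurableSet_Ioo]
    refine isOpen_Ioo.ae_eq_zero_of_integral_contDiff_smul_eq_zero hloc fun u h1 h2 h3 => ?_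
    obtain ⟨hG, hres, hx⟩ := isPotential_diffusive (σ := σ) he₀ hv hτ hE h1 (by rwa [hEτ])
    have := horth _ hG hres
    have e1 : ∀ f : ℝ × ℝ → ℝ, ∫ y in movingDomain e (Ioi τ), f y * z.fst y = 0 := by
      intro f
      rw [integral_eq_zero_of_ae]
      filter_upwards [hfst] with y hy
      simp [hy]
    rw [e1, zero_add] at this
    simp only [hx] at this
    rw [setIntegral_eq_integral_of_forall_compl_eq_zero] at this
    · exact this
    · intro x hx'
      rw [image_eq_zero_of_notMem_tsupport fun hh => hx' (h3 hh), zero_mul]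
  have h1 : z.fst = 0 := Lp.ext (hfst.trans (Lp.coeFn_zero _ _ _).symm)
  have h2 : z.snd = 0 := Lp.ext (hsnd.trans (Lp.coeFn_zero _ _ _).symm)
  exact WithLp.ofLp_injective 2 (Prod.ext h1 h2)

/-- Every initial density is approximated by potentials with small residual. -/
theorem exists_isPotential_approx (he₀ : 0 < e₀) (hv : 0 < vbar) (hτ : 0 ≤ τ) (hσ : σ ≠ 0)
    (hE : IsSmoothExtension (thickness e₀ vbar) E vbar τ) {g₀ : ℝ → ℝ}
    (hg₀ : MemLp g₀ 2 (leb (thickness e₀ vbar τ))) {ε : ℝ} (hε : 0 < ε) :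
    ∃ G, IsPotential (thickness e₀ vbar) τ G ∧
      MemLp (residual σ G) 2 (volume.restrict (movingDomain (thickness e₀ vbar) (Ioi τ))) ∧
      eLpNorm (residual σ G) 2 (volume.restrict (movingDomain (thickness e₀ vbar) (Ioi τ))) ≤
        ENNReal.ofReal ε ∧
      eLpNorm (fun x => dx G (τ, x) - g₀ x) 2 (leb (thickness e₀ vbar τ)) ≤ ENNReal.ofReal ε := by
  set e := thickness e₀ vbar with he
  have hd := Submodule.topologicalClosure_eq_top_iff.2
    (orthogonal_potentialPairs he₀ hv hτ hσ hE)
  -- The target has residual zero: being in the closure means that the exact equation with initial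
  -- datum g₀ is approximately solvable.
  set p : WithLp 2 (Lp ℝ 2 (volume.restrict (movingDomain e (Ioi τ))) × Lp ℝ 2 (leb (e τ))) :=
    WithLp.toLp 2 (0, hg₀.toLp) with hp
  have hmem : p ∈ (potentialPairs e τ σ).topologicalClosure := by
    rw [hd]
    trivial
  rw [← SetLike.mem_coe, Submodule.topologicalClosure_coe, Metric.mem_closure_iff] at hmem
  obtain ⟨z, ⟨G, hG, h1, h2⟩, hz⟩ := hmem ε hε
  have hres : MemLp (residual σ G) 2 (volume.restrict (movingDomain e (Ioi τ))) :=
    (Lp.memLp z.fst).ae_eq h1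
  rw [dist_comm, dist_eq_norm] at hz
  refine ⟨G, hG, hres, ?_, ?_⟩
  · have h3 : ‖z.fst‖ ≤ ε := by
      have := (WithLp.norm_fst_le _ (z - p)).trans hz.le
      simpa [hp] using this
    rw [← eLpNorm_congr_ae h1, ← ENNReal.ofReal_toReal (Lp.memLp z.fst).2.ne, ← Lp.norm_def]
    exact ENNReal.ofReal_le_ofReal h3
  · have h3 : ‖z.snd - hg₀.toLp‖ ≤ ε := by
      have := (WithLp.norm_snd_le _ (z - p)).trans hz.le
      simpa [hp] using this
    have h4 : (fun x => dx G (τ, x) - g₀ x) =ᵐ[leb (e τ)] (z.snd - hg₀.toLp : Lp ℝ 2 (leb (e τ))) := by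
      filter_upwards [Lp.coeFn_sub z.snd hg₀.toLp, h2, hg₀.coeFn_toLp] with x q1 q2 q3
      rw [q1, Pi.sub_apply, q2, q3]
    rw [eLpNorm_congr_ae h4, ← ENNReal.ofReal_toReal (Lp.memLp (z.snd - hg₀.toLp)).2.ne, ← Lp.norm_def]
    exact ENNReal.ofReal_le_ofReal h3

end Density

/-! ### Square norms and limits of pairings in L². -/

section L2

variable {α : Type*} {m : MeasurableSpace α} {μ : Measure α}

theorem eLpNorm_two_sq (f : α → ℝ) : eLpNorm f 2 μ ^ 2 = ∫⁻ x, ‖f x‖ₑ ^ 2 ∂μ := by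
  have h := eLpNorm_nnreal_pow_eq_lintegral (μ := μ) (f := f) (p := 2) (by norm_num)
  simpa using h

theorem MemLp.ofReal_integral_sq {f : α → ℝ} (hf : MemLp f 2 μ) :
    ENNReal.ofReal (∫ x, f x ^ 2 ∂μ) = eLpNorm f 2 μ ^ 2 := by
  rw [eLpNorm_two_sq, ofReal_integral_eq_lintegral_ofReal hf.integrable_sq
    (Eventually.of_forall fun x => sq_nonneg _)]
  refine lintegral_congr fun x => ?_
  rw [← sq_abs, ENNReal.ofReal_pow (abs_nonneg _), ← Real.norm_eq_abs, ofReal_norm]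

theorem tendsto_integral_mul_of_eLpNorm {f : ℕ → α → ℝ} {f' q : α → ℝ} (hf : ∀ n, MemLp (f n) 2 μ)
    (hf' : MemLp f' 2 μ) (hq : MemLp q 2 μ)
    (h : Tendsto (fun n => eLpNorm (fun x => f n x - f' x) 2 μ) atTop (𝓝 0)) :
    Tendsto (fun n => ∫ x, f n x * q x ∂μ) atTop (𝓝 (∫ x, f' x * q x ∂μ)) := by
  refine tendsto_integral_of_L1' _ (hf'.integrable_mul hq).1
    (Eventually.of_forall fun n => (hf n).integrable_mul hq) ?_
  have h0 : Tendsto (fun n => eLpNorm (fun x => f n x - f' x) 2 μ * eLpNorm q 2 μ) atTop (𝓝 0) := by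
    simpa using ENNReal.Tendsto.mul_const h (Or.inr hq.2.ne)
  refine tendsto_of_tendsto_of_tendsto_of_le_of_le tendsto_const_nhds h0 (fun _ => zero_le)
    fun n => ?_
  have := eLpNorm_smul_le_mul_eLpNorm (p := 2) (q := 2) (r := 1) hq.1 ((hf n).sub hf').1
  refine Eq.trans_le ?_ this
  congr 1
  ext x
  simp [sub_mul]

theorem tendsto_eLpNorm_of_sub {f : ℕ → α → ℝ} {f' : α → ℝ} (hf : ∀ n, MemLp (f n) 2 μ)
    (hf' : MemLp f' 2 μ)
    (h : Tendsto (fun n => eLpNorm (fun x => f n x - f' x) 2 μ) atTop (𝓝 0)) :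
    Tendsto (fun n => eLpNorm (f n) 2 μ) atTop (𝓝 (eLpNorm f' 2 μ)) := by
  have h1 := (Lp.tendsto_Lp_iff_tendsto_eLpNorm'' (p := 2) (μ := μ) f hf f' hf').2 h
  have h2 := (ENNReal.continuous_ofReal.tendsto _).comp h1.norm
  simpa only [Function.comp_def, Lp.norm_toLp, ENNReal.ofReal_toReal (hf _).2.ne,
    ENNReal.ofReal_toReal hf'.2.ne] using h2

end L2

/-! ### The energy inequality in terms of extended norms, up to infinite time. -/

section Energy

variable {e E : ℝ → ℝ} {vbar τ σ : ℝ} {G : ℝ × ℝ → ℝ}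

theorem eLpNorm_movingDomain_sq (he : Continuous e) {I : Set ℝ} (hI : MeasurableSet I)
    {f : ℝ × ℝ → ℝ} (hf : AEStronglyMeasurable f (volume.restrict (movingDomain e I))) :
    eLpNorm f 2 (volume.restrict (movingDomain e I)) ^ 2 =
      ∫⁻ t in I, eLpNorm (fun x => f (t, x)) 2 (leb (e t)) ^ 2 := by
  rw [eLpNorm_two_sq, setLIntegral_movingDomain he hI (hf.enorm.pow_const 2)]
  exact lintegral_congr fun t => (eLpNorm_two_sq _).symm

theorem eLpNorm_movingDomain_Ioi_sq (e : ℝ → ℝ) (τ : ℝ) (f : ℝ × ℝ → ℝ) :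
    eLpNorm f 2 (volume.restrict (movingDomain e (Ioi τ))) ^ 2 =
      ⨆ n : ℕ, eLpNorm f 2 (volume.restrict (movingDomain e (Ioo τ (τ + (n + 1))))) ^ 2 := by
  have h : movingDomain e (Ioi τ) = ⋃ n : ℕ, movingDomain e (Ioo τ (τ + (n + 1))) := by
    ext z
    simp only [mem_iUnion]
    constructor
    · rintro ⟨h1, h2⟩
      obtain ⟨n, hn⟩ := exists_nat_gt (z.1 - τ)
      exact ⟨n, ⟨h1, by linarith⟩, h2⟩
    · rintro ⟨n, h1, h2⟩
      exact ⟨h1.1, h2⟩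
  simp only [eLpNorm_two_sq]
  rw [h, setLIntegral_iUnion_of_directed]
  refine directed_of_isDirected_le fun n m hnm => movingDomain_mono (Ioo_subset_Ioo_right ?_)
  have : (n : ℝ) ≤ m := by exact_mod_cast hnm
  linarith

/-- The residual is measured on the whole half-line, so the right side does not depend on T and the
bound on ∂ₓₓG passes to infinite time by monotone convergence. -/
theorem IsPotential.eLpNorm_add_le (hE : IsSmoothExtension e E vbar τ) (hG : IsPotential e τ G)
    (hvb : 0 < vbar) (hσ : 0 < σ) {T : ℝ} (hT : τ < T) :
    eLpNorm (fun x => dx G (T, x)) 2 (leb (e T)) ^ 2 +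
      ENNReal.ofReal σ * eLpNorm (dx (dx G)) 2 (volume.restrict (movingDomain e (Ioo τ T))) ^ 2 ≤
    eLpNorm (fun x => dx G (τ, x)) 2 (leb (e τ)) ^ 2 +
      ENNReal.ofReal σ⁻¹ *
        eLpNorm (residual σ G) 2 (volume.restrict (movingDomain e (Ioi τ))) ^ 2 := by
  have hs : ∀ t, MemLp (fun x => dx G (t, x)) 2 (leb (e t)) := fun t =>
    memLp_of_continuous _ ((contDiff_slice (contDiff_dx hG.contDiff) t).continuous)
  have hxx : MemLp (dx (dx G)) 2 (volume.restrict (movingDomain e (Ioo τ T))) :=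
    memLp_movingDomain_of_continuous hE.continuous (contDiff_dx (contDiff_dx hG.contDiff)).continuous
  have hr : MemLp (residual σ G) 2 (volume.restrict (movingDomain e (Ioo τ T))) :=
    memLp_movingDomain_of_continuous hE.continuous (continuous_residual hG.contDiff)
  have hle : eLpNorm (residual σ G) 2 (volume.restrict (movingDomain e (Ioo τ T))) ≤
      eLpNorm (residual σ G) 2 (volume.restrict (movingDomain e (Ioi τ))) :=
    eLpNorm_mono_measure _ (Measure.restrict_mono (movingDomain_mono fun t ht => ht.1) le_rfl)
  refine le_trans ?_ (add_le_add_right (mul_le_mul_right (pow_le_pow_left₀ zero_le hle 2) _) _)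
  rw [← MemLp.ofReal_integral_sq (hs T), ← MemLp.ofReal_integral_sq (hs τ),
    ← MemLp.ofReal_integral_sq hxx, ← MemLp.ofReal_integral_sq hr, ← ENNReal.ofReal_mul hσ.le,
    ← ENNReal.ofReal_mul (inv_nonneg.2 hσ.le),
    ← ENNReal.ofReal_add (integral_nonneg fun x => sq_nonneg _)
      (mul_nonneg hσ.le (integral_nonneg fun x => sq_nonneg _)),
    ← ENNReal.ofReal_add (integral_nonneg fun x => sq_nonneg _)
      (mul_nonneg (inv_nonneg.2 hσ.le) (integral_nonneg fun x => sq_nonneg _))]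
  exact ENNReal.ofReal_le_ofReal (hG.energy_le hE hvb hσ hT)

theorem IsPotential.eLpNorm_slice_sq_le (hE : IsSmoothExtension e E vbar τ) (hG : IsPotential e τ G)
    (hvb : 0 < vbar) (hσ : 0 < σ) {t : ℝ} (ht : τ ≤ t) :
    eLpNorm (fun x => dx G (t, x)) 2 (leb (e t)) ^ 2 ≤
    eLpNorm (fun x => dx G (τ, x)) 2 (leb (e τ)) ^ 2 +
      ENNReal.ofReal σ⁻¹ *
        eLpNorm (residual σ G) 2 (volume.restrict (movingDomain e (Ioi τ))) ^ 2 := by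
  rcases ht.eq_or_lt with rfl | ht
  · exact le_self_add
  · exact le_self_add.trans (hG.eLpNorm_add_le hE hvb hσ ht)

theorem IsPotential.eLpNorm_dx_dx_sq_le (hE : IsSmoothExtension e E vbar τ) (hG : IsPotential e τ G)
    (hvb : 0 < vbar) (hσ : 0 < σ) :
    ENNReal.ofReal σ * eLpNorm (dx (dx G)) 2 (volume.restrict (movingDomain e (Ioi τ))) ^ 2 ≤
    eLpNorm (fun x => dx G (τ, x)) 2 (leb (e τ)) ^ 2 +
      ENNReal.ofReal σ⁻¹ *
        eLpNorm (residual σ G) 2 (volume.restrict (movingDomain e (Ioi τ))) ^ 2 := by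
  rw [eLpNorm_movingDomain_Ioi_sq e τ (dx (dx G)), ENNReal.mul_iSup]
  refine iSup_le fun n => ?_
  exact le_add_self.trans (hG.eLpNorm_add_le hE hvb hσ (by linarith [(Nat.cast_nonneg n : (0 : ℝ) ≤ n)]))

/-- Meant for differences of two approximating potentials. With s = σ⁻¹, the squared bounds (1+s)δ²
and s(1+s)δ² are both at most ((1+s)δ)². -/
theorem IsPotential.eLpNorm_le (hE : IsSmoothExtension e E vbar τ) (hG : IsPotential e τ G)
    (hvb : 0 < vbar) (hσ : 0 < σ) {δ : ℝ} (hδ : 0 ≤ δ)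
    (h0 : eLpNorm (fun x => dx G (τ, x)) 2 (leb (e τ)) ≤ ENNReal.ofReal δ)
    (hr : eLpNorm (residual σ G) 2 (volume.restrict (movingDomain e (Ioi τ))) ≤ ENNReal.ofReal δ) :
    (∀ t, τ ≤ t → eLpNorm (fun x => dx G (t, x)) 2 (leb (e t)) ≤ ENNReal.ofReal ((1 + σ⁻¹) * δ)) ∧
    eLpNorm (dx (dx G)) 2 (volume.restrict (movingDomain e (Ioi τ))) ≤
      ENNReal.ofReal ((1 + σ⁻¹) * δ) := by
  have hσ' : 0 < σ⁻¹ := inv_pos.2 hσ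
  have key : eLpNorm (fun x => dx G (τ, x)) 2 (leb (e τ)) ^ 2 + ENNReal.ofReal σ⁻¹ *
        eLpNorm (residual σ G) 2 (volume.restrict (movingDomain e (Ioi τ))) ^ 2 ≤
      ENNReal.ofReal ((1 + σ⁻¹) * δ ^ 2) := by
    refine (add_le_add (pow_le_pow_left₀ zero_le h0 2)
      (mul_le_mul_right (pow_le_pow_left₀ zero_le hr 2) _)).trans_eq ?_
    rw [← ENNReal.ofReal_pow hδ, ← ENNReal.ofReal_mul hσ'.le,
      ← ENNReal.ofReal_add (sq_nonneg _) (by positivity)]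
    congr 1
    ring
  constructor
  · intro t ht
    have h1 := (hG.eLpNorm_slice_sq_le hE hvb hσ ht).trans key
    rw [← ENNReal.pow_le_pow_left_iff two_ne_zero, ← ENNReal.ofReal_pow (by positivity)]
    refine h1.trans (ENNReal.ofReal_le_ofReal ?_)
    have : 0 ≤ (1 + σ⁻¹) * σ⁻¹ * δ ^ 2 := by positivity
    nlinarith
  · have h1 := (hG.eLpNorm_dx_dx_sq_le hE hvb hσ).trans key
    rw [← ENNReal.pow_le_pow_left_iff two_ne_zero, ← ENNReal.ofReal_pow (by positivity)]
    have h2 := mul_le_mul_right h1 (ENNReal.ofReal σ⁻¹)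
    rw [← mul_assoc, ← ENNReal.ofReal_mul hσ'.le, inv_mul_cancel₀ hσ.ne', ENNReal.ofReal_one, one_mul,
      ← ENNReal.ofReal_mul hσ'.le] at h2
    refine h2.trans (ENNReal.ofReal_le_ofReal ?_)
    have : 0 ≤ (1 + σ⁻¹) * δ ^ 2 := by positivity
    nlinarith

end Energy

/-! ### Construction of the limit and its properties. -/

/-- The pointwise limit does not refer to the measure, so one and the same function serves as the
limit on every time slice. -/
theorem eLpNorm_sub_limUnder_le {α : Type*} {m : MeasurableSpace α} {μ : Measure α}
    {f : ℕ → α → ℝ} (hf : ∀ n, StronglyMeasurable (f n)) {B : ℕ → ℝ≥0∞} (hB : ∑' i, B i ≠ ⊤)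
    (hc : ∀ N n m : ℕ, N ≤ n → N ≤ m → eLpNorm (f n - f m) 2 μ < B N) (N : ℕ) :
    eLpNorm (fun x => f N x - limUnder atTop fun k => f k x) 2 μ ≤ B N := by
  have hlim := tendsto_eLpNorm_sub_limUnder (fun n => (hf n).aestronglyMeasurable) hB hc
  have hw : StronglyMeasurable fun x => limUnder atTop fun k => f k x := StronglyMeasurable.limUnder hf
  have h1 := hlim.const_add (B N)
  rw [add_zero] at h1
  refine ge_of_tendsto h1 ?_
  filter_upwards [eventually_ge_atTop N] with n hn
  have h2 := eLpNorm_add_le (p := 2) (μ := μ) ((hf N).sub (hf n)).aestronglyMeasurable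
    ((hf n).sub hw).aestronglyMeasurable (by norm_num)
  have e1 : (f N - f n + (f n - fun x => limUnder atTop fun k => f k x)) =
      fun x => f N x - limUnder atTop fun k => f k x := by
    ext x
    simp
  rw [e1] at h2
  exact h2.trans (add_le_add (hc N N n le_rfl hn).le le_rfl)

/-- The functions `w` and `wx` are the limits of the first and second space derivatives of
potentials `G n` that solve the heat equation up to an error that tends to zero. -/
structure IsApproximated (e : ℝ → ℝ) (τ σ : ℝ) (g₀ : ℝ → ℝ) (w wx : ℝ × ℝ → ℝ)
    (G : ℕ → ℝ × ℝ → ℝ) (B : ℕ → ℝ≥0∞) : Prop where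
  bound_ne_top : ∀ n, B n ≠ ⊤
  tendsto_bound : Tendsto B atTop (𝓝 0)
  isPotential : ∀ n, IsPotential e τ (G n)
  stronglyMeasurable : StronglyMeasurable w
  stronglyMeasurable_x : StronglyMeasurable wx
  residual_le : ∀ n, eLpNorm (residual σ (G n)) 2 (volume.restrict (movingDomain e (Ioi τ))) ≤ B n
  initial_le : ∀ n, eLpNorm (fun x => dx (G n) (τ, x) - g₀ x) 2 (leb (e τ)) ≤ B n
  slice_le : ∀ n t, τ ≤ t → eLpNorm (fun x => dx (G n) (t, x) - w (t, x)) 2 (leb (e t)) ≤ B n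
  memLp_dx_dx : ∀ n, MemLp (dx (dx (G n))) 2 (volume.restrict (movingDomain e (Ioi τ)))
  dx_dx_le : ∀ n, eLpNorm (fun z => dx (dx (G n)) z - wx z) 2
    (volume.restrict (movingDomain e (Ioi τ))) ≤ B n

/-- The difference of two potentials is a potential, and residual and density are linear. The energy
inequality for differences makes the densities Cauchy on every slice at a common rate, and their
space derivatives Cauchy on the whole moving domain. -/
theorem exists_isApproximated {e₀ vbar τ σ : ℝ} {E : ℝ → ℝ} (he₀ : 0 < e₀) (hv : 0 < vbar)
    (hτ : 0 ≤ τ) (hσ : 0 < σ) (hE : IsSmoothExtension (thickness e₀ vbar) E vbar τ) {g₀ : ℝ → ℝ}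
    (hg₀ : MemLp g₀ 2 (leb (thickness e₀ vbar τ))) :
    ∃ w wx G B, IsApproximated (thickness e₀ vbar) τ σ g₀ w wx G B := by
  have hεpos : ∀ n : ℕ, (0 : ℝ) < (1 / 2) ^ n := fun n => by positivity
  choose G hG hGr hGε hG0 using fun n : ℕ =>
    exists_isPotential_approx he₀ hv hτ hσ.ne' hE hg₀ (hεpos n)
  set e := thickness e₀ vbar with he
  have hσ' : 0 < σ⁻¹ := inv_pos.2 hσ
  -- Data within 2^(-N) of the target differ by at most 2 · 2^(-N), which the energy inequality
  -- multiplies by 1 + σ⁻¹. The factor 3 instead of 2 gives the strict inequality required of fast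
  -- Cauchy sequences.
  set B : ℕ → ℝ≥0∞ := fun n => ENNReal.ofReal (3 * (1 + σ⁻¹) * (1 / 2) ^ n) with hBdef
  have hsum : Summable fun n : ℕ => 3 * (1 + σ⁻¹) * (1 / 2 : ℝ) ^ n :=
    (summable_geometric_of_lt_one (by norm_num) (by norm_num)).mul_left _
  have hB : ∑' i, B i ≠ ⊤ := hsum.tsum_ofReal_ne_top
  have hle : ∀ n : ℕ, ENNReal.ofReal ((1 / 2) ^ n) ≤ B n := fun n =>
    ENNReal.ofReal_le_ofReal (by nlinarith [hεpos n, mul_pos hσ' (hεpos n)])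
  have hcont : ∀ n, Continuous (dx (G n)) := fun n => (contDiff_dx (hG n).contDiff).continuous
  have hcont' : ∀ n, Continuous (dx (dx (G n))) := fun n =>
    (contDiff_dx (contDiff_dx (hG n).contDiff)).continuous
  have hdiff : ∀ n m, IsPotential e τ (G n + (-1 : ℝ) • G m) := fun n m =>
    (hG n).add ((hG m).smul _)
  have hsc : ∀ m, ContDiff ℝ ∞ ((-1 : ℝ) • G m) := fun m => ((hG m).smul (-1)).contDiff
  have hdx : ∀ n m, dx (G n + (-1 : ℝ) • G m) = dx (G n) - dx (G m) := fun n m => by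
    rw [dx_add (hG n).contDiff (hsc m), dx_smul (hG m).contDiff]
    simp [sub_eq_add_neg]
  have hdxx : ∀ n m, dx (dx (G n + (-1 : ℝ) • G m)) = dx (dx (G n)) - dx (dx (G m)) := fun n m => by
    rw [dx_add (hG n).contDiff (hsc m), dx_smul (hG m).contDiff,
      dx_add (contDiff_dx (hG n).contDiff)
        (dx_smul (hG m).contDiff (-1) ▸ contDiff_dx (hsc m)),
      dx_smul (contDiff_dx (hG m).contDiff)]
    simp [sub_eq_add_neg]
  have hrs : ∀ n m, residual σ (G n + (-1 : ℝ) • G m) = residual σ (G n) - residual σ (G m) :=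
    fun n m => by
      rw [residual_add (hG n).contDiff (hsc m), residual_smul (hG m).contDiff]
      simp [sub_eq_add_neg]
  have hbd : ∀ N n : ℕ, N ≤ n → ENNReal.ofReal ((1 / 2) ^ n) ≤ ENNReal.ofReal ((1 / 2) ^ N) :=
    fun N n hn => ENNReal.ofReal_le_ofReal (pow_le_pow_of_le_one (by norm_num) (by norm_num) hn)
  have htwo : ∀ N : ℕ, ENNReal.ofReal ((1 / 2) ^ N) + ENNReal.ofReal ((1 / 2) ^ N) =
      ENNReal.ofReal (2 * (1 / 2) ^ N) := fun N => by
    rw [← ENNReal.ofReal_add (hεpos N).le (hεpos N).le, two_mul]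
  have hcauchy : ∀ N n m : ℕ, N ≤ n → N ≤ m →
      (∀ t, τ ≤ t → eLpNorm ((fun x => dx (G n) (t, x)) - fun x => dx (G m) (t, x)) 2 (leb (e t)) < B N) ∧
      eLpNorm (dx (dx (G n)) - dx (dx (G m))) 2 (volume.restrict (movingDomain e (Ioi τ))) < B N := by
    intro N n m hn hm
    have hlt : ENNReal.ofReal ((1 + σ⁻¹) * (2 * (1 / 2) ^ N)) < B N := by
      rw [hBdef, ENNReal.ofReal_lt_ofReal_iff (by positivity)]
      nlinarith [hεpos N, mul_pos hσ' (hεpos N)]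
    have hmeas : ∀ n, AEStronglyMeasurable (fun x => dx (G n) (τ, x) - g₀ x) (leb (e τ)) := fun n =>
      ((hcont n).comp (continuous_const.prodMk continuous_id)).aestronglyMeasurable.sub hg₀.1
    have key := (hdiff n m).eLpNorm_le hE hv hσ (δ := 2 * (1 / 2) ^ N) (by positivity) (by
      rw [hdx, ← htwo]
      have h1 := eLpNorm_sub_le (p := 2) (hmeas n) (hmeas m) (by norm_num)
      refine Eq.trans_le ?_ (h1.trans (add_le_add ((hG0 n).trans (hbd N n hn))
        ((hG0 m).trans (hbd N m hm))))
      congr 1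
      ext x
      simp) (by
      rw [hrs, ← htwo]
      exact (eLpNorm_sub_le (hGr n).1 (hGr m).1 (by norm_num)).trans
        (add_le_add ((hGε n).trans (hbd N n hn)) ((hGε m).trans (hbd N m hm))))
    rw [hdx] at key
    refine ⟨fun t ht => (key.1 t ht).trans_lt hlt, ?_⟩
    have h2 := key.2
    rw [← hdx, hdxx] at h2
    exact h2.trans_lt hlt
  -- Limits taken at every point of the plane are jointly measurable, and convergence holds on every
  -- slice t ≥ τ, not just on almost every one. This is what continuity in time needs.
  refine ⟨fun z => limUnder atTop fun n => dx (G n) z, fun z => limUnder atTop fun n => dx (dx (G n)) z,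
    G, B, fun n => ENNReal.ofReal_ne_top, ?_, hG,
    StronglyMeasurable.limUnder fun n => (hcont n).stronglyMeasurable,
    StronglyMeasurable.limUnder fun n => (hcont' n).stronglyMeasurable,
    fun n => (hGε n).trans (hle n), fun n => (hG0 n).trans (hle n), fun n t ht => ?_, fun n => ?_,
    fun n => ?_⟩
  · have h := (ENNReal.continuous_ofReal.tendsto _).comp hsum.tendsto_atTop_zero
    rwa [ENNReal.ofReal_zero] at h
  · exact eLpNorm_sub_limUnder_le (fun n => ((hcont n).comp
      (continuous_const.prodMk continuous_id)).stronglyMeasurable) hB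
      (fun N n m hn hm => (hcauchy N n m hn hm).1 t ht) n
  · refine ⟨(hcont' n).aestronglyMeasurable, ?_⟩
    have h0 : MemLp (fun x => dx (G n) (τ, x)) 2 (leb (e τ)) :=
      memLp_of_continuous _ ((hcont n).comp (continuous_const.prodMk continuous_id))
    have h1 := (hG n).eLpNorm_dx_dx_sq_le hE hv hσ
    have h2 := h1.trans_lt (ENNReal.add_lt_top.2 ⟨ENNReal.pow_lt_top h0.2,
      ENNReal.mul_lt_top ENNReal.ofReal_lt_top (ENNReal.pow_lt_top (hGr n).2)⟩)
    by_contra h3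
    rw [not_lt, top_le_iff] at h3
    rw [h3, ENNReal.top_pow two_ne_zero, ENNReal.mul_top (by simpa using hσ)] at h2
    exact lt_irrefl _ h2
  · exact eLpNorm_sub_limUnder_le (fun n => (hcont' n).stronglyMeasurable) hB
      (fun N n m hn hm => (hcauchy N n m hn hm).2) n

theorem MemLp.of_eLpNorm_sub_ne_top {α : Type*} {m : MeasurableSpace α} {μ : Measure α} {f f' : α → ℝ}
    (hf : MemLp f 2 μ) (hf' : AEStronglyMeasurable f' μ)
    (h : eLpNorm (fun x => f x - f' x) 2 μ ≠ ⊤) : MemLp f' 2 μ := by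
  have h1 : MemLp (fun x => f x - f' x) 2 μ := ⟨hf.1.sub hf', h.lt_top⟩
  have e1 : f' = f - fun x => f x - f' x := by
    ext x
    simp
  rw [e1]
  exact hf.sub h1

/-- The product of a square-integrable function with a continuous function. -/
theorem MemLp.continuous_mul_movingDomain {e : ℝ → ℝ} {τ T : ℝ} (he : Continuous e)
    {k q : ℝ × ℝ → ℝ} (hk : Continuous k)
    (hq : MemLp q 2 (volume.restrict (movingDomain e (Ioo τ T)))) :
    MemLp (fun z => k z * q z) 2 (volume.restrict (movingDomain e (Ioo τ T))) := by
  obtain ⟨C, hC⟩ := exists_ae_bound_movingDomain (τ := τ) (T := T) he hk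
  refine hq.of_le_mul (hk.aestronglyMeasurable.mul hq.1) (c := C) ?_
  filter_upwards [hC] with z hz
  rw [norm_mul]
  exact mul_le_mul_of_nonneg_right hz (norm_nonneg _)

section Limit

variable {e E : ℝ → ℝ} {vbar τ σ T : ℝ} {g₀ : ℝ → ℝ} {w wx : ℝ × ℝ → ℝ} {G : ℕ → ℝ × ℝ → ℝ}
  {B : ℕ → ℝ≥0∞}

namespace IsApproximated

theorem continuous_dx (h : IsApproximated e τ σ g₀ w wx G B) (n : ℕ) : Continuous (dx (G n)) :=
  (contDiff_dx (h.isPotential n).contDiff).continuous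

theorem memLp_dx_slice (h : IsApproximated e τ σ g₀ w wx G B) (n : ℕ) (L t : ℝ) :
    MemLp (fun x => dx (G n) (t, x)) 2 (leb L) :=
  memLp_of_continuous _ ((h.continuous_dx n).comp (continuous_const.prodMk continuous_id))

theorem memLp_slice (h : IsApproximated e τ σ g₀ w wx G B) {t : ℝ} (ht : τ ≤ t) :
    MemLp (fun x => w (t, x)) 2 (leb (e t)) :=
  MemLp.of_eLpNorm_sub_ne_top (h.memLp_dx_slice 0 _ t)
    (h.stronglyMeasurable.comp_measurable measurable_prodMk_left).aestronglyMeasurable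
    (ne_top_of_le_ne_top (h.bound_ne_top 0) (h.slice_le 0 t ht))

theorem memLp_x (h : IsApproximated e τ σ g₀ w wx G B) :
    MemLp wx 2 (volume.restrict (movingDomain e (Ioi τ))) :=
  MemLp.of_eLpNorm_sub_ne_top (h.memLp_dx_dx 0) h.stronglyMeasurable_x.aestronglyMeasurable
    (ne_top_of_le_ne_top (h.bound_ne_top 0) (h.dx_dx_le 0))

/-- The slice bound is uniform in time, so integrating its square over (τ, T) costs the factor T -
τ. -/
theorem eLpNorm_sub_le_mul (h : IsApproximated e τ σ g₀ w wx G B) (he : Continuous e) (n : ℕ) :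
    eLpNorm (fun z => dx (G n) z - w z) 2 (volume.restrict (movingDomain e (Ioo τ T))) ≤
      B n * ENNReal.ofReal √(T - τ) := by
  have hm : AEStronglyMeasurable (fun z => dx (G n) z - w z)
      (volume.restrict (movingDomain e (Ioo τ T))) :=
    (h.continuous_dx n).aestronglyMeasurable.sub h.stronglyMeasurable.aestronglyMeasurable
  rw [← ENNReal.pow_le_pow_left_iff two_ne_zero, eLpNorm_movingDomain_sq he measurableSet_Ioo hm]
  have h1 : ∫⁻ t in Ioo τ T, eLpNorm (fun x => dx (G n) (t, x) - w (t, x)) 2 (leb (e t)) ^ 2 ≤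
      ∫⁻ _ in Ioo τ T, B n ^ 2 :=
    setLIntegral_mono' measurableSet_Ioo fun t ht =>
      pow_le_pow_left₀ zero_le (h.slice_le n t ht.1.le) 2
  refine h1.trans_eq ?_
  rw [setLIntegral_const, Real.volume_Ioo, mul_pow, ← ENNReal.ofReal_pow (Real.sqrt_nonneg _)]
  congr 1
  rcases le_total 0 (T - τ) with hT | hT
  · rw [Real.sq_sqrt hT]
  · rw [Real.sqrt_eq_zero_of_nonpos hT, ENNReal.ofReal_of_nonpos hT]
    simp

theorem memLp (h : IsApproximated e τ σ g₀ w wx G B) (he : Continuous e) :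
    MemLp w 2 (volume.restrict (movingDomain e (Ioo τ T))) :=
  MemLp.of_eLpNorm_sub_ne_top (memLp_movingDomain_of_continuous he (h.continuous_dx 0))
    h.stronglyMeasurable.aestronglyMeasurable
    (ne_top_of_le_ne_top (ENNReal.mul_ne_top (h.bound_ne_top 0) ENNReal.ofReal_ne_top)
      (h.eLpNorm_sub_le_mul he 0))

theorem tendsto_zero_of_le (h : IsApproximated e τ σ g₀ w wx G B) {f : ℕ → ℝ≥0∞}
    (hf : ∀ n, f n ≤ B n) : Tendsto f atTop (𝓝 0) :=
  tendsto_of_tendsto_of_tendsto_of_le_of_le tendsto_const_nhds h.tendsto_bound (fun _ => zero_le) hf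

theorem tendsto_eLpNorm_sub (h : IsApproximated e τ σ g₀ w wx G B) (he : Continuous e) :
    Tendsto (fun n => eLpNorm (fun z => dx (G n) z - w z) 2
      (volume.restrict (movingDomain e (Ioo τ T)))) atTop (𝓝 0) := by
  have h0 : Tendsto (fun n => B n * ENNReal.ofReal √(T - τ)) atTop (𝓝 0) := by
    simpa using ENNReal.Tendsto.mul_const h.tendsto_bound (Or.inr ENNReal.ofReal_ne_top)
  exact tendsto_of_tendsto_of_tendsto_of_le_of_le tendsto_const_nhds h0 (fun _ => zero_le)
    fun n => h.eLpNorm_sub_le_mul he n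

/-- A uniform limit of continuous curves. The lower bound c on the thickness keeps the constants of
the rescaling to (0,1) uniform in time. -/
theorem continuousInL2 (h : IsApproximated e τ σ g₀ w wx G B) (he : Continuous e) {c : ℝ} (hc : 0 < c)
    (hce : ∀ t, τ ≤ t → c ≤ e t) : ContinuousInL2 e (Ici τ) fun t x => w (t, x) := by
  have hpos : ∀ t, τ ≤ t → 0 < e t := fun t ht => hc.trans_le (hce t ht)
  have hs : 0 < c ^ (1 / 2 : ℝ) := Real.rpow_pos_of_pos hc _
  have hG : ∀ n, ContinuousInL2 e (Ici τ) fun t x => dx (G n) (t, x) := fun n =>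
    continuousInL2_of_continuous he (h.continuous_dx n)
  have hmem : ∀ t ∈ Ici τ, MemLp (fun y => w (t, y * e t)) 2 (leb 1) := fun t ht =>
    (memLp_leb_iff (hpos t ht) _).1 (h.memLp_slice ht)
  have hle : ∀ n t, τ ≤ t → eLpNorm (fun y => dx (G n) (t, y * e t) - w (t, y * e t)) 2 (leb 1) ≤
      (ENNReal.ofReal (c ^ (1 / 2 : ℝ)))⁻¹ * B n := by
    intro n t ht
    have h1 := h.slice_le n t ht
    rw [eLpNorm_leb (hpos t ht)] at h1
    have h2 : ENNReal.ofReal (c ^ (1 / 2 : ℝ)) ≤ ENNReal.ofReal (e t ^ (1 / 2 : ℝ)) :=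
      ENNReal.ofReal_le_ofReal (Real.rpow_le_rpow hc.le (hce t ht) (by norm_num))
    rw [← ENNReal.div_eq_inv_mul, ENNReal.le_div_iff_mul_le (Or.inl (by simpa using hs))
      (Or.inl ENNReal.ofReal_ne_top), mul_comm]
    exact (mul_le_mul_left h2 _).trans h1
  have hlim : Tendsto (fun n => (ENNReal.ofReal (c ^ (1 / 2 : ℝ)))⁻¹ * B n) atTop (𝓝 0) := by
    have := ENNReal.Tendsto.const_mul h.tendsto_bound (a := (ENNReal.ofReal (c ^ (1 / 2 : ℝ)))⁻¹)
      (Or.inr (by simpa using hs))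
    simpa using this
  refine ⟨h.stronglyMeasurable.aestronglyMeasurable, hmem, fun t₀ ht₀ => ?_⟩
  rw [ENNReal.tendsto_nhds_zero]
  intro ε hε
  have hε3 : 0 < ε / 3 := ENNReal.div_pos hε.ne' (by norm_num)
  obtain ⟨n, hn⟩ := ((ENNReal.tendsto_nhds_zero.1 hlim) _ hε3).exists
  filter_upwards [(ENNReal.tendsto_nhds_zero.1 ((hG n).tendsto t₀ ht₀)) _ hε3, self_mem_nhdsWithin]
    with t h1 ht
  have a1 := ((hG n).memLp t ht).sub (hmem t ht)
  have a2 := ((hG n).memLp t ht).sub ((hG n).memLp t₀ ht₀)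
  have a3 := ((hG n).memLp t₀ ht₀).sub (hmem t₀ ht₀)
  have e1 : (fun y => w (t, y * e t) - w (t₀, y * e t₀)) =
      ((fun y => dx (G n) (t, y * e t)) - fun y => dx (G n) (t₀, y * e t₀)) -
      ((fun y => dx (G n) (t, y * e t)) - fun y => w (t, y * e t)) +
      ((fun y => dx (G n) (t₀, y * e t₀)) - fun y => w (t₀, y * e t₀)) := by
    ext y
    simp only [Pi.add_apply, Pi.sub_apply]
    ring
  rw [e1]
  refine (eLpNorm_add_le (a2.sub a1).1 a3.1 (by norm_num)).trans ?_
  refine (add_le_add ((eLpNorm_sub_le a2.1 a1.1 (by norm_num)).trans (add_le_add h1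
    ((hle n t ht).trans hn))) ((hle n t₀ ht₀).trans hn)).trans_eq ?_
  exact ENNReal.add_thirds ε

/-- In the limit the residual drops out of the energy inequality, and the initial norm has constant
1. -/
theorem eLpNorm_slice_le (h : IsApproximated e τ σ g₀ w wx G B) (hE : IsSmoothExtension e E vbar τ)
    (hvb : 0 < vbar) (hσ : 0 < σ) (hg₀ : MemLp g₀ 2 (leb (e τ))) {t : ℝ} (ht : τ ≤ t) :
    eLpNorm (fun x => w (t, x)) 2 (leb (e t)) ≤ eLpNorm g₀ 2 (leb (e τ)) := by
  have h1 := tendsto_eLpNorm_of_sub (fun n => h.memLp_dx_slice n _ t) (h.memLp_slice ht)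
    (h.tendsto_zero_of_le fun n => h.slice_le n t ht)
  have h2 := tendsto_eLpNorm_of_sub (fun n => h.memLp_dx_slice n _ τ) hg₀
    (h.tendsto_zero_of_le h.initial_le)
  have h3 := h.tendsto_zero_of_le h.residual_le
  have h4 := (ENNReal.Tendsto.pow (n := 2) h2).add (ENNReal.Tendsto.const_mul
    (ENNReal.Tendsto.pow (n := 2) h3) (a := ENNReal.ofReal σ⁻¹) (Or.inr ENNReal.ofReal_ne_top))
  rw [← ENNReal.pow_le_pow_left_iff two_ne_zero]
  have h5 := le_of_tendsto_of_tendsto' (ENNReal.Tendsto.pow (n := 2) h1) h4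
    fun n => (h.isPotential n).eLpNorm_slice_sq_le hE hvb hσ ht
  simpa using h5

/-- For each approximation, ∂ₜG = σ∂ₓₓG + r is inserted in the identity for potentials. All terms
pass to the limit by L² convergence, and the one with r vanishes. -/
theorem integral_identity (h : IsApproximated e τ σ g₀ w wx G B) (hE : IsSmoothExtension e E vbar τ)
    (hg₀ : MemLp g₀ 2 (leb (e τ))) {v vt vx : ℝ → ℝ → ℝ} (hv : IsRegular e τ T v vt vx) (hT : τ < T)
    (lam : ℝ) :
    (∫ z in movingDomain e (Ioo τ T),
        w z * (Real.exp (-lam * (z.1 - τ)) * (vt z.1 z.2 - lam * v z.1 z.2))) -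
      σ * ∫ z in movingDomain e (Ioo τ T), wx z * (Real.exp (-lam * (z.1 - τ)) * vx z.1 z.2) =
    Real.exp (-lam * (T - τ)) * (∫ x in Ioo 0 (e T), w (T, x) * v T x) -
      ∫ x in Ioo 0 (e τ), g₀ x * v τ x := by
  have he := hE.continuous
  have hpos : ∀ t, τ ≤ t → 0 < e t := fun t ht => hE.eq t ht ▸ hE.pos t
  have hk : Continuous fun z : ℝ × ℝ => Real.exp (-lam * (z.1 - τ)) := by fun_prop
  have hq : MemLp (fun z : ℝ × ℝ => Real.exp (-lam * (z.1 - τ)) * (vt z.1 z.2 - lam * v z.1 z.2)) 2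
      (volume.restrict (movingDomain e (Ioo τ T))) :=
    MemLp.continuous_mul_movingDomain he hk (hv.memLp_t.sub (hv.memLp.const_mul lam))
  have hqx : MemLp (fun z : ℝ × ℝ => Real.exp (-lam * (z.1 - τ)) * vx z.1 z.2) 2
      (volume.restrict (movingDomain e (Ioo τ T))) :=
    MemLp.continuous_mul_movingDomain he hk hv.memLp_x
  have hsub : volume.restrict (movingDomain e (Ioo τ T)) ≤ volume.restrict (movingDomain e (Ioi τ)) :=
    Measure.restrict_mono (movingDomain_mono fun t ht => ht.1) le_rfl
  have hdx : ∀ n, MemLp (dx (G n)) 2 (volume.restrict (movingDomain e (Ioo τ T))) := fun n =>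
    memLp_movingDomain_of_continuous he (h.continuous_dx n)
  have hres : ∀ n, MemLp (residual σ (G n)) 2 (volume.restrict (movingDomain e (Ioo τ T))) := fun n =>
    memLp_movingDomain_of_continuous he (continuous_residual (h.isPotential n).contDiff)
  have l1 := tendsto_integral_mul_of_eLpNorm hdx (h.memLp he) hq (h.tendsto_eLpNorm_sub he)
  have l2 := tendsto_integral_mul_of_eLpNorm (fun n => (h.memLp_dx_dx n).mono_measure hsub)
    (h.memLp_x.mono_measure hsub) hqx (h.tendsto_zero_of_le fun n =>
      (eLpNorm_mono_measure _ hsub).trans (h.dx_dx_le n))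
  have l3 := tendsto_integral_mul_of_eLpNorm (f' := fun _ => 0) hres (by simp) hqx
    (h.tendsto_zero_of_le fun n => by
      simpa using (eLpNorm_mono_measure _ hsub).trans (h.residual_le n))
  have l4 := tendsto_integral_mul_of_eLpNorm (fun n => h.memLp_dx_slice n _ T) (h.memLp_slice hT.le)
    (hv.continuous.memLp_slice (right_mem_Icc.2 hT.le) (hpos T hT.le))
    (h.tendsto_zero_of_le fun n => h.slice_le n T hT.le)
  have l5 := tendsto_integral_mul_of_eLpNorm (fun n => h.memLp_dx_slice n _ τ) hg₀
    (hv.continuous.memLp_slice (left_mem_Icc.2 hT.le) (hpos τ le_rfl))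
    (h.tendsto_zero_of_le h.initial_le)
  simp only [zero_mul, integral_zero] at l3
  have l6 := (l1.sub (l2.const_mul σ)).sub l3
  rw [sub_zero] at l6
  refine tendsto_nhds_unique l6 (((l4.const_mul (Real.exp (-lam * (T - τ)))).sub l5).congr fun n => ?_)
  rw [← (h.isPotential n).integral_identity hE hv hT lam]
  have i1 : IntegrableOn (fun z : ℝ × ℝ => dx (G n) z *
      (Real.exp (-lam * (z.1 - τ)) * (vt z.1 z.2 - lam * v z.1 z.2))) (movingDomain e (Ioo τ T)) :=
    (hdx n).integrable_mul hq
  have i2 : IntegrableOn (fun z : ℝ × ℝ => σ * (dx (dx (G n)) z *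
      (Real.exp (-lam * (z.1 - τ)) * vx z.1 z.2))) (movingDomain e (Ioo τ T)) :=
    (((h.memLp_dx_dx n).mono_measure hsub).integrable_mul hqx).const_mul σ
  have i3 : IntegrableOn (fun z : ℝ × ℝ => residual σ (G n) z *
      (Real.exp (-lam * (z.1 - τ)) * vx z.1 z.2)) (movingDomain e (Ioo τ T)) :=
    (hres n).integrable_mul hqx
  have i4 : IntegrableOn (fun z : ℝ × ℝ => dx (G n) z *
      (Real.exp (-lam * (z.1 - τ)) * (vt z.1 z.2 - lam * v z.1 z.2)) - σ * (dx (dx (G n)) z *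
      (Real.exp (-lam * (z.1 - τ)) * vx z.1 z.2))) (movingDomain e (Ioo τ T)) := i1.sub i2
  rw [← integral_const_mul, ← integral_sub i1 i2, ← integral_sub i4 i3]
  refine integral_congr_ae (Eventually.of_forall fun z => ?_)
  simp only [residual]
  ring

/-- `wx` is the space derivative of `w`, tested with functions of zero trace. -/
theorem integral_mul_eq_neg (h : IsApproximated e τ σ g₀ w wx G B) (he : Continuous e)
    (hpos : ∀ t, τ ≤ t → 0 < e t) {k : ℝ → ℝ} (hk : Continuous k) {u p : ℝ → ℝ → ℝ}
    (hu : MemLp (fun z : ℝ × ℝ => u z.1 z.2) 2 (volume.restrict (movingDomain e (Ioo τ T))))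
    (hp : MemLp (fun z : ℝ × ℝ => p z.1 z.2) 2 (volume.restrict (movingDomain e (Ioo τ T))))
    (hup : ∀ᵐ t ∂(volume.restrict (Ioo τ T)), IsWeakDeriv (e t) (u t) (p t))
    (h0 : ∀ᵐ t ∂(volume.restrict (Ioo τ T)), HasTrace (e t) (u t) 0 0)
    (h1 : ∀ᵐ t ∂(volume.restrict (Ioo τ T)), HasTrace (e t) (u t) (e t) 0) :
    ∫ z in movingDomain e (Ioo τ T), w z * (k z.1 * p z.1 z.2) =
      - ∫ z in movingDomain e (Ioo τ T), wx z * (k z.1 * u z.1 z.2) := by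
  have hk' : Continuous fun z : ℝ × ℝ => k z.1 := hk.comp continuous_fst
  have hku := MemLp.continuous_mul_movingDomain he hk' hu
  have hkp := MemLp.continuous_mul_movingDomain he hk' hp
  have hsub : volume.restrict (movingDomain e (Ioo τ T)) ≤ volume.restrict (movingDomain e (Ioi τ)) :=
    Measure.restrict_mono (movingDomain_mono fun t ht => ht.1) le_rfl
  have hdx : ∀ n, MemLp (dx (G n)) 2 (volume.restrict (movingDomain e (Ioo τ T))) := fun n =>
    memLp_movingDomain_of_continuous he (h.continuous_dx n)
  have hdxx : ∀ n, MemLp (dx (dx (G n))) 2 (volume.restrict (movingDomain e (Ioo τ T))) := fun n =>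
    (h.memLp_dx_dx n).mono_measure hsub
  have l1 := tendsto_integral_mul_of_eLpNorm hdx (h.memLp he) hkp (h.tendsto_eLpNorm_sub he)
  have l2 := tendsto_integral_mul_of_eLpNorm hdxx (h.memLp_x.mono_measure hsub) hku
    (h.tendsto_zero_of_le fun n => (eLpNorm_mono_measure _ hsub).trans (h.dx_dx_le n))
  refine tendsto_nhds_unique l1 (l2.neg.congr fun n => ?_)
  have i1 : IntegrableOn (fun z : ℝ × ℝ => dx (G n) z * (k z.1 * p z.1 z.2))
      (movingDomain e (Ioo τ T)) := (hdx n).integrable_mul hkp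
  have i2 : IntegrableOn (fun z : ℝ × ℝ => dx (dx (G n)) z * (k z.1 * u z.1 z.2))
      (movingDomain e (Ioo τ T)) := (hdxx n).integrable_mul hku
  rw [setIntegral_movingDomain he measurableSet_Ioo i1, setIntegral_movingDomain he measurableSet_Ioo i2,
    ← integral_neg]
  refine integral_congr_ae ?_
  filter_upwards [hup, h0, h1, MovingHeat.memLp_slice he measurableSet_Ioo hu,
    MovingHeat.memLp_slice he measurableSet_Ioo hp, ae_restrict_mem measurableSet_Ioo]
    with t q1 q2 q3 q4 q5 ht
  have hG := (h.isPotential n).contDiff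
  have key := q1.integral_mul_of_hasTrace (hpos t ht.1.le) q4 q5 q2 q3
    ((contDiff_slice (contDiff_dx hG) t).of_le (by simp))
  rw [deriv_slice_dx (contDiff_dx hG) t] at key
  have e1 : ∀ x, dx (G n) (t, x) * (k t * p t x) = k t * (dx (G n) (t, x) * p t x) := fun x => by ring
  have e2 : ∀ x, dx (dx (G n)) (t, x) * (k t * u t x) = k t * (dx (dx (G n)) (t, x) * u t x) :=
    fun x => by ring
  simp only [e1, e2, integral_const_mul]
  rw [key]
  ring

end IsApproximated

end Limit

theorem ContinuousInL2.continuous_mul {e : ℝ → ℝ} {I : Set ℝ} {f : ℝ → ℝ → ℝ}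
    (hf : ContinuousInL2 e I f) {k : ℝ → ℝ} (hk : Continuous k) :
    ContinuousInL2 e I fun t x => k t * f t x := by
  refine ⟨(hk.comp continuous_fst).aestronglyMeasurable.mul hf.1, fun t ht => (hf.2 t ht).const_mul _,
    fun t₀ ht₀ => ?_⟩
  have h1 : Tendsto (fun t => ‖k t‖ₑ * eLpNorm (fun y => f t (y * e t) - f t₀ (y * e t₀)) 2 (leb 1) +
      ‖k t - k t₀‖ₑ * eLpNorm (fun y => f t₀ (y * e t₀)) 2 (leb 1)) (𝓝[I] t₀) (𝓝 0) := by
    have a1 : Tendsto (fun t => ‖k t‖ₑ) (𝓝[I] t₀) (𝓝 ‖k t₀‖ₑ) :=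
      (hk.enorm.tendsto t₀).mono_left nhdsWithin_le_nhds
    have a2 : Tendsto (fun t => ‖k t - k t₀‖ₑ) (𝓝[I] t₀) (𝓝 0) := by
      have : Tendsto (fun t => ‖k t - k t₀‖ₑ) (𝓝 t₀) (𝓝 ‖k t₀ - k t₀‖ₑ) :=
        (hk.sub continuous_const).enorm.tendsto t₀
      rw [sub_self, enorm_zero] at this
      exact this.mono_left nhdsWithin_le_nhds
    have b1 := ENNReal.Tendsto.mul a1 (Or.inr ENNReal.zero_ne_top) (hf.3 t₀ ht₀)
      (Or.inr enorm_ne_top)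
    have b2 := ENNReal.Tendsto.mul_const a2 (b := eLpNorm (fun y => f t₀ (y * e t₀)) 2 (leb 1))
      (Or.inr (hf.2 t₀ ht₀).2.ne)
    simpa using b1.add b2
  refine tendsto_of_tendsto_of_tendsto_of_le_of_le' tendsto_const_nhds h1
    (Eventually.of_forall fun _ => zero_le) ?_
  filter_upwards [self_mem_nhdsWithin] with t ht
  have e1 : (fun y => k t * f t (y * e t) - k t₀ * f t₀ (y * e t₀)) =
      k t • ((fun y => f t (y * e t)) - fun y => f t₀ (y * e t₀)) +
        (k t - k t₀) • fun y => f t₀ (y * e t₀) := by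
    ext y
    simp only [Pi.add_apply, Pi.smul_apply, Pi.sub_apply, smul_eq_mul]
    ring
  rw [e1]
  have d := (hf.2 t ht).sub (hf.2 t₀ ht₀)
  refine (eLpNorm_add_le (d.1.const_smul _) ((hf.2 t₀ ht₀).1.const_smul _) (by norm_num)).trans_eq ?_
  rw [eLpNorm_const_smul, eLpNorm_const_smul]
  rfl

/-! ### Functionals on H¹ given by two square-integrable coefficients. -/

section Dual

variable {L : ℝ} {a b : ℝ → ℝ}

open Classical in
/-- The functional `z ↦ ⟨a, z⟩ + ⟨b, z'⟩` on `H¹(0, L)`, for square-integrable `a` and `b`. -/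
def dualPair (L : ℝ) (a b : ℝ → ℝ) : StrongDual ℝ (H1 L) :=
  if h : MemLp a 2 (leb L) ∧ MemLp b 2 (leb L) then
    (innerSL ℝ (WithLp.toLp 2 (h.1.toLp, h.2.toLp) :
      WithLp 2 (Lp ℝ 2 (leb L) × Lp ℝ 2 (leb L)))).comp (H1 L).subtypeL
  else 0

theorem dualPair_ofSmooth (ha : MemLp a 2 (leb L)) (hb : MemLp b 2 (leb L)) {φ : ℝ → ℝ}
    (hφ : ContDiff ℝ ∞ φ) :
    dualPair L a b (H1.ofSmooth L φ hφ) = ∫ x in Ioo 0 L, a x * φ x + b x * deriv φ x := by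
  have hφ0 := memLp_of_continuous L hφ.continuous
  have hφ1 := memLp_of_continuous L (hφ.continuous_deriv (by simp))
  have hi : ∀ {f g : ℝ → ℝ} (hf : MemLp f 2 (leb L)) (hg : MemLp g 2 (leb L)),
      inner ℝ hf.toLp hg.toLp = ∫ x in Ioo 0 L, f x * g x := by
    intro f g hf hg
    rw [L2.inner_def]
    refine integral_congr_ae ?_
    filter_upwards [hf.coeFn_toLp, hg.coeFn_toLp] with x h1 h2
    rw [h1, h2]
    simp [mul_comm]
  have i1 : IntegrableOn (fun x => a x * φ x) (Ioo 0 L) := ha.integrable_mul hφ0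
  have i2 : IntegrableOn (fun x => b x * deriv φ x) (Ioo 0 L) := hb.integrable_mul hφ1
  rw [dualPair, dif_pos ⟨ha, hb⟩, integral_add i1 i2, ← hi ha hφ0, ← hi hb hφ1]
  exact WithLp.prod_inner_apply _ _

/-- No integrability is assumed, thanks to the default value 0 of `dualPair`. The bound can
therefore be used at every time, although the space derivative is known to be square-integrable on
almost every slice only. -/
theorem enorm_dualPair_sq_le (L : ℝ) (a b : ℝ → ℝ) :
    ‖dualPair L a b‖ₑ ^ 2 ≤ eLpNorm a 2 (leb L) ^ 2 + eLpNorm b 2 (leb L) ^ 2 := by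
  by_cases h : MemLp a 2 (leb L) ∧ MemLp b 2 (leb L)
  · set z : WithLp 2 (Lp ℝ 2 (leb L) × Lp ℝ 2 (leb L)) := WithLp.toLp 2 (h.1.toLp, h.2.toLp) with hz
    have h1 : ‖dualPair L a b‖ ≤ ‖z‖ := by
      rw [dualPair, dif_pos h]
      refine ContinuousLinearMap.opNorm_le_bound _ (norm_nonneg _) fun y => ?_
      exact norm_inner_le_norm (𝕜 := ℝ) z (y : WithLp 2 (Lp ℝ 2 (leb L) × Lp ℝ 2 (leb L)))
    have h2 : ‖z‖ ^ 2 = ‖h.1.toLp‖ ^ 2 + ‖h.2.toLp‖ ^ 2 := WithLp.prod_norm_sq_eq_of_L2 z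
    rw [← Lp.enorm_toLp h.1, ← Lp.enorm_toLp h.2, ← ofReal_norm, ← ofReal_norm, ← ofReal_norm,
      ← ENNReal.ofReal_pow (norm_nonneg _), ← ENNReal.ofReal_pow (norm_nonneg _),
      ← ENNReal.ofReal_pow (norm_nonneg _), ← ENNReal.ofReal_add (sq_nonneg _) (sq_nonneg _), ← h2]
    exact ENNReal.ofReal_le_ofReal (pow_le_pow_left₀ (norm_nonneg _) h1 2)
  · have h0 : ‖dualPair L a b‖ ≤ 0 := by
      rw [dualPair, dif_neg h]
      exact ContinuousLinearMap.opNorm_le_bound _ le_rfl fun y => by simp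
    rw [← ofReal_norm, ENNReal.ofReal_of_nonpos h0, zero_pow two_ne_zero]
    exact zero_le

end Dual

theorem stronglyMeasurable_integral_slice {e : ℝ → ℝ} (he : Continuous e) {f : ℝ × ℝ → ℝ}
    (hf : StronglyMeasurable f) : StronglyMeasurable fun t => ∫ x in Ioo 0 (e t), f (t, x) := by
  have h := (hf.indicator (measurableSet_movingDomain he MeasurableSet.univ)).integral_prod_right'
    (ν := (volume : Measure ℝ))
  rw [integral_slice_indicator] at h
  simpa using h

/-! ### The damped limit is a weak solution. -/

section Solution

variable {e E : ℝ → ℝ} {vbar τ σ lam : ℝ} {g₀ : ℝ → ℝ} {w wx : ℝ × ℝ → ℝ} {G : ℕ → ℝ × ℝ → ℝ}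
  {B : ℕ → ℝ≥0∞}

namespace IsApproximated

/-- In the limiting identity the terminal term vanishes, and the Neumann traces of the test function
allow the term with wx to be integrated by parts back onto w. -/
theorem weakFormulation (h : IsApproximated e τ σ g₀ w wx G B) (hE : IsSmoothExtension e E vbar τ)
    (hg₀ : MemLp g₀ 2 (leb (e τ))) (lam : ℝ) :
    WeakFormulation e τ σ lam g₀ fun t x => Real.exp (-lam * (t - τ)) * w (t, x) := by
  intro T hT v vt vx vxx hv
  have he := hE.continuous
  have hpos : ∀ t, τ ≤ t → 0 < e t := fun t ht => hE.eq t ht ▸ hE.pos t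
  have hk : Continuous fun t : ℝ => Real.exp (-lam * (t - τ)) := by fun_prop
  have hk' : Continuous fun z : ℝ × ℝ => Real.exp (-lam * (z.1 - τ)) := by fun_prop
  have id1 := h.integral_identity hE hg₀ hv.isRegular hT lam
  have id2 := h.integral_mul_eq_neg he hpos hk hv.memLp_x hv.memLp_xx hv.weakDeriv_xx
    hv.neumann_left hv.neumann_right
  have i1 : IntegrableOn (fun z : ℝ × ℝ =>
      w z * (Real.exp (-lam * (z.1 - τ)) * (vt z.1 z.2 - lam * v z.1 z.2)))
      (movingDomain e (Ioo τ T)) :=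
    (h.memLp he).integrable_mul (MemLp.continuous_mul_movingDomain he hk'
      (hv.memLp_t.sub (hv.memLp.const_mul lam)))
  have i2 : IntegrableOn (fun z : ℝ × ℝ =>
      w z * (Real.exp (-lam * (z.1 - τ)) * vxx z.1 z.2)) (movingDomain e (Ioo τ T)) :=
    (h.memLp he).integrable_mul (MemLp.continuous_mul_movingDomain he hk' hv.memLp_xx)
  have hterm : ∫ x in Ioo 0 (e T), w (T, x) * v T x = 0 := by
    refine integral_eq_zero_of_ae ?_
    filter_upwards [hv.terminal] with x hx
    simp [hx]
  have i3 : IntegrableOn (fun z : ℝ × ℝ => Real.exp (-lam * (z.1 - τ)) * w z *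
      (vt z.1 z.2 + σ * vxx z.1 z.2 - lam * v z.1 z.2)) (movingDomain e (Ioo τ T)) := by
    refine (i1.add (i2.const_mul σ)).congr (Eventually.of_forall fun z => ?_)
    simp only [Pi.add_apply]
    ring
  have e1 := setIntegral_movingDomain he measurableSet_Ioo i3
  have e2 : ∫ z in movingDomain e (Ioo τ T), Real.exp (-lam * (z.1 - τ)) * w z *
      (vt z.1 z.2 + σ * vxx z.1 z.2 - lam * v z.1 z.2) =
      (∫ z in movingDomain e (Ioo τ T),
        w z * (Real.exp (-lam * (z.1 - τ)) * (vt z.1 z.2 - lam * v z.1 z.2))) +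
      σ * ∫ z in movingDomain e (Ioo τ T), w z * (Real.exp (-lam * (z.1 - τ)) * vxx z.1 z.2) := by
    rw [← integral_const_mul, ← integral_add i1 (i2.const_mul σ)]
    refine integral_congr_ae (Eventually.of_forall fun z => ?_)
    simp only
    ring
  rw [hterm, mul_zero, zero_sub] at id1
  rw [← e1, e2, id2]
  linarith

/-- With k = exp(-λ(t-τ)), the time derivative is represented by φ ↦ -λk∫wφ - σk∫wx φ', the boundary
terms being contained in the weak form. It is square-integrable up to infinite time because w is
bounded in L² while k decays, and because wx is square-integrable on the whole half-line. -/
theorem timeDerivInDual (h : IsApproximated e τ σ g₀ w wx G B) (hE : IsSmoothExtension e E vbar τ)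
    (hvb : 0 < vbar) (hσ : 0 < σ) (hlam : 0 < lam) (hg₀ : MemLp g₀ 2 (leb (e τ))) :
    TimeDerivInDual e τ fun t x => Real.exp (-lam * (t - τ)) * w (t, x) := by
  have he := hE.continuous
  set k : ℝ → ℝ := fun t => Real.exp (-lam * (t - τ)) with hkdef
  have hk : Continuous k := by fun_prop
  have hkm : StronglyMeasurable fun z : ℝ × ℝ => k z.1 := (hk.comp continuous_fst).stronglyMeasurable
  set a : ℝ × ℝ → ℝ := fun z => -(lam * k z.1) * w z with ha
  set b : ℝ × ℝ → ℝ := fun z => -(σ * k z.1) * wx z with hb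
  have ham : StronglyMeasurable a := ((hkm.const_mul lam).neg).mul h.stronglyMeasurable
  have hbm : StronglyMeasurable b := ((hkm.const_mul σ).neg).mul h.stronglyMeasurable_x
  have hslx := MovingHeat.memLp_slice he measurableSet_Ioi h.memLp_x
  have hF : ∀ᵐ t ∂(volume.restrict (Ioi τ)), ∀ (φ : ℝ → ℝ) (hφ : ContDiff ℝ ∞ φ),
      dualPair (e t) (fun x => a (t, x)) (fun x => b (t, x)) (H1.ofSmooth (e t) φ hφ) =
        ∫ x in Ioo 0 (e t), a (t, x) * φ x + b (t, x) * deriv φ x := by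
    filter_upwards [hslx, ae_restrict_mem measurableSet_Ioi] with t ht1 ht2 φ hφ
    exact dualPair_ofSmooth (a := fun x => a (t, x)) (b := fun x => b (t, x))
      ((h.memLp_slice (le_of_lt ht2)).const_mul (-(lam * k t)))
      (ht1.const_mul (-(σ * k t))) hφ
  refine ⟨fun t => dualPair (e t) (fun x => a (t, x)) (fun x => b (t, x)), fun φ hφ => ?_, ?_,
    fun φ hφ hφc hφs => ?_⟩
  · have hd : Continuous (deriv φ) := hφ.continuous_deriv (by simp)
    have hm : StronglyMeasurable fun z : ℝ × ℝ => a z * φ z.2 + b z * deriv φ z.2 :=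
      (ham.mul (hφ.continuous.comp continuous_snd).stronglyMeasurable).add
        (hbm.mul (hd.comp continuous_snd).stronglyMeasurable)
    refine (stronglyMeasurable_integral_slice he hm).aestronglyMeasurable.congr ?_
    filter_upwards [hF] with t ht
    exact (ht φ hφ).symm
  · have hexp : ∫⁻ t in Ioi τ, ENNReal.ofReal (k t ^ 2) < ⊤ := by
      refine IntegrableOn.setLIntegral_lt_top ?_
      have h1 := (exp_neg_integrableOn_Ioi τ (b := 2 * lam) (by linarith)).const_mul
        (Real.exp (2 * lam * τ))
      refine h1.congr (Eventually.of_forall fun t => ?_)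
      simp only [hkdef]
      rw [← Real.exp_add, sq, ← Real.exp_add]
      congr 1
      ring
    have hw := h.memLp_x.2
    have hwsq := ENNReal.pow_lt_top hw (n := 2)
    rw [eLpNorm_movingDomain_sq he measurableSet_Ioi h.memLp_x.1] at hwsq
    have hbd : ∀ t ∈ Ioi τ, ‖dualPair (e t) (fun x => a (t, x)) (fun x => b (t, x))‖ₑ ^ 2 ≤
        ENNReal.ofReal (k t ^ 2) * (ENNReal.ofReal (lam ^ 2) * eLpNorm g₀ 2 (leb (e τ)) ^ 2) +
        ENNReal.ofReal (σ ^ 2) * eLpNorm (fun x => wx (t, x)) 2 (leb (e t)) ^ 2 := by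
      intro t ht
      have hk1 : k t ^ 2 ≤ 1 := by
        have : k t ≤ 1 := Real.exp_le_one_iff.2 (by nlinarith [mem_Ioi.1 ht])
        exact pow_le_one₀ (Real.exp_pos _).le this
      refine (enorm_dualPair_sq_le _ _ _).trans (add_le_add ?_ ?_)
      · have e1 : (fun x => a (t, x)) = (-(lam * k t)) • fun x => w (t, x) := rfl
        rw [e1, eLpNorm_const_smul, mul_pow, ← mul_assoc, ← ENNReal.ofReal_mul (sq_nonneg _),
          ← ofReal_norm, ← ENNReal.ofReal_pow (norm_nonneg _), norm_neg, Real.norm_eq_abs, sq_abs]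
        refine mul_le_mul' (ENNReal.ofReal_le_ofReal (by rw [mul_pow, mul_comm])) ?_
        exact pow_le_pow_left₀ zero_le (h.eLpNorm_slice_le hE hvb hσ hg₀ (le_of_lt ht)) 2
      · have e1 : (fun x => b (t, x)) = (-(σ * k t)) • fun x => wx (t, x) := rfl
        rw [e1, eLpNorm_const_smul, mul_pow,
          ← ofReal_norm, ← ENNReal.ofReal_pow (norm_nonneg _), norm_neg, Real.norm_eq_abs, sq_abs]
        refine mul_le_mul' (ENNReal.ofReal_le_ofReal ?_) le_rfl
        rw [mul_pow]
        nlinarith [sq_nonneg σ]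
    refine (setLIntegral_mono' measurableSet_Ioi hbd).trans_lt ?_
    have hkm2 : Measurable fun t => ENNReal.ofReal (k t ^ 2) :=
      (hk.pow 2).measurable.ennreal_ofReal
    rw [lintegral_add_left (hkm2.mul_const _), lintegral_mul_const _ hkm2,
      lintegral_const_mul' _ _ ENNReal.ofReal_ne_top]
    exact ENNReal.add_lt_top.2 ⟨ENNReal.mul_lt_top hexp (ENNReal.mul_lt_top ENNReal.ofReal_lt_top
      (ENNReal.pow_lt_top hg₀.2)), ENNReal.mul_lt_top ENNReal.ofReal_lt_top hwsq⟩
  -- Beyond the support of φ, the half-line reduces to (τ, T), and both endpoint terms of the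
  -- limiting identity vanish. That identity imposes no boundary condition in x, so φ itself may be
  -- inserted.
  · obtain ⟨T, hT, hTφ⟩ : ∃ T, τ < T ∧ ∀ t x, T ≤ t → φ (t, x) = 0 := by
      obtain ⟨M, hM⟩ := (hφc.isCompact.image continuous_fst).bddAbove
      refine ⟨max (M + 1) (τ + 1), by have := le_max_right (M + 1) (τ + 1); linarith,
        fun t x ht => image_eq_zero_of_notMem_tsupport fun hh => ?_⟩
      have h1 := hM (mem_image_of_mem _ hh)
      have h2 := le_max_left (M + 1) (τ + 1)
      simp only at h1
      linarith
    have hφτ : ∀ x, φ (τ, x) = 0 := fun x => image_eq_zero_of_notMem_tsupport fun hh =>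
      lt_irrefl τ (hφs hh).1
    have hdt : ∀ t x, T < t → dt φ (t, x) = 0 := fun t x ht => by
      refine (hasDerivAt_dt hφ t x).unique ((hasDerivAt_const t (0 : ℝ)).congr_of_eventuallyEq ?_)
      filter_upwards [lt_mem_nhds ht] with s hs
      exact hTφ s x hs.le
    have hreg : IsRegular e τ T (fun t x => φ (t, x)) (fun t x => dt φ (t, x))
        (fun t x => dx φ (t, x)) :=
      isRegular_of_hasDerivAt he hφ.continuous (contDiff_dt hφ).continuous (contDiff_dx hφ).continuous
        (hasDerivAt_dt hφ) (hasDerivAt_dx hφ)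
    have id1 := h.integral_identity hE hg₀ hreg hT lam
    simp only [hφτ, hTφ T _ le_rfl, mul_zero, integral_zero, sub_zero, Prod.mk.eta] at id1
    have hk' : Continuous fun z : ℝ × ℝ => k z.1 := hk.comp continuous_fst
    have hsub : volume.restrict (movingDomain e (Ioo τ T)) ≤
        volume.restrict (movingDomain e (Ioi τ)) :=
      Measure.restrict_mono (movingDomain_mono fun t ht => ht.1) le_rfl
    have i1 : IntegrableOn (fun z : ℝ × ℝ => w z * (k z.1 * (dt φ z - lam * φ z)))
        (movingDomain e (Ioo τ T)) :=
      (h.memLp he).integrable_mul (MemLp.continuous_mul_movingDomain he hk'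
        (hreg.memLp_t.sub (hreg.memLp.const_mul lam)))
    have i2 : IntegrableOn (fun z : ℝ × ℝ => w z * (k z.1 * φ z)) (movingDomain e (Ioo τ T)) :=
      (h.memLp he).integrable_mul (MemLp.continuous_mul_movingDomain he hk' hreg.memLp)
    have i3 : IntegrableOn (fun z : ℝ × ℝ => wx z * (k z.1 * dx φ z)) (movingDomain e (Ioo τ T)) :=
      (h.memLp_x.mono_measure hsub).integrable_mul
        (MemLp.continuous_mul_movingDomain he hk' hreg.memLp_x)
    have i4 : IntegrableOn (fun z : ℝ × ℝ => k z.1 * w z * dt φ z) (movingDomain e (Ioo τ T)) := by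
      refine (i1.add (i2.const_mul lam)).congr (Eventually.of_forall fun z => ?_)
      simp only [Pi.add_apply]
      ring
    have i5 : IntegrableOn (fun z : ℝ × ℝ => a z * φ z + b z * dx φ z)
        (movingDomain e (Ioo τ T)) := by
      refine ((i2.const_mul (-lam)).add (i3.const_mul (-σ))).congr (Eventually.of_forall fun z => ?_)
      simp only [Pi.add_apply, ha, hb]
      ring
    have hcut : ∀ f : ℝ × ℝ → ℝ, (∀ t x, T < t → f (t, x) = 0) →
        ∫ t in Ioi τ, ∫ x in Ioo 0 (e t), f (t, x) = ∫ t in Ioo τ T, ∫ x in Ioo 0 (e t), f (t, x) := by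
      intro f hf
      rw [← integral_Ioc_eq_integral_Ioo]
      refine setIntegral_eq_of_subset_of_forall_sdiff_eq_zero measurableSet_Ioi
        Ioc_subset_Ioi_self fun t ht => ?_
      have ht' : T < t := by
        by_contra hh
        exact ht.2 ⟨ht.1, not_lt.1 hh⟩
      simp [hf t _ ht']
    have e1 : ∫ t in Ioi τ, dualPair (e t) (fun x => a (t, x)) (fun x => b (t, x))
        (H1.ofSmooth (e t) (fun x => φ (t, x)) (contDiff_slice hφ t)) =
        ∫ t in Ioi τ, ∫ x in Ioo 0 (e t), (a (t, x) * φ (t, x) + b (t, x) * dx φ (t, x)) := by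
      refine integral_congr_ae ?_
      filter_upwards [hF] with t ht
      rw [ht _ (contDiff_slice hφ t), deriv_slice_dx hφ t]
    have e2 : ∀ t x, deriv (fun s => φ (s, x)) t = dt φ (t, x) := fun t x => (hasDerivAt_dt hφ t x).deriv
    have hdx : ∀ t x, T < t → dx φ (t, x) = 0 := fun t x ht => by
      refine (hasDerivAt_dx hφ t x).unique ((hasDerivAt_const x (0 : ℝ)).congr_of_eventuallyEq ?_)
      exact Eventually.of_forall fun y => hTφ t y ht.le
    rw [e1]
    simp only [e2]
    rw [hcut (fun z => k z.1 * w z * dt φ z) fun t x ht => by simp [hdt t x ht],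
      hcut (fun z => a z * φ z + b z * dx φ z) fun t x ht => by
        simp [hdx t x ht, hTφ t x ht.le],
      ← setIntegral_movingDomain he measurableSet_Ioo i4,
      ← setIntegral_movingDomain he measurableSet_Ioo i5]
    have e3 : ∫ z in movingDomain e (Ioo τ T), k z.1 * w z * dt φ z =
        (∫ z in movingDomain e (Ioo τ T), w z * (k z.1 * (dt φ z - lam * φ z))) +
          lam * ∫ z in movingDomain e (Ioo τ T), w z * (k z.1 * φ z) := by
      rw [← integral_const_mul, ← integral_add i1 (i2.const_mul lam)]
      refine integral_congr_ae (Eventually.of_forall fun z => ?_)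
      simp only
      ring
    have e4 : ∫ z in movingDomain e (Ioo τ T), a z * φ z + b z * dx φ z =
        -lam * (∫ z in movingDomain e (Ioo τ T), w z * (k z.1 * φ z)) +
          -σ * ∫ z in movingDomain e (Ioo τ T), wx z * (k z.1 * dx φ z) := by
      rw [← integral_const_mul, ← integral_const_mul,
        ← integral_add (i2.const_mul (-lam)) (i3.const_mul (-σ))]
      refine integral_congr_ae (Eventually.of_forall fun z => ?_)
      simp only [ha, hb]
      ring
    rw [e3, e4]
    linarith

end IsApproximated

end Solution

end MovingHeat

end

/-! ### Existence, uniqueness and decay. -/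

theorem proposition2 (e₀ vbar τ₁ σ lam : ℝ) (he₀ : 0 < e₀) (hvbar : 0 < vbar) (hτ₁ : 0 ≤ τ₁)
    (hσ : 0 < σ) (hlam : 0 < lam) (g₀ : ℝ → ℝ)
    (hg₀ : MemLp g₀ 2 (MovingHeat.leb (MovingHeat.thickness e₀ vbar τ₁))) :
    ∃ g : ℝ → ℝ → ℝ,
      MovingHeat.IsWeakL2Solution (MovingHeat.thickness e₀ vbar) τ₁ σ lam g₀ g ∧
      (∀ h : ℝ → ℝ → ℝ,
        MovingHeat.ContinuousInL2 (MovingHeat.thickness e₀ vbar) (Ici τ₁) h →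
        MovingHeat.WeakFormulation (MovingHeat.thickness e₀ vbar) τ₁ σ lam g₀ h →
        ∀ t : ℝ, τ₁ ≤ t → h t =ᵐ[MovingHeat.leb (MovingHeat.thickness e₀ vbar t)] g t) ∧
      ∀ t : ℝ, τ₁ ≤ t →
        eLpNorm (g t) 2 (MovingHeat.leb (MovingHeat.thickness e₀ vbar t)) ≤
          ENNReal.ofReal (Real.exp (-lam * (t - τ₁))) *
            eLpNorm g₀ 2 (MovingHeat.leb (MovingHeat.thickness e₀ vbar τ₁)) := by
  obtain ⟨E, hEs, hEpos, hEeq, hEd⟩ := MovingHeat.exists_smooth_thickness he₀ hvbar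
  have hE : MovingHeat.IsSmoothExtension (MovingHeat.thickness e₀ vbar) E vbar τ₁ :=
    ⟨MovingHeat.continuous_thickness e₀ vbar, hEs, hEpos, fun t ht => hEeq t (hτ₁.trans ht),
      fun t ht => hEd t (hτ₁.trans ht)⟩
  obtain ⟨w, wx, G, B, h⟩ := MovingHeat.exists_isApproximated he₀ hvbar hτ₁ hσ hE hg₀
  have hk : Continuous fun t : ℝ => Real.exp (-lam * (t - τ₁)) := by fun_prop
  have hc : MovingHeat.ContinuousInL2 (MovingHeat.thickness e₀ vbar) (Ici τ₁)
      fun t x => Real.exp (-lam * (t - τ₁)) * w (t, x) :=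
    (h.continuousInL2 hE.continuous he₀ fun t ht => by
      rw [MovingHeat.thickness]
      have := mul_nonneg (hτ₁.trans ht) hvbar.le
      linarith).continuous_mul hk
  have hw := h.weakFormulation hE hg₀ lam
  refine ⟨fun t x => Real.exp (-lam * (t - τ₁)) * w (t, x),
    ⟨hc, h.timeDerivInDual hE hvbar hσ hlam hg₀, hw⟩,
    fun f hf hfw t ht => MovingHeat.ae_eq_of_weakFormulation he₀ hvbar hτ₁ hσ hf hc hfw hw ht,
    fun t ht => ?_⟩
  have e1 : (fun x => Real.exp (-lam * (t - τ₁)) * w (t, x)) =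
      Real.exp (-lam * (t - τ₁)) • fun x => w (t, x) := rfl
  beta_reduce
  rw [e1, eLpNorm_const_smul, ← ofReal_norm, Real.norm_of_nonneg (Real.exp_pos _).le]
  gcongr
  exact h.eLpNorm_slice_le hE hvbar hσ hg₀ ht
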